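/- Let $\Omega\subset\mathbb R^3$ be a nonempty bounded convex open set with $C^2$ boundary and outward unit normal $n$, let $S^2$ be the unit sphere of $\mathbb R^3$, $\mathcal X=\Omega\times S^2$, $\tau>0$, $Q_\tau=(0,\tau)\times\Omega$, and $$\partial\Omega_\pm=\{(x,\beta)\in\partial\Omega\times S^2:\ \pm\,\beta\cdot n(x)>0\},\qquad L^2_\pm=L^2(\partial\Omega_\pm;\ \pm\beta\cdot n\,d\Gamma\,d\beta).$$ Let $W^{2,1}_2(Q_\tau)$ be the space of functions $T\in L^2(Q_\tau)$ whose weak derivatives $T_t,T_{x_i},T_{x_ix_j}$ belong to $L^2(Q_\tau)$, normed by the sum of the $L^2(Q_\tau)$-norms of $T$ and of these derivatives. Let $$\mathcal W=\{v\in L^2(\mathcal X):\ \beta\cdot\nabla_x v\in L^2(\mathcal X),\ v|_{\partial\Omega_+}\in L^2_+\},\qquad \|v\|_{\mathcal W}=\big(\|v\|_{L^2(\mathcal X)}^2+\|\beta\cdot\nabla_xv\|_{L^2(\mathcal X)}^2+\|v|_{\partial\Omega_+}\|_{L^2_+}^2\big)^{1/2},$$ where $\beta\cdot\nabla_xv$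 is taken in the sense of distributions and the traces on $\partial\Omega_\pm$ are defined by Green's formula $$\int_{\mathcal X}(\beta\cdot\nabla_xv)\varphi+\int_{\mathcal X}v\,(\beta\cdot\nabla_x\varphi)=\int_{\partial\Omega_\pm}(\beta\cdot n)\,v\,\varphi\,d\Gamma\,d\beta$$ for all $\varphi\in C_c^\infty(\mathbb R^3\times\mathbb R^3)$ whose support meets $\partial\Omega\times S^2$ only inside $\partial\Omega_\pm$. **Theorem.** There is a constant $C=C(\tau,\Omega)>0$ such that for every $T\in W^{2,1}_2(Q_\tau)$ and every nonnegative $I_b\in L^2(0,\tau;L^2_-)$, the problem $$I+\beta\cdot\nabla_xI=T^4\ \text{ in }(0,\tau)\times\mathcal X,\qquad I=I_b\ \text{ on }(0,\tau)\times\partial\Omega_-$$ has exactly one solution $I\in L^2(0,\tau;\mathcal W)$ (both equations being required for almost every $t\in(0,\tau)$). This solution is nonnegative, and $$\|I\|_{L^2(0,\tau;\mathcal W)}\le C\left(\|T\|^4_{W^{2,1}_2(Q_\tau)}+\|I_b\|_{L^2(0,\tau;L^2_-)}\right).$$ -/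

import Mathlib

open MeasureTheory Set Filter Topology
open scoped ENNReal ContDiff

namespace RadTransfer

noncomputable section

/-- The physical space `ℝ³` with its Euclidean norm. -/
abbrev E3 : Type := EuclideanSpace ℝ (Fin 3)

/-- The unit sphere `S²` of directions. -/
abbrev Dir : Type := Metric.sphere (0 : E3) 1

/-! ### Domains with `C²` boundary and their outer normal -/

/-- `ρ` is a local `C²` defining function of `Ω` at the boundary point `x`: near `x` the set `Ω` is
`{ρ < 0}`, with `ρ x = 0` and `∇ρ x ≠ 0`. -/
def IsC2DefiningFunction (Ω : Set E3) (x : E3) (ρ : E3 → ℝ) : Prop :=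
  ContDiffAt ℝ 2 ρ x ∧ ρ x = 0 ∧ gradient ρ x ≠ 0 ∧ ∀ᶠ y in 𝓝 x, (y ∈ Ω ↔ ρ y < 0)

/-- Bounded convex domains of `ℝ³` with `C²` boundary. -/
structure IsC2ConvexDomain (Ω : Set E3) : Prop where
  isOpen : IsOpen Ω
  nonempty : Ω.Nonempty
  convex : Convex ℝ Ω
  isBounded : Bornology.IsBounded Ω
  c2_boundary : ∀ x ∈ frontier Ω, ∃ ρ : E3 → ℝ, IsC2DefiningFunction Ω x ρ

/-- `ν` is the outward unit normal to `∂Ω` at `x`. -/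
def IsOuterNormal (Ω : Set E3) (x ν : E3) : Prop :=
  ∃ ρ : E3 → ℝ, IsC2DefiningFunction Ω x ρ ∧ ν = ‖gradient ρ x‖⁻¹ • gradient ρ x

open Classical in
/-- The outward unit normal field `n` of `∂Ω`; it does not depend on the defining function. -/
def outerNormal (Ω : Set E3) (x : E3) : E3 :=
  if h : ∃ ν, IsOuterNormal Ω x ν then h.choose else 0

/-! ### The measures -/

/-- The Lebesgue measure on the time interval `(0, τ)`. -/
def timeMeasure (τ : ℝ) : Measure ℝ := volume.restrict (Ioo 0 τ)

/-- The surface measure `dβ` of the unit sphere (total mass `4π`). -/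
def dirMeasure : Measure Dir := (volume : Measure E3).toSphere

/-- The measure `dx dβ` on `𝒳 = Ω × S²`. -/
def phaseMeasure (Ω : Set E3) : Measure (E3 × Dir) := (volume.restrict Ω).prod dirMeasure

/-- The surface measure `dΓ` of `∂Ω`: the two-dimensional Hausdorff measure, normalized so that it is
the usual area. -/
def surfaceMeasure (Ω : Set E3) : Measure E3 :=
  (Measure.euclideanHausdorffMeasure 2).restrict (frontier Ω)

/-- For `s = 1` the outflow part `∂Ω₊ = {(x, β) ∈ ∂Ω × S² : β·n > 0}` and for `s = -1` the inflow
part `∂Ω₋ = {(x, β) ∈ ∂Ω × S² : β·n < 0}`. -/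
def boundaryPart (Ω : Set E3) (s : ℝ) : Set (E3 × Dir) :=
  {z | z.1 ∈ frontier Ω ∧ 0 < s * inner ℝ (z.2 : E3) (outerNormal Ω z.1)}

/-- The measure `|β·n| dΓ dβ` on `∂Ω₊` (`s = 1`) or `∂Ω₋` (`s = -1`). -/
def boundaryMeasure (Ω : Set E3) (s : ℝ) : Measure (E3 × Dir) :=
  (((surfaceMeasure Ω).prod dirMeasure).restrict (boundaryPart Ω s)).withDensity
    fun z => ENNReal.ofReal (s * inner ℝ (z.2 : E3) (outerNormal Ω z.1))

/-- `L²(𝒳)`. -/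
abbrev L2Phase (Ω : Set E3) : Type := Lp ℝ 2 (phaseMeasure Ω)

/-- `L²₊ = L²(∂Ω₊; β·n dΓ dβ)`. -/
abbrev L2Plus (Ω : Set E3) : Type := Lp ℝ 2 (boundaryMeasure Ω 1)

/-- `L²₋ = L²(∂Ω₋; -β·n dΓ dβ)`. -/
abbrev L2Minus (Ω : Set E3) : Type := Lp ℝ 2 (boundaryMeasure Ω (-1))

/-! ### The directional derivative `β·∇ₓ` and traces -/

/-- The classical `β·∇ₓφ` of a smooth `φ : ℝ³ × ℝ³ → ℝ`, at a point of `ℝ³ × S²`. -/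
def dirDeriv (φ : E3 × E3 → ℝ) (z : E3 × Dir) : ℝ :=
  fderiv ℝ φ (z.1, (z.2 : E3)) ((z.2 : E3), 0)

/-- `β·∇ₓ v = d` in the sense of distributions on `Ω × S²`. -/
def IsWeakDirDeriv (Ω : Set E3) (v d : E3 × Dir → ℝ) : Prop :=
  ∀ φ : E3 × E3 → ℝ, ContDiff ℝ ∞ φ → HasCompactSupport φ → tsupport φ ⊆ Ω ×ˢ univ →
    Integrable (fun z => v z * dirDeriv φ z) (phaseMeasure Ω) ∧
    Integrable (fun z => d z * φ (z.1, (z.2 : E3))) (phaseMeasure Ω) ∧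
    ∫ z, v z * dirDeriv φ z ∂(phaseMeasure Ω)
      = -∫ z, d z * φ (z.1, (z.2 : E3)) ∂(phaseMeasure Ω)

/-- `γ` is the trace on `∂Ω₊` (`s = 1`) or on `∂Ω₋` (`s = -1`) of a function `v` with `β·∇ₓ v = d`:
Green's formula holds for all smooth test functions whose support meets `∂Ω × S²` only inside that
part of the boundary. -/
def IsTrace (Ω : Set E3) (s : ℝ) (v d γ : E3 × Dir → ℝ) : Prop :=
  ∀ φ : E3 × E3 → ℝ, ContDiff ℝ ∞ φ → HasCompactSupport φ →
    (∀ x ∈ frontier Ω, ∀ β : Dir, (x, (β : E3)) ∈ tsupport φ → (x, β) ∈ boundaryPart Ω s) →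
    Integrable (fun z => v z * dirDeriv φ z) (phaseMeasure Ω) ∧
    Integrable (fun z => d z * φ (z.1, (z.2 : E3))) (phaseMeasure Ω) ∧
    Integrable (fun z => γ z * φ (z.1, (z.2 : E3))) (boundaryMeasure Ω s) ∧
    ∫ z, d z * φ (z.1, (z.2 : E3)) ∂(phaseMeasure Ω) + ∫ z, v z * dirDeriv φ z ∂(phaseMeasure Ω)
      = s * ∫ z, γ z * φ (z.1, (z.2 : E3)) ∂(boundaryMeasure Ω s)

/-! ### The space `𝒲` -/

theorem integrable_add_mul {α : Type*} [MeasurableSpace α] {μ : Measure α} {f g h : α → ℝ}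
    {k : α → ℝ} (hh : h =ᵐ[μ] f + g) (hf : Integrable (fun z => f z * k z) μ)
    (hg : Integrable (fun z => g z * k z) μ) :
    Integrable (fun z => h z * k z) μ ∧
      ∫ z, h z * k z ∂μ = ∫ z, f z * k z ∂μ + ∫ z, g z * k z ∂μ := by
  have e : (fun z => f z * k z + g z * k z) =ᵐ[μ] fun z => h z * k z := by
    filter_upwards [hh] with z hz
    rw [hz, Pi.add_apply, add_mul]
  exact ⟨(hf.add hg).congr e, by rw [← integral_congr_ae e, integral_add hf hg]⟩

theorem integrable_smul_mul {α : Type*} [MeasurableSpace α] {μ : Measure α} {f h : α → ℝ}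
    {k : α → ℝ} {c : ℝ} (hh : h =ᵐ[μ] c • f) (hf : Integrable (fun z => f z * k z) μ) :
    Integrable (fun z => h z * k z) μ ∧ ∫ z, h z * k z ∂μ = c * ∫ z, f z * k z ∂μ := by
  have e : (fun z => c * (f z * k z)) =ᵐ[μ] fun z => h z * k z := by
    filter_upwards [hh] with z hz
    rw [hz, Pi.smul_apply, smul_eq_mul, mul_assoc]
  exact ⟨(hf.const_mul c).congr e, by rw [← integral_congr_ae e, integral_const_mul]⟩

theorem integrable_zero_mul {α : Type*} [MeasurableSpace α] {μ : Measure α} {h : α → ℝ}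
    {k : α → ℝ} (hh : h =ᵐ[μ] 0) :
    Integrable (fun z => h z * k z) μ ∧ ∫ z, h z * k z ∂μ = 0 := by
  have e : (fun _ => (0 : ℝ)) =ᵐ[μ] fun z => h z * k z := by
    filter_upwards [hh] with z hz
    rw [hz, Pi.zero_apply, zero_mul]
  exact ⟨(integrable_zero _ _ _).congr e, by rw [← integral_congr_ae e, integral_zero]⟩

theorem IsWeakDirDeriv.add {Ω : Set E3} {v₁ v₂ v d₁ d₂ d : E3 × Dir → ℝ}
    (h₁ : IsWeakDirDeriv Ω v₁ d₁) (h₂ : IsWeakDirDeriv Ω v₂ d₂)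
    (hv : v =ᵐ[phaseMeasure Ω] v₁ + v₂) (hd : d =ᵐ[phaseMeasure Ω] d₁ + d₂) :
    IsWeakDirDeriv Ω v d := by
  intro φ h h' h''
  obtain ⟨a₁, b₁, c₁⟩ := h₁ φ h h' h''
  obtain ⟨a₂, b₂, c₂⟩ := h₂ φ h h' h''
  obtain ⟨a, a'⟩ := integrable_add_mul hv a₁ a₂
  obtain ⟨b, b'⟩ := integrable_add_mul hd b₁ b₂
  exact ⟨a, b, by rw [a', b']; linarith⟩

theorem IsWeakDirDeriv.smul {Ω : Set E3} {v₁ v d₁ d : E3 × Dir → ℝ} {c : ℝ}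
    (h₁ : IsWeakDirDeriv Ω v₁ d₁)
    (hv : v =ᵐ[phaseMeasure Ω] c • v₁) (hd : d =ᵐ[phaseMeasure Ω] c • d₁) :
    IsWeakDirDeriv Ω v d := by
  intro φ h h' h''
  obtain ⟨a₁, b₁, c₁⟩ := h₁ φ h h' h''
  obtain ⟨a, a'⟩ := integrable_smul_mul hv a₁
  obtain ⟨b, b'⟩ := integrable_smul_mul hd b₁
  exact ⟨a, b, by rw [a', b', c₁]; ring⟩

theorem IsWeakDirDeriv.zero {Ω : Set E3} {v d : E3 × Dir → ℝ}
    (hv : v =ᵐ[phaseMeasure Ω] 0) (hd : d =ᵐ[phaseMeasure Ω] 0) : IsWeakDirDeriv Ω v d := by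
  intro φ _ _ _
  obtain ⟨a, a'⟩ := integrable_zero_mul (k := dirDeriv φ) hv
  obtain ⟨b, b'⟩ := integrable_zero_mul (k := fun z : E3 × Dir => φ (z.1, (z.2 : E3))) hd
  exact ⟨a, b, by rw [a', b', neg_zero]⟩

theorem IsTrace.add {Ω : Set E3} {s : ℝ} {v₁ v₂ v d₁ d₂ d γ₁ γ₂ γ : E3 × Dir → ℝ}
    (h₁ : IsTrace Ω s v₁ d₁ γ₁) (h₂ : IsTrace Ω s v₂ d₂ γ₂)
    (hv : v =ᵐ[phaseMeasure Ω] v₁ + v₂) (hd : d =ᵐ[phaseMeasure Ω] d₁ + d₂)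
    (hγ : γ =ᵐ[boundaryMeasure Ω s] γ₁ + γ₂) : IsTrace Ω s v d γ := by
  intro φ h h' h''
  obtain ⟨a₁, b₁, e₁, c₁⟩ := h₁ φ h h' h''
  obtain ⟨a₂, b₂, e₂, c₂⟩ := h₂ φ h h' h''
  obtain ⟨a, a'⟩ := integrable_add_mul hv a₁ a₂
  obtain ⟨b, b'⟩ := integrable_add_mul hd b₁ b₂
  obtain ⟨e, e'⟩ := integrable_add_mul hγ e₁ e₂
  exact ⟨a, b, e, by rw [a', b', e', mul_add]; linarith⟩

theorem IsTrace.smul {Ω : Set E3} {s : ℝ} {v₁ v d₁ d γ₁ γ : E3 × Dir → ℝ} {c : ℝ}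
    (h₁ : IsTrace Ω s v₁ d₁ γ₁)
    (hv : v =ᵐ[phaseMeasure Ω] c • v₁) (hd : d =ᵐ[phaseMeasure Ω] c • d₁)
    (hγ : γ =ᵐ[boundaryMeasure Ω s] c • γ₁) : IsTrace Ω s v d γ := by
  intro φ h h' h''
  obtain ⟨a₁, b₁, e₁, c₁⟩ := h₁ φ h h' h''
  obtain ⟨a, a'⟩ := integrable_smul_mul hv a₁
  obtain ⟨b, b'⟩ := integrable_smul_mul hd b₁
  obtain ⟨e, e'⟩ := integrable_smul_mul hγ e₁
  exact ⟨a, b, e, by rw [a', b', e', ← mul_add, c₁]; ring⟩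

theorem IsTrace.zero {Ω : Set E3} {s : ℝ} {v d γ : E3 × Dir → ℝ}
    (hv : v =ᵐ[phaseMeasure Ω] 0) (hd : d =ᵐ[phaseMeasure Ω] 0)
    (hγ : γ =ᵐ[boundaryMeasure Ω s] 0) : IsTrace Ω s v d γ := by
  intro φ _ _ _
  obtain ⟨a, a'⟩ := integrable_zero_mul (k := dirDeriv φ) hv
  obtain ⟨b, b'⟩ := integrable_zero_mul (k := fun z : E3 × Dir => φ (z.1, (z.2 : E3))) hd
  obtain ⟨e, e'⟩ := integrable_zero_mul (k := fun z : E3 × Dir => φ (z.1, (z.2 : E3))) hγ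
  exact ⟨a, b, e, by rw [a', b', e', add_zero, mul_zero]⟩

/-- `𝒲 = {v ∈ L²(𝒳) : β·∇ₓ v ∈ L²(𝒳), v|_{∂Ω₊} ∈ L²₊}` with its Hilbert norm
`(‖v‖² + ‖β·∇ₓ v‖² + ‖v|_{∂Ω₊}‖²)^{1/2}`.  An element is stored as the triple
`(v, β·∇ₓ v, v|_{∂Ω₊})`, whose last two entries are determined by `v`. -/
def transportSpace (Ω : Set E3) :
    Submodule ℝ (WithLp 2 (L2Phase Ω × WithLp 2 (L2Phase Ω × L2Plus Ω))) where
  carrier := {w | IsWeakDirDeriv Ω w.fst w.snd.fst ∧ IsTrace Ω 1 w.fst w.snd.fst w.snd.snd}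
  add_mem' {w w'} h h' :=
    ⟨h.1.add h'.1 (Lp.coeFn_add w.fst w'.fst) (Lp.coeFn_add w.snd.fst w'.snd.fst),
      h.2.add h'.2 (Lp.coeFn_add w.fst w'.fst) (Lp.coeFn_add w.snd.fst w'.snd.fst)
        (Lp.coeFn_add w.snd.snd w'.snd.snd)⟩
  zero_mem' :=
    ⟨.zero (Lp.coeFn_zero ℝ 2 _) (Lp.coeFn_zero ℝ 2 _),
      .zero (Lp.coeFn_zero ℝ 2 _) (Lp.coeFn_zero ℝ 2 _) (Lp.coeFn_zero ℝ 2 _)⟩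
  smul_mem' c w h :=
    ⟨h.1.smul (Lp.coeFn_smul c w.fst) (Lp.coeFn_smul c w.snd.fst),
      h.2.smul (Lp.coeFn_smul c w.fst) (Lp.coeFn_smul c w.snd.fst) (Lp.coeFn_smul c w.snd.snd)⟩

/-- The function `v` underlying an element of `𝒲`. -/
def fn {Ω : Set E3} (w : transportSpace Ω) : L2Phase Ω := w.1.fst

/-- The directional derivative `β·∇ₓ v` of an element of `𝒲`. -/
def dirD {Ω : Set E3} (w : transportSpace Ω) : L2Phase Ω := w.1.snd.fst

/-- The trace `v|_{∂Ω₊}` of an element of `𝒲`. -/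
def outTrace {Ω : Set E3} (w : transportSpace Ω) : L2Plus Ω := w.1.snd.snd

theorem norm_sq_eq {Ω : Set E3} (w : transportSpace Ω) :
    ‖w‖ ^ 2 = ‖fn w‖ ^ 2 + ‖dirD w‖ ^ 2 + ‖outTrace w‖ ^ 2 := by
  have h : ‖w‖ = ‖w.1‖ := rfl
  rw [h, WithLp.prod_norm_sq_eq_of_L2, WithLp.prod_norm_sq_eq_of_L2, ← add_assoc]
  rfl

/-! ### The parabolic Sobolev space `W^{2,1}_2(Q_τ)` -/

/-- The cylinder `Q_τ = (0, τ) × Ω`. -/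
def cylinder (Ω : Set E3) (τ : ℝ) : Set (ℝ × E3) := Ioo 0 τ ×ˢ Ω

/-- `g ∈ L²(U)` is the weak derivative in the direction `e` of `u` on the open set `U`. -/
def IsL2WeakDeriv (U : Set (ℝ × E3)) (e : ℝ × E3) (u g : ℝ × E3 → ℝ) : Prop :=
  MemLp g 2 (volume.restrict U) ∧
  ∀ φ : ℝ × E3 → ℝ, ContDiff ℝ ∞ φ → HasCompactSupport φ → tsupport φ ⊆ U →
    ∫ p in U, u p * fderiv ℝ φ p e = -∫ p in U, g p * φ p

/-- `u` has a weak derivative in the direction `e` which belongs to `L²(U)`. -/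
def HasL2WeakDeriv (U : Set (ℝ × E3)) (e : ℝ × E3) (u : ℝ × E3 → ℝ) : Prop :=
  ∃ g, IsL2WeakDeriv U e u g

open Classical in
/-- The weak derivative in the direction `e` (unique almost everywhere on `U`). -/
def weakDeriv (U : Set (ℝ × E3)) (e : ℝ × E3) (u : ℝ × E3 → ℝ) : ℝ × E3 → ℝ :=
  if h : HasL2WeakDeriv U e u then h.choose else 0

/-- The time direction in `ℝ × ℝ³`. -/
def dirT : ℝ × E3 := (1, 0)

/-- The `i`-th spatial direction in `ℝ × ℝ³`. -/
def dirX (i : Fin 3) : ℝ × E3 := (0, EuclideanSpace.single i 1)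

/-- `T ∈ W^{2,1}_2(Q_τ)`: `T`, `T_t`, `T_{x_i}` and `T_{x_i x_j}` belong to `L²(Q_τ)`. -/
structure MemW21 (Ω : Set E3) (τ : ℝ) (T : ℝ × E3 → ℝ) : Prop where
  memLp : MemLp T 2 (volume.restrict (cylinder Ω τ))
  time : HasL2WeakDeriv (cylinder Ω τ) dirT T
  space : ∀ i, HasL2WeakDeriv (cylinder Ω τ) (dirX i) T
  space_space : ∀ i j, HasL2WeakDeriv (cylinder Ω τ) (dirX j) (weakDeriv (cylinder Ω τ) (dirX i) T)

/-- The `L²(Q_τ)` norm. -/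
def normL2Q (Ω : Set E3) (τ : ℝ) (u : ℝ × E3 → ℝ) : ℝ :=
  (eLpNorm u 2 (volume.restrict (cylinder Ω τ))).toReal

/-- The norm of `W^{2,1}_2(Q_τ)`. -/
def normW21 (Ω : Set E3) (τ : ℝ) (T : ℝ × E3 → ℝ) : ℝ :=
  normL2Q Ω τ T + normL2Q Ω τ (weakDeriv (cylinder Ω τ) dirT T)
    + ∑ i, normL2Q Ω τ (weakDeriv (cylinder Ω τ) (dirX i) T)
    + ∑ i, ∑ j, normL2Q Ω τ
        (weakDeriv (cylinder Ω τ) (dirX j) (weakDeriv (cylinder Ω τ) (dirX i) T))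

/-! ### The transport problem -/

/-- `I ∈ L²(0, τ; 𝒲)` solves `I + β·∇ₓ I = T⁴` in `(0, τ) × 𝒳` with `I = I_b` on
`(0, τ) × ∂Ω₋`. -/
def IsSolution (Ω : Set E3) (τ : ℝ) (T : ℝ × E3 → ℝ) (Ib : Lp (L2Minus Ω) 2 (timeMeasure τ))
    (I : Lp (transportSpace Ω) 2 (timeMeasure τ)) : Prop :=
  ∀ᵐ t ∂(timeMeasure τ),
    (∀ᵐ z ∂(phaseMeasure Ω), fn (I t) z + dirD (I t) z = T (t, z.1) ^ 4) ∧
    IsTrace Ω (-1) (fn (I t)) (dirD (I t)) (Ib t)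

end

end RadTransfer

namespace RadTransfer

open scoped NNReal

noncomputable section

/-! ### Supporting normals of a convex domain with `C²` boundary -/

/-! For fixed time the equation is an ordinary differential equation `u' + u = F` along each chord
of `Ω` in the direction `β`, with `u` prescribed at the entry point; Duhamel's formula solves it
(`transportSol`). Existence, the `L²` bounds and Green's formula then follow by integrating over all
chords, and positivity is visible in the formula.

Integrating over chords needs one geometric fact: on the part of the boundary where `β` enters,
`|β·n| dΓ` is the planar area of the projection along `β` (`fluxMeasure_apply`). Here `dΓ` is a
Hausdorff measure, so there is no chart to compute in. Instead, convexity and continuity of the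
normal make the oblique projection to a tangent plane locally bi-Lipschitz with constant `K` as
close to `1` as desired, the planar case is a determinant, and `K → 1` gives equality. It follows
that phase space with `dx dβ` is the space of chords with `|β·n| dΓ dβ ds`
(`measurePreserving_flow`), and that passing from entry to exit point preserves the boundary
measures (`measurePreserving_exitPoint`).

Uniqueness is by duality (`eq_zero_of_solves_zero`): the adjoint equation with a smooth right-hand
side is solved explicitly by a test function admissible in the inflow Green formula. The stationary
problem thus has a bounded linear solution operator (`exists_solution_operator`), which is applied
at almost every time.

It remains to see that `T⁴` is square integrable, that is, `T ∈ L⁸` (`parabolic_sobolev`). The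
parabolic dimension of the cylinder is `5`, so two parabolic derivatives in `L²` leave room for the
exponent `8 < 10`. No extension of `T` beyond the cylinder is used: by convexity, a kernel supported
in the cylinder stays there when it is contracted parabolically towards a point `p`. Means of first
order Taylor polynomials of `T` against these kernels tend to `T` as the scale tends to zero, and
their derivative in the scale involves only `T_t` and the second space derivatives. Integrating over
scales bounds `|T|` by a potential of parabolic order two, which is estimated in `L⁸`. Finally
`exists_curry_Lp` turns the scalar function `T⁴` into a measurable function of time with values in
`L²(𝒳)`. -/

theorem IsC2DefiningFunction.hasGradientAt {Ω : Set E3} {x : E3} {ρ : E3 → ℝ}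
    (h : IsC2DefiningFunction Ω x ρ) : HasGradientAt ρ (gradient ρ x) x :=
  (h.1.differentiableAt (by norm_num)).hasGradientAt

theorem IsC2DefiningFunction.hasDerivAt_line {Ω : Set E3} {x : E3} {ρ : E3 → ℝ}
    (h : IsC2DefiningFunction Ω x ρ) (v : E3) :
    HasDerivAt (fun t : ℝ => ρ (x + t • v)) (inner ℝ (gradient ρ x) v) 0 := by
  have h1 : HasFDerivAt ρ (InnerProductSpace.toDual ℝ E3 (gradient ρ x)) (x + (0 : ℝ) • v) := by
    simpa using h.hasGradientAt.hasFDerivAt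
  have h2 : HasDerivAt (fun t : ℝ => x + t • v) v 0 := by
    simpa using ((hasDerivAt_id (0 : ℝ)).smul_const v).const_add x
  exact h1.comp_hasDerivAt (0 : ℝ) h2

theorem IsC2DefiningFunction.eventually_mem {Ω : Set E3} {x : E3} {ρ : E3 → ℝ}
    (h : IsC2DefiningFunction Ω x ρ) {v : E3} (hv : inner ℝ (gradient ρ x) v < 0) :
    ∀ᶠ t : ℝ in 𝓝[>] 0, x + t • v ∈ Ω := by
  have h1 : ∀ᶠ t : ℝ in 𝓝[>] 0, slope (fun t : ℝ => ρ (x + t • v)) 0 t < 0 :=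
    ((hasDerivAt_iff_tendsto_slope.1 (h.hasDerivAt_line v)).mono_left
      (nhdsWithin_mono _ fun t ht => ne_of_gt ht)).eventually (gt_mem_nhds hv)
  have h2 : Tendsto (fun t : ℝ => x + t • v) (𝓝[>] 0) (𝓝 x) := by
    have : ContinuousAt (fun t : ℝ => x + t • v) 0 := by fun_prop
    simpa using this.tendsto.mono_left nhdsWithin_le_nhds
  filter_upwards [h1, h2.eventually h.2.2.2, self_mem_nhdsWithin] with t h3 h4 (h5 : 0 < t)
  rw [h4]
  simp only [slope_def_field, zero_smul, add_zero, h.2.1, sub_zero] at h3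
  by_contra! h6
  exact absurd h3 (not_lt.2 (div_nonneg h6 h5.le))

/-- A positive derivative towards `y` would make `ρ` positive just after `x`, whereas the segment
from `x` to the interior point `y` lies in `Ω` apart from `x`. -/
theorem IsC2DefiningFunction.inner_nonpos {Ω : Set E3} (hΩ : IsC2ConvexDomain Ω) {x : E3}
    {ρ : E3 → ℝ} (h : IsC2DefiningFunction Ω x ρ) (hx : x ∈ frontier Ω) {y : E3} (hy : y ∈ Ω) :
    inner ℝ (gradient ρ x) (y - x) ≤ 0 := by
  by_contra! h0
  have h1 : ∀ᶠ t : ℝ in 𝓝[>] 0, 0 < slope (fun t : ℝ => ρ (x + t • (y - x))) 0 t :=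
    ((hasDerivAt_iff_tendsto_slope.1 (h.hasDerivAt_line (y - x))).mono_left
      (nhdsWithin_mono _ fun t ht => ne_of_gt ht)).eventually (lt_mem_nhds h0)
  have h2 : Tendsto (fun t : ℝ => x + t • (y - x)) (𝓝[>] 0) (𝓝 x) := by
    have : ContinuousAt (fun t : ℝ => x + t • (y - x)) 0 := by fun_prop
    simpa using this.tendsto.mono_left nhdsWithin_le_nhds
  have h3 : ∀ᶠ t : ℝ in 𝓝[>] 0, t ≤ 1 :=
    nhdsWithin_le_nhds (eventually_le_nhds one_pos)
  obtain ⟨t, h1, h2, h3, h4 : 0 < t⟩ :=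
    (h1.and ((h2.eventually h.2.2.2).and (h3.and self_mem_nhdsWithin))).exists
  have hm : x + t • (y - x) ∈ interior Ω :=
    hΩ.convex.add_smul_sub_mem_interior' (frontier_subset_closure hx)
      (by rwa [hΩ.isOpen.interior_eq]) ⟨h4, h3⟩
  rw [hΩ.isOpen.interior_eq, h2] at hm
  simp only [slope_def_field, zero_smul, add_zero, h.2.1, sub_zero] at h1
  exact absurd h1 (not_lt.2 (div_nonpos_of_nonpos_of_nonneg hm.le h4.le))

/-- Every direction `v` with `⟨n, v⟩ < 0` enters `Ω`, so a supporting vector `u` has `⟨u, v⟩ ≤ 0`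
for all of them; two unit vectors related in this way coincide. This is the source of both the
independence of `n` from `ρ` and its continuity. -/
theorem IsC2DefiningFunction.eq_of_supporting {Ω : Set E3} {x : E3} {ρ : E3 → ℝ}
    (h : IsC2DefiningFunction Ω x ρ) {u : E3} (hu : ‖u‖ = 1)
    (hs : ∀ y ∈ Ω, inner ℝ u (y - x) ≤ 0) : u = ‖gradient ρ x‖⁻¹ • gradient ρ x := by
  set g := gradient ρ x with hg
  have hg0 : 0 < ‖g‖ := norm_pos_iff.2 h.2.2.1
  obtain ⟨n, hn⟩ : ∃ n, n = ‖g‖⁻¹ • g := ⟨_, rfl⟩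
  rw [← hn]
  have hn1 : ‖n‖ = 1 := by rw [hn, norm_smul, norm_inv, norm_norm, inv_mul_cancel₀ hg0.ne']
  have key : ∀ v : E3, inner ℝ n v < 0 → inner ℝ u v ≤ 0 := by
    intro v hv
    have hv' : inner ℝ g v < 0 := by
      rw [hn, real_inner_smul_left] at hv
      by_contra! h0
      exact absurd hv (not_lt.2 (by positivity))
    obtain ⟨t, ht, ht0 : 0 < t⟩ := ((h.eventually_mem hv').and self_mem_nhdsWithin).exists
    have := hs _ ht
    rw [add_sub_cancel_left, real_inner_smul_right] at this
    by_contra! h0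
    exact absurd this (not_le.2 (by positivity))
  have hnn : inner ℝ n n = (1 : ℝ) := by rw [real_inner_self_eq_norm_sq, hn1]; norm_num
  have huu : inner ℝ u u = (1 : ℝ) := by rw [real_inner_self_eq_norm_sq, hu]; norm_num
  set c : ℝ := inner ℝ u n with hc
  have hc' : inner ℝ n u = c := real_inner_comm _ _
  have hc0 : 0 ≤ c := by
    have := key (-n) (by rw [inner_neg_right, hnn]; norm_num)
    rw [inner_neg_right] at this
    linarith
  have hc1 : c ≤ 1 := by
    have := real_inner_le_norm u n
    rwa [hu, hn1, one_mul] at this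
  have hc2 : c = 1 := by
    by_contra hne
    have hlt : c < 1 := lt_of_le_of_ne hc1 hne
    have hpos : 0 < 1 - c ^ 2 := by nlinarith
    -- The component of `u` orthogonal to `n`, tilted slightly inwards. Its product with `n` is `-(1
    -- - c²)/2 < 0`, its product with `u` is `(1 - c²)(1 - c/2) > 0`.
    have := key (u - c • n - ((1 - c ^ 2) / 2) • n) (by
      rw [inner_sub_right, inner_sub_right, real_inner_smul_right, real_inner_smul_right, hnn, hc']
      linarith)
    rw [inner_sub_right, inner_sub_right, real_inner_smul_right, real_inner_smul_right, huu,
      ← hc] at this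
    nlinarith
  exact (inner_eq_one_iff_of_norm_eq_one hu hn1).1 hc2

theorem isOuterNormal_outerNormal {Ω : Set E3} (hΩ : IsC2ConvexDomain Ω) {x : E3}
    (hx : x ∈ frontier Ω) : IsOuterNormal Ω x (outerNormal Ω x) := by
  obtain ⟨ρ, hρ⟩ := hΩ.c2_boundary x hx
  have h : ∃ ν, IsOuterNormal Ω x ν := ⟨_, ρ, hρ, rfl⟩
  rw [outerNormal, dif_pos h]
  exact h.choose_spec

theorem norm_outerNormal {Ω : Set E3} (hΩ : IsC2ConvexDomain Ω) {x : E3}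
    (hx : x ∈ frontier Ω) : ‖outerNormal Ω x‖ = 1 := by
  obtain ⟨ρ, hρ, h⟩ := isOuterNormal_outerNormal hΩ hx
  rw [h, norm_smul, norm_inv, norm_norm, inv_mul_cancel₀ (norm_pos_iff.2 hρ.2.2.1).ne']

/-- The inequality is strict because `Ω` is open: `y` can still be moved a little along the normal.
-/
theorem inner_outerNormal_neg {Ω : Set E3} (hΩ : IsC2ConvexDomain Ω) {x : E3}
    (hx : x ∈ frontier Ω) {y : E3} (hy : y ∈ Ω) : inner ℝ (outerNormal Ω x) (y - x) < 0 := by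
  have hle : ∀ z ∈ Ω, inner ℝ (outerNormal Ω x) (z - x) ≤ 0 := by
    obtain ⟨ρ, hρ, h⟩ := isOuterNormal_outerNormal hΩ hx
    intro z hz
    rw [h, real_inner_smul_left]
    exact mul_nonpos_of_nonneg_of_nonpos (by positivity) (hρ.inner_nonpos hΩ hx hz)
  have h2 : Tendsto (fun t : ℝ => y + t • outerNormal Ω x) (𝓝[>] 0) (𝓝 y) := by
    have : ContinuousAt (fun t : ℝ => y + t • outerNormal Ω x) 0 := by fun_prop
    simpa using this.tendsto.mono_left nhdsWithin_le_nhds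
  obtain ⟨t, ht, ht0 : 0 < t⟩ :=
    ((h2.eventually (hΩ.isOpen.mem_nhds hy)).and self_mem_nhdsWithin).exists
  have := hle _ ht
  rw [add_sub_right_comm, inner_add_right, real_inner_smul_right, real_inner_self_eq_norm_sq,
    norm_outerNormal hΩ hx] at this
  linarith

theorem inner_outerNormal_nonpos {Ω : Set E3} (hΩ : IsC2ConvexDomain Ω) {x : E3}
    (hx : x ∈ frontier Ω) {y : E3} (hy : y ∈ closure Ω) :
    inner ℝ (outerNormal Ω x) (y - x) ≤ 0 := by
  have hc : IsClosed {z : E3 | inner ℝ (outerNormal Ω x) (z - x) ≤ 0} :=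
    isClosed_le (by fun_prop) continuous_const
  exact closure_minimal (fun z hz => (inner_outerNormal_neg hΩ hx hz).le) hc hy

theorem eq_outerNormal {Ω : Set E3} (hΩ : IsC2ConvexDomain Ω) {x : E3}
    (hx : x ∈ frontier Ω) {u : E3} (hu : ‖u‖ = 1) (hs : ∀ y ∈ Ω, inner ℝ u (y - x) ≤ 0) :
    u = outerNormal Ω x := by
  obtain ⟨ρ, hρ, h⟩ := isOuterNormal_outerNormal hΩ hx
  rw [h]
  exact hρ.eq_of_supporting hu hs

theorem eventually_mem_of_inner_outerNormal_neg {Ω : Set E3} (hΩ : IsC2ConvexDomain Ω) {x : E3}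
    (hx : x ∈ frontier Ω) {v : E3} (hv : inner ℝ (outerNormal Ω x) v < 0) :
    ∀ᶠ t : ℝ in 𝓝[>] 0, x + t • v ∈ Ω := by
  obtain ⟨ρ, hρ, h⟩ := isOuterNormal_outerNormal hΩ hx
  refine hρ.eventually_mem ?_
  rw [h, real_inner_smul_left] at hv
  by_contra! h0
  exact absurd hv (not_lt.2 (by positivity))

/-- Supporting inequalities pass to limits, so every cluster point of nearby normals is a unit
supporting vector at `x`, hence the normal there; compactness of the sphere turns this into
convergence. -/
theorem continuousOn_outerNormal {Ω : Set E3} (hΩ : IsC2ConvexDomain Ω) :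
    ContinuousOn (outerNormal Ω) (frontier Ω) := by
  intro x hx
  refine (isCompact_sphere (0 : E3) 1).tendsto_nhds_of_unique_mapClusterPt
    (eventually_of_mem self_mem_nhdsWithin fun y hy => by simpa using norm_outerNormal hΩ hy) ?_
  intro u hu hcl
  refine eq_outerNormal hΩ hx (by simpa using hu) fun y hy => ?_
  by_contra! h0
  have hop : ∀ᶠ p : E3 × E3 in 𝓝 u ×ˢ 𝓝 x, 0 < inner ℝ p.1 (y - p.2) := by
    rw [← nhds_prod_eq]
    have hc : Continuous fun p : E3 × E3 => (inner ℝ p.1 (y - p.2) : ℝ) := by fun_prop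
    exact hc.continuousAt.eventually (lt_mem_nhds h0)
  obtain ⟨pa, ha, pb, hb, hab⟩ := eventually_prod_iff.1 hop
  obtain ⟨z, hz1, hz2, hz3⟩ := ((hcl.frequently ha).and_eventually
    ((hb.filter_mono nhdsWithin_le_nhds).and (self_mem_nhdsWithin (s := frontier Ω)))).exists
  exact absurd (hab hz1 hz2) (not_lt.2 (inner_outerNormal_neg hΩ hz3 hy).le)

/-! ### Areas of planar and of nearly planar sets -/

theorem lipschitzOnWith_euclideanHausdorffMeasure_image_le {X Y : Type*} [EMetricSpace X]
    [EMetricSpace Y] [MeasurableSpace X] [BorelSpace X] [MeasurableSpace Y] [BorelSpace Y]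
    {K : ℝ≥0} {f : X → Y} {s : Set X} (h : LipschitzOnWith K f s) (d : ℕ) :
    Measure.euclideanHausdorffMeasure d (f '' s)
      ≤ (K : ℝ≥0∞) ^ d * Measure.euclideanHausdorffMeasure d s := by
  have := h.hausdorffMeasure_image_le (d := (d : ℝ)) (by positivity)
  rw [Measure.euclideanHausdorffMeasure_def, Measure.euclideanHausdorffMeasure_def,
    Measure.smul_apply, Measure.smul_apply, ENNReal.smul_def, ENNReal.smul_def, smul_eq_mul,
    smul_eq_mul, mul_left_comm]
  rw [ENNReal.rpow_natCast] at this
  gcongr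

/-- The coordinates `(y, s) ↦ y + s u` of the space along a unit vector `u`. -/
def lineCoord (u : E3) (hu : ‖u‖ = 1) : ((ℝ ∙ u)ᗮ : Submodule ℝ E3) × ℝ ≃ᵐ E3 :=
  MeasurableEquiv.prodComm.trans
    ((((LinearIsometryEquiv.toSpanUnitSingleton u hu).toHomeomorph.toMeasurableEquiv).prodCongr
      (MeasurableEquiv.refl _)).trans ((ℝ ∙ u).measurableEquivProd (0 : E3)).symm)

theorem lineCoord_apply (u : E3) (hu : ‖u‖ = 1) (p : ((ℝ ∙ u)ᗮ : Submodule ℝ E3) × ℝ) :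
    lineCoord u hu p = (p.1 : E3) + p.2 • u := by
  simp only [lineCoord, MeasurableEquiv.trans_apply, Submodule.measurableEquivProd_symm_apply,
    vadd_eq_add, add_zero]
  rw [add_comm]
  rfl

theorem measurePreserving_lineCoord (u : E3) (hu : ‖u‖ = 1) :
    MeasurePreserving (lineCoord u hu) volume volume := by
  have h1 : MeasurePreserving
      (((LinearIsometryEquiv.toSpanUnitSingleton u hu).toHomeomorph.toMeasurableEquiv).prodCongr
      (MeasurableEquiv.refl ((ℝ ∙ u)ᗮ : Submodule ℝ E3))) volume volume :=
    (LinearIsometryEquiv.measurePreserving (LinearIsometryEquiv.toSpanUnitSingleton u hu)).prod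
      (MeasurePreserving.id volume)
  have h2 := ((ℝ ∙ u).measurePreserving_measurableEquivProd (0 : E3)).symm
  rw [InnerProductSpace.euclideanHausdorffMeasure_eq_volume] at h2
  exact (Measure.measurePreserving_swap).trans (h1.trans h2)

theorem finrank_orthogonal_span {u : E3} (hu : ‖u‖ = 1) :
    Module.finrank ℝ ((ℝ ∙ u)ᗮ : Submodule ℝ E3) = 2 := by
  have : Fact (Module.finrank ℝ E3 = 2 + 1) := ⟨by simp⟩
  exact Submodule.finrank_orthogonal_span_singleton (by rintro rfl; simp at hu)

theorem volume_orthogonal_span {u : E3} (hu : ‖u‖ = 1) (B : Set ((ℝ ∙ u)ᗮ : Submodule ℝ E3)) :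
    volume B = Measure.euclideanHausdorffMeasure 2 (Subtype.val '' B : Set E3) := by
  rw [isometry_subtype_coe.euclideanHausdorffMeasure_image, ← finrank_orthogonal_span hu,
    InnerProductSpace.euclideanHausdorffMeasure_eq_volume]

/-- The cylinder of unit height with base `B` in the direction `u`. -/
def cyl (u : E3) (B : Set E3) : Set E3 := (fun p : E3 × ℝ => p.1 + p.2 • u) '' (B ×ˢ Icc 0 1)

/-- Expresses planar areas as volumes, on which linear maps act through their determinants. -/
theorem volume_cyl {u : E3} (hu : ‖u‖ = 1) {B : Set E3} (hB : ∀ b ∈ B, inner ℝ u b = (0 : ℝ)) :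
    volume (cyl u B) = Measure.euclideanHausdorffMeasure 2 B := by
  set W : Submodule ℝ E3 := (ℝ ∙ u)ᗮ
  have hBW : Subtype.val '' (Subtype.val ⁻¹' B : Set W) = B := by
    refine image_preimage_eq_of_subset fun b hb => ?_
    exact ⟨⟨b, Submodule.mem_orthogonal_singleton_iff_inner_right.2 (hB b hb)⟩, rfl⟩
  have h : cyl u B = (lineCoord u hu).symm ⁻¹' ((Subtype.val ⁻¹' B : Set W) ×ˢ Icc (0 : ℝ) 1) := by
    rw [← MeasurableEquiv.image_eq_preimage_symm]
    conv_lhs => rw [cyl, ← hBW]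
    ext x
    simp only [mem_image, mem_prod, Prod.exists, lineCoord_apply]
    constructor
    · rintro ⟨a, b, ⟨⟨w, hw, rfl⟩, hb⟩, rfl⟩
      exact ⟨w, b, ⟨hw, hb⟩, rfl⟩
    · rintro ⟨w, b, ⟨hw, hb⟩, rfl⟩
      exact ⟨w, b, ⟨⟨w, hw, rfl⟩, hb⟩, rfl⟩
  rw [h, (measurePreserving_lineCoord u hu).symm.measure_preimage_equiv, Measure.volume_eq_prod,
    Measure.prod_prod, volume_orthogonal_span hu, hBW]
  simp

/-- The orthogonal projection along a unit vector `u`. -/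
def perp (u : E3) : E3 →L[ℝ] E3 := ContinuousLinearMap.id ℝ E3 - (innerSL ℝ u).smulRight u

theorem perp_apply (u x : E3) : perp u x = x - (inner ℝ u x : ℝ) • u := by simp [perp]

theorem volume_image_transvection (f : Module.Dual ℝ E3) (v : E3) (s : Set E3) :
    volume (LinearMap.transvection f v '' s) = ENNReal.ofReal |1 + f v| * volume s := by
  rw [Measure.addHaar_image_linearMap, LinearMap.transvection.det]

/-- The cosine law for projected areas, by comparing unit cylinders: tilting the axis from `n` to
`u` multiplies the volume by `⟨u, n⟩`, and sliding the base along the axis `u` into the plane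
orthogonal to `u` preserves it. -/
theorem euclideanHausdorffMeasure_perp_image {u n : E3} (hu : ‖u‖ = 1) (hn : ‖n‖ = 1)
    (hc : inner ℝ u n ≠ (0 : ℝ)) {B : Set E3} (hB : ∀ b ∈ B, inner ℝ n b = (0 : ℝ)) :
    Measure.euclideanHausdorffMeasure 2 (perp u '' B)
      = ENNReal.ofReal |inner ℝ u n| * Measure.euclideanHausdorffMeasure 2 B := by
  have huu : inner ℝ u u = (1 : ℝ) := by rw [real_inner_self_eq_norm_sq, hu]; norm_num
  have hnn : inner ℝ n n = (1 : ℝ) := by rw [real_inner_self_eq_norm_sq, hn]; norm_num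
  have h1 : volume (cyl u B) = ENNReal.ofReal |inner ℝ u n| * volume (cyl n B) := by
    -- This shear fixes the base plane and sends `n` to `u`; its determinant is `1 + ⟨n, u - n⟩ =
    -- ⟨n, u⟩`.
    have : cyl u B = LinearMap.transvection (innerₗ E3 n) (u - n) '' cyl n B := by
      rw [cyl, cyl, image_image]
      refine image_congr fun p hp => ?_
      have := hB p.1 hp.1
      simp only [LinearMap.transvection.apply, innerₗ_apply_apply, inner_add_right, this,
        real_inner_smul_right, hnn]
      module
    rw [this, volume_image_transvection]
    congr 3
    simp [inner_sub_right, hn, real_inner_comm]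
  have h2 : volume (cyl u (perp u '' B)) = volume (cyl u B) := by
    set c : ℝ := inner ℝ u n
    have hc' : inner ℝ n u = c := real_inner_comm _ _
    -- On the plane orthogonal to `n` this functional equals `-⟨u, ·⟩`, and it vanishes at `u`; the
    -- shear along `u` is therefore the projection on the base, fixes the axis and has determinant
    -- `1`.
    set f : Module.Dual ℝ E3 := c⁻¹ • innerₗ E3 n - innerₗ E3 u with hf
    have : cyl u (perp u '' B) = LinearMap.transvection f u '' cyl u B := by
      rw [cyl, cyl, image_image, ← Set.image_id (Icc (0 : ℝ) 1), prod_image_image_eq, image_image]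
      simp only [Set.image_id]
      refine image_congr fun p hp => ?_
      have := hB p.1 hp.1
      simp only [LinearMap.transvection.apply, hf, perp_apply, LinearMap.sub_apply,
        LinearMap.smul_apply, innerₗ_apply_apply, inner_add_right, this, real_inner_smul_right, huu,
        hc', smul_eq_mul, id]
      rw [zero_add, mul_left_comm, inv_mul_cancel₀ hc]
      module
    rw [this, volume_image_transvection]
    simp [hf, hc', hc, hu]
  rw [volume_cyl hn hB, ← h2, volume_cyl hu] at h1
  · exact h1
  · rintro _ ⟨b, -, rfl⟩
    rw [perp_apply, inner_sub_right, real_inner_smul_right, huu, mul_one, sub_self]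

/-! ### Comparison of measures that are locally comparable -/

/-- Countably many of the neighbourhoods cover the space; cutting them into disjoint pieces lets the
local inequalities be summed. -/
theorem measure_le_mul_of_locally_le {X : Type*} [TopologicalSpace X] [SecondCountableTopology X]
    [MeasurableSpace X] [OpensMeasurableSpace X] {μ ν : Measure X} {c : ℝ≥0∞}
    (h : ∀ x, ∃ U ∈ 𝓝 x, ∀ A ⊆ U, MeasurableSet A → μ A ≤ c * ν A) (A : Set X)
    (hA : MeasurableSet A) : μ A ≤ c * ν A := by
  choose U hU hUA using h
  obtain ⟨s, hs, hsu⟩ := TopologicalSpace.countable_cover_nhds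
    (fun x => interior_mem_nhds.2 (hU x))
  rcases s.eq_empty_or_nonempty with rfl | hne
  · have : A = ∅ := by
      rw [biUnion_empty] at hsu
      exact eq_empty_of_subset_empty (hsu ▸ subset_univ A)
    simp [this]
  obtain ⟨e, rfl⟩ := hs.exists_eq_range hne
  set D : ℕ → Set X := disjointed fun n => interior (U (e n)) with hD
  have hDm : ∀ n, MeasurableSet (D n) := MeasurableSet.disjointed fun n => isOpen_interior.measurableSet
  have hDu : ⋃ n, D n = univ := by
    rw [hD, iUnion_disjointed, ← hsu, biUnion_range]
  have hsum : ∀ m : Measure X, m A = ∑' n, m (A ∩ D n) := fun m => by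
    rw [← measure_iUnion (fun i j hij => (disjoint_disjointed _ hij).mono inter_subset_right
      inter_subset_right) (fun n => hA.inter (hDm n)), ← inter_iUnion, hDu, inter_univ]
  rw [hsum μ, hsum ν, ← ENNReal.tsum_mul_left]
  exact ENNReal.tsum_le_tsum fun n => hUA (e n) _
    (inter_subset_right.trans ((disjointed_subset _ n).trans interior_subset)) (hA.inter (hDm n))

theorem measure_le_of_forall_one_lt_mul {X : Type*} [MeasurableSpace X] {μ ν : Measure X}
    (h : ∀ K : ℝ≥0, 1 < K → ∀ A, MeasurableSet A → μ A ≤ (K : ℝ≥0∞) ^ 3 * ν A) : μ ≤ ν := by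
  refine Measure.le_iff.2 fun A hA => ?_
  have h1 : Tendsto (fun K : ℝ≥0 => (K : ℝ≥0∞) ^ 3 * ν A) (𝓝[>] 1) (𝓝 (1 * ν A)) := by
    refine ENNReal.Tendsto.mul_const ?_ (Or.inl one_ne_zero)
    have : Continuous fun K : ℝ≥0 => ((K ^ 3 : ℝ≥0) : ℝ≥0∞) := by fun_prop
    simpa using (this.tendsto 1).mono_left nhdsWithin_le_nhds
  rw [one_mul] at h1
  exact ge_of_tendsto h1 (eventually_of_mem self_mem_nhdsWithin fun K hK => h K hK A hA)

/-! ### The projection of the boundary along a direction -/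

/-- The oblique projection along `u` onto the plane orthogonal to `n`. -/
def oblique (u n : E3) : E3 →L[ℝ] E3 :=
  ContinuousLinearMap.id ℝ E3 - (inner ℝ u n : ℝ)⁻¹ • (innerSL ℝ n).smulRight u

theorem oblique_apply (u n x : E3) :
    oblique u n x = x - ((inner ℝ u n : ℝ)⁻¹ * inner ℝ n x) • u := by
  simp [oblique, smul_smul]

theorem inner_oblique {u n : E3} (hc : inner ℝ u n ≠ (0 : ℝ)) (x : E3) :
    inner ℝ n (oblique u n x) = (0 : ℝ) := by
  rw [oblique_apply, inner_sub_right, real_inner_smul_right, real_inner_comm u n]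
  field_simp
  ring

theorem perp_oblique {u : E3} (hu : ‖u‖ = 1) (n x : E3) : perp u (oblique u n x) = perp u x := by
  have huu : inner ℝ u u = (1 : ℝ) := by rw [real_inner_self_eq_norm_sq, hu]; norm_num
  rw [oblique_apply, perp_apply, perp_apply, inner_sub_right, real_inner_smul_right, huu]
  module

theorem norm_oblique_sub {u : E3} (hu : ‖u‖ = 1) (n x : E3) :
    ‖oblique u n x - x‖ = |inner ℝ u n|⁻¹ * |inner ℝ n x| := by
  rw [oblique_apply, sub_sub_cancel_left, norm_neg, norm_smul, hu, mul_one, norm_mul,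
    norm_inv, Real.norm_eq_abs, Real.norm_eq_abs]

/-- Short boundary chords are almost tangential. The supporting inequality at either end gives one
sign with the normal of that end, and replacing that normal by `n` costs `δ`. -/
theorem abs_inner_sub_le {Ω : Set E3} (hΩ : IsC2ConvexDomain Ω) {n x y : E3} {δ : ℝ}
    (hx : x ∈ frontier Ω) (hy : y ∈ frontier Ω) (hxn : ‖outerNormal Ω x - n‖ ≤ δ)
    (hyn : ‖outerNormal Ω y - n‖ ≤ δ) : |inner ℝ n (x - y)| ≤ δ * ‖x - y‖ := by
  have key : ∀ {x y : E3}, x ∈ frontier Ω → y ∈ frontier Ω → ‖outerNormal Ω y - n‖ ≤ δ →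
      inner ℝ n (x - y) ≤ δ * ‖x - y‖ := by
    intro x y hx hy hyn
    have h1 := inner_outerNormal_nonpos hΩ hy (frontier_subset_closure hx)
    have h2 : inner ℝ (n - outerNormal Ω y) (x - y) ≤ ‖n - outerNormal Ω y‖ * ‖x - y‖ :=
      real_inner_le_norm _ _
    rw [norm_sub_rev n] at h2
    rw [inner_sub_left] at h2
    have := mul_le_mul_of_nonneg_right hyn (norm_nonneg (x - y))
    linarith
  refine abs_le.2 ⟨?_, key hx hy hyn⟩
  have := key hy hx hxn
  rw [← neg_sub x y, inner_neg_right, norm_neg] at this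
  linarith

/-- Near a boundary point the oblique projection onto the tangent plane is almost isometric on the
boundary. -/
theorem exists_nhds_oblique {Ω : Set E3} (hΩ : IsC2ConvexDomain Ω) {u x : E3} (hu : ‖u‖ = 1)
    (hx : x ∈ frontier Ω) (hc : inner ℝ u (outerNormal Ω x) ≠ (0 : ℝ)) {K : ℝ≥0} (hK : 1 < K) :
    ∃ U ∈ 𝓝 x, ∀ A ⊆ frontier Ω ∩ U,
      Measure.euclideanHausdorffMeasure 2 (oblique u (outerNormal Ω x) '' A)
        ≤ (K : ℝ≥0∞) ^ 2 * Measure.euclideanHausdorffMeasure 2 A ∧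
      Measure.euclideanHausdorffMeasure 2 A
        ≤ (K : ℝ≥0∞) ^ 2
          * Measure.euclideanHausdorffMeasure 2 (oblique u (outerNormal Ω x) '' A) := by
  set n := outerNormal Ω x with hn
  set c : ℝ := inner ℝ u n with hcdef
  have hcpos : 0 < |c| := abs_pos.2 hc
  have hK' : (1 : ℝ) < K := by exact_mod_cast hK
  have hK0 : (0 : ℝ) < K := by linarith
  -- Chosen so that `1 + η ≤ K` and `1 - η = 1 / K`: an `η`-perturbation of the identity then has
  -- Lipschitz constant at most `K` in both directions.
  set η : ℝ := 1 - (K : ℝ)⁻¹ with hη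
  have hη0 : 0 < η := by rw [hη, sub_pos]; exact inv_lt_one_of_one_lt₀ hK'
  have hη1 : η ≤ K - 1 := by
    have : η = (K - 1) * (K : ℝ)⁻¹ := by rw [hη]; field_simp
    rw [this]
    exact mul_le_of_le_one_right (by linarith) (inv_le_one_of_one_le₀ hK'.le)
  have hev := (continuousOn_outerNormal hΩ x hx).eventually
    (Metric.closedBall_mem_nhds n (mul_pos hη0 hcpos))
  obtain ⟨U, hU, hUs⟩ := mem_nhdsWithin_iff_exists_mem_nhds_inter.1 hev
  refine ⟨U, hU, fun A hA => ?_⟩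
  have hclose : ∀ y ∈ A, ∀ z ∈ A, ‖oblique u n (y - z) - (y - z)‖ ≤ η * ‖y - z‖ := by
    intro y hy z hz
    rw [norm_oblique_sub hu]
    have h1 := abs_inner_sub_le hΩ (hA hy).1 (hA hz).1 (n := n) (δ := η * |c|)
      (by simpa [dist_eq_norm] using hUs ⟨(hA hy).2, (hA hy).1⟩)
      (by simpa [dist_eq_norm] using hUs ⟨(hA hz).2, (hA hz).1⟩)
    calc |c|⁻¹ * |inner ℝ n (y - z)| ≤ |c|⁻¹ * (η * |c| * ‖y - z‖) := by gcongr
      _ = η * ‖y - z‖ := by field_simp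
  have hlip : LipschitzOnWith K (oblique u n) A := by
    refine LipschitzOnWith.of_dist_le_mul fun y hy z hz => ?_
    rw [dist_eq_norm, dist_eq_norm, ← map_sub]
    have h1 := hclose y hy z hz
    have h2 := norm_add_le (oblique u n (y - z) - (y - z)) (y - z)
    rw [sub_add_cancel] at h2
    nlinarith [norm_nonneg (y - z)]
  have hanti : ∀ y ∈ A, ∀ z ∈ A, dist y z ≤ K * dist (oblique u n y) (oblique u n z) := by
    intro y hy z hz
    rw [dist_eq_norm, dist_eq_norm, ← map_sub]
    have h1 := hclose y hy z hz
    have h2 := norm_sub_norm_le (y - z) (oblique u n (y - z))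
    rw [norm_sub_rev (y - z) (oblique u n (y - z))] at h2
    have h3 : (K : ℝ)⁻¹ * ‖y - z‖ ≤ ‖oblique u n (y - z)‖ := by
      have : (K : ℝ)⁻¹ = 1 - η := by rw [hη]; ring
      rw [this]
      linarith
    calc ‖y - z‖ = K * ((K : ℝ)⁻¹ * ‖y - z‖) := by field_simp
      _ ≤ _ := by gcongr
  refine ⟨lipschitzOnWith_euclideanHausdorffMeasure_image_le hlip 2, ?_⟩
  have hinj : InjOn (oblique u n) A := fun y hy z hz h => by
    have := hanti y hy z hz
    rw [h, dist_self, mul_zero] at this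
    exact dist_le_zero.1 this
  have hinv : LipschitzOnWith K (Function.invFunOn (oblique u n) A) (oblique u n '' A) := by
    refine LipschitzOnWith.of_dist_le_mul ?_
    rintro _ ⟨y, hy, rfl⟩ _ ⟨z, hz, rfl⟩
    rw [hinj.leftInvOn_invFunOn hy, hinj.leftInvOn_invFunOn hz]
    exact hanti y hy z hz
  have := lipschitzOnWith_euclideanHausdorffMeasure_image_le hinv 2
  rwa [hinj.invFunOn_image subset_rfl] at this

/-- By compactness a local bound suffices, and locally the area is at most a constant times that of
a bounded planar set, the projection along the normal itself. -/
theorem isFiniteMeasure_surfaceMeasure {Ω : Set E3} (hΩ : IsC2ConvexDomain Ω) :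
    IsFiniteMeasure (surfaceMeasure Ω) := by
  have hcpt : IsCompact (frontier Ω) :=
    Metric.isCompact_of_isClosed_isBounded isClosed_frontier
      (hΩ.isBounded.closure.subset frontier_subset_closure)
  refine ⟨?_⟩
  rw [surfaceMeasure, Measure.restrict_apply_univ]
  refine hcpt.measure_lt_top_of_nhdsWithin fun x hx => ?_
  have hn := norm_outerNormal hΩ hx
  have hnn : inner ℝ (outerNormal Ω x) (outerNormal Ω x) = (1 : ℝ) := by
    rw [real_inner_self_eq_norm_sq, hn]; norm_num
  obtain ⟨U, hU, h⟩ := exists_nhds_oblique hΩ hn hx (by rw [hnn]; norm_num)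
    (show (1 : ℝ≥0) < 2 by norm_num)
  refine ⟨frontier Ω ∩ U, inter_mem self_mem_nhdsWithin (mem_nhdsWithin_of_mem_nhds hU), ?_⟩
  refine lt_of_le_of_lt (h _ subset_rfl).2 (ENNReal.mul_lt_top (by simp) ?_)
  set n := outerNormal Ω x
  set W : Submodule ℝ E3 := (ℝ ∙ n)ᗮ
  set B := oblique n n '' (frontier Ω ∩ U)
  have hBW : Subtype.val '' (Subtype.val ⁻¹' B : Set W) = B := by
    refine image_preimage_eq_of_subset ?_
    rintro _ ⟨b, hb, rfl⟩
    exact ⟨⟨_, Submodule.mem_orthogonal_singleton_iff_inner_right.2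
      (inner_oblique (by rw [hnn]; norm_num) b)⟩, rfl⟩
  rw [← hBW, ← volume_orthogonal_span hn]
  have hb : Bornology.IsBounded B :=
    (((hcpt.isBounded.subset inter_subset_left).image (oblique n n)))
  exact (isometry_subtype_coe.antilipschitz.isBounded_preimage hb).measure_lt_top

/-! ### The part of the boundary through which a direction enters -/

/-- The boundary points at which the direction `u` points into `Ω`. -/
def inflow (Ω : Set E3) (u : E3) : Set E3 :=
  {x | x ∈ frontier Ω ∧ inner ℝ u (outerNormal Ω x) < (0 : ℝ)}

theorem measurableSet_inflow {Ω : Set E3} (hΩ : IsC2ConvexDomain Ω) (u : E3) :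
    MeasurableSet (inflow Ω u) := by
  have hc : ContinuousOn (fun x => (inner ℝ u (outerNormal Ω x) : ℝ)) (frontier Ω) :=
    continuousOn_const.inner (continuousOn_outerNormal hΩ)
  obtain ⟨V, hV, hVe⟩ := continuousOn_iff'.1 hc (Iio 0) isOpen_Iio
  have : inflow Ω u = V ∩ frontier Ω := by
    rw [← hVe]
    ext x
    exact and_comm
  rw [this]
  exact hV.measurableSet.inter isClosed_frontier.measurableSet

theorem mem_inflow_of_mem {Ω : Set E3} (hΩ : IsC2ConvexDomain Ω) {u x : E3}
    (hx : x ∈ frontier Ω) {t : ℝ} (ht : 0 < t) (h : x + t • u ∈ Ω) : x ∈ inflow Ω u := by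
  refine ⟨hx, ?_⟩
  have := inner_outerNormal_neg hΩ hx h
  rw [add_sub_cancel_left, real_inner_smul_right, real_inner_comm] at this
  by_contra! h0
  exact absurd this (not_lt.2 (by positivity))

/-- A line meets `Ω` in an open segment. -/
theorem exists_chord {Ω : Set E3} (hΩ : IsC2ConvexDomain Ω) {u x : E3} (hu : ‖u‖ = 1)
    (hx : x ∈ inflow Ω u) :
    ∃ L : ℝ, 0 < L ∧ (∀ s : ℝ, x + s • u ∈ Ω ↔ s ∈ Ioo 0 L) ∧ x + L • u ∈ inflow Ω (-u) := by
  set I : Set ℝ := {s | x + s • u ∈ Ω} with hI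
  have hcont : Continuous fun s : ℝ => x + s • u := by fun_prop
  have hIo : IsOpen I := hΩ.isOpen.preimage hcont
  have hpos : ∀ s ∈ I, 0 < s := by
    intro s hs
    have := inner_outerNormal_neg hΩ hx.1 hs
    rw [add_sub_cancel_left, real_inner_smul_right, real_inner_comm] at this
    by_contra! h0
    exact absurd this (not_lt.2 (mul_nonneg_of_nonpos_of_nonpos h0 hx.2.le))
  have hev : ∀ᶠ s : ℝ in 𝓝[>] 0, s ∈ I :=
    eventually_mem_of_inner_outerNormal_neg hΩ hx.1 (by rw [real_inner_comm]; exact hx.2)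
  obtain ⟨R, hR⟩ := (Metric.isBounded_iff.1 hΩ.isBounded)
  have hbdd : BddAbove I := by
    obtain ⟨s₀, hs₀⟩ := hev.exists
    refine ⟨s₀ + R, fun s hs => ?_⟩
    have := hR hs hs₀
    rw [dist_add_left, dist_eq_norm, ← sub_smul, norm_smul, hu, mul_one] at this
    linarith [le_abs_self (s - s₀), Real.norm_eq_abs (s - s₀)]
  obtain ⟨s₀, hs₀⟩ := hev.exists
  have hne : I.Nonempty := ⟨s₀, hs₀⟩
  have hord : ∀ s ∈ I, ∀ r, 0 < r → r ≤ s → r ∈ I := by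
    intro s hs r hr hrs
    have := hΩ.convex.add_smul_sub_mem_interior' (frontier_subset_closure hx.1)
      (by rwa [hΩ.isOpen.interior_eq]) (show r / s ∈ Ioc (0 : ℝ) 1 from
        ⟨div_pos hr (hr.trans_le hrs), div_le_one_of_le₀ hrs (hr.trans_le hrs).le⟩)
    rwa [hΩ.isOpen.interior_eq, add_sub_cancel_left, smul_smul,
      div_mul_cancel₀ _ (hr.trans_le hrs).ne'] at this
  -- The parameters inside `Ω` form an interval beginning at `0`; since it is open, its supremum is
  -- not attained and gives the exit point.
  set L := sSup I with hL
  have hLpos : 0 < L := (hpos s₀ hs₀).trans_le (le_csSup hbdd hs₀)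
  have hLnot : L ∉ I := fun h => by
    obtain ⟨ε, hε, hb⟩ := Metric.isOpen_iff.1 hIo L h
    have : L + ε / 2 ∈ I := hb (by simp [abs_of_pos hε]; linarith)
    linarith [le_csSup hbdd this]
  have hiff : ∀ s : ℝ, x + s • u ∈ Ω ↔ s ∈ Ioo 0 L := by
    intro s
    constructor
    · intro hs
      refine ⟨hpos s hs, lt_of_le_of_ne (le_csSup hbdd hs) ?_⟩
      rintro rfl
      exact hLnot hs
    · rintro ⟨h1, h2⟩
      obtain ⟨r, hr, hsr⟩ := exists_lt_of_lt_csSup hne h2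
      exact hord r hr s h1 hsr.le
  have hcl : x + L • u ∈ closure Ω := by
    have : L ∈ closure I := csSup_mem_closure hne hbdd
    exact map_mem_closure (f := fun s : ℝ => x + s • u) hcont this fun s hs => hs
  have hfr : x + L • u ∈ frontier Ω := by
    rw [hΩ.isOpen.frontier_eq]
    exact ⟨hcl, hLnot⟩
  refine ⟨L, hLpos, hiff, mem_inflow_of_mem hΩ hfr (t := L / 2) (by linarith) ?_⟩
  have : x + L • u + (L / 2) • -u = x + (L / 2) • u := by module
  rw [this, hiff]
  constructor <;> linarith

theorem perp_add_smul {u : E3} (hu : ‖u‖ = 1) (x : E3) (s : ℝ) :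
    perp u (x + s • u) = perp u x := by
  have huu : inner ℝ u u = (1 : ℝ) := by rw [real_inner_self_eq_norm_sq, hu]; norm_num
  rw [perp_apply, perp_apply, inner_add_right, real_inner_smul_right, huu]
  module

theorem exists_eq_add_smul_of_perp_eq {u x y : E3} (h : perp u x = perp u y) :
    ∃ s : ℝ, y = x + s • u := by
  refine ⟨inner ℝ u y - inner ℝ u x, ?_⟩
  rw [perp_apply, perp_apply, sub_eq_sub_iff_add_eq_add] at h
  rw [sub_smul, add_sub_assoc', h, add_sub_cancel_right]

/-- A line has at most one entry point: the supporting half-space at an entry point forces every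
other boundary point of the line to lie ahead of it. -/
theorem injOn_perp_inflow {Ω : Set E3} (hΩ : IsC2ConvexDomain Ω) (u : E3) :
    InjOn (perp u) (inflow Ω u) := by
  have key : ∀ x ∈ inflow Ω u, ∀ s : ℝ, x + s • u ∈ inflow Ω u → 0 ≤ s := by
    intro x hx s hs
    have := inner_outerNormal_nonpos hΩ hx.1 (frontier_subset_closure hs.1)
    rw [add_sub_cancel_left, real_inner_smul_right, real_inner_comm] at this
    by_contra! h0
    exact absurd this (not_le.2 (mul_pos_of_neg_of_neg h0 hx.2))
  intro x hx y hy h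
  obtain ⟨s, rfl⟩ := exists_eq_add_smul_of_perp_eq h
  have h1 := key x hx s hy
  have h2 := key _ hy (-s) (by simpa [add_assoc, ← add_smul] using hx)
  have : s = 0 := by linarith
  simp [this]

/-- The measure `|u·n| dΓ` on the part of the boundary through which `u` enters. -/
def fluxMeasure (Ω : Set E3) (u : E3) : Measure E3 :=
  ((surfaceMeasure Ω).restrict (inflow Ω u)).withDensity
    fun x => ENNReal.ofReal (-inner ℝ u (outerNormal Ω x))

/-- The flux measure is the area of the projection along `u`. -/
theorem fluxMeasure_apply {Ω : Set E3} (hΩ : IsC2ConvexDomain Ω) {u : E3} (hu : ‖u‖ = 1)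
    {A : Set E3} (hA : MeasurableSet A) :
    fluxMeasure Ω u A = Measure.euclideanHausdorffMeasure 2 (perp u '' (A ∩ inflow Ω u)) := by
  set S := inflow Ω u with hS
  have hSm : MeasurableSet S := measurableSet_inflow hΩ u
  have hemb : MeasurableEmbedding (fun x : S => perp u x) :=
    (perp u).continuous.continuousOn.measurableEmbedding hSm (injOn_perp_inflow hΩ u)
  have hval : MeasurableEmbedding (Subtype.val : S → E3) := MeasurableEmbedding.subtype_coe hSm
  set m₁ : Measure S := (fluxMeasure Ω u).comap Subtype.val with hm₁
  set m₂ : Measure S := (Measure.euclideanHausdorffMeasure 2).comap fun x : S => perp u x with hm₂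
  have h1 : ∀ B : Set S, m₁ B = fluxMeasure Ω u (Subtype.val '' B) := fun B =>
    hval.comap_apply _ _
  have h2 : ∀ B : Set S, m₂ B = Measure.euclideanHausdorffMeasure 2 (perp u '' (Subtype.val '' B)) :=
    fun B => by rw [image_image]; exact hemb.comap_apply _ _
  have hflux : ∀ B ⊆ S, MeasurableSet B → fluxMeasure Ω u B
      = ∫⁻ x in B, ENNReal.ofReal (-inner ℝ u (outerNormal Ω x))
        ∂(Measure.euclideanHausdorffMeasure 2) := by
    intro B hB hBm
    rw [fluxMeasure, withDensity_apply _ hBm, Measure.restrict_restrict hBm, surfaceMeasure,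
      Measure.restrict_restrict (hBm.inter hSm), inter_eq_self_of_subset_left hB,
      inter_eq_self_of_subset_left (hB.trans fun x hx => hx.1)]
  -- Of the three factors `K`, one bounds the oscillation of the density `-⟨u, n⟩` and two come from
  -- the area distortion of the oblique projection. The projection along `u` factors through the
  -- oblique one, so the remaining planar map contributes exactly the cosine.
  have hloc : ∀ K : ℝ≥0, 1 < K → ∀ x : S, ∃ U ∈ 𝓝 x, ∀ B ⊆ U, MeasurableSet B →
      m₁ B ≤ (K : ℝ≥0∞) ^ 3 * m₂ B ∧ m₂ B ≤ (K : ℝ≥0∞) ^ 3 * m₁ B := by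
    intro K hK x
    have hx := x.2
    set c : ℝ := inner ℝ u (outerNormal Ω x) with hc
    have hcneg : c < 0 := hx.2
    have hn1 := norm_outerNormal hΩ hx.1
    obtain ⟨U, hU, hUA⟩ := exists_nhds_oblique hΩ hu hx.1 hcneg.ne hK
    have hcont : ContinuousAt (fun y : S => (-inner ℝ u (outerNormal Ω y) : ℝ)) x := by
      have h3 : ContinuousOn (fun x => (-inner ℝ u (outerNormal Ω x) : ℝ)) S :=
        ((continuousOn_const.inner (continuousOn_outerNormal hΩ)).neg).mono fun y hy => hy.1
      exact (continuousOn_iff_continuous_domRestrict.1 h3).continuousAt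
    have hK0 : (0 : ℝ) < K := by exact_mod_cast one_pos.trans hK
    have hK1 : (1 : ℝ) < K := by exact_mod_cast hK
    have hev1 := hcont.eventually (gt_mem_nhds (show -c < K * -c by nlinarith))
    have hev2 := hcont.eventually (lt_mem_nhds (show (K : ℝ)⁻¹ * -c < -c by
      have := inv_lt_one_of_one_lt₀ hK1
      nlinarith))
    refine ⟨_, inter_mem (continuous_subtype_val.continuousAt.preimage_mem_nhds hU)
      (hev1.and hev2), fun B hB hBm => ?_⟩
    have hBm' : MeasurableSet (Subtype.val '' B : Set E3) := hval.measurableSet_image' hBm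
    have hBS : (Subtype.val '' B : Set E3) ⊆ S := by rintro _ ⟨y, -, rfl⟩; exact y.2
    have hBU : (Subtype.val '' B : Set E3) ⊆ frontier Ω ∩ U := by
      rintro _ ⟨y, hy, rfl⟩
      exact ⟨y.2.1, (hB hy).1⟩
    obtain ⟨h3, h4⟩ := hUA _ hBU
    have h5 : m₂ B = ENNReal.ofReal (-c) * Measure.euclideanHausdorffMeasure 2
        (oblique u (outerNormal Ω x) '' (Subtype.val '' B)) := by
      rw [h2, ← abs_of_neg hcneg, hc, ← euclideanHausdorffMeasure_perp_image hu hn1 hcneg.ne,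
        image_image (perp u) (oblique u _)]
      · congr 1
        exact image_congr fun y _ => (perp_oblique hu _ _).symm
      · rintro _ ⟨y, -, rfl⟩
        exact inner_oblique hcneg.ne y
    have h6 : m₁ B = ∫⁻ x in Subtype.val '' B, ENNReal.ofReal (-inner ℝ u (outerNormal Ω x))
        ∂(Measure.euclideanHausdorffMeasure 2) := by rw [h1, hflux _ hBS hBm']
    set M := Measure.euclideanHausdorffMeasure 2 (Subtype.val '' B : Set E3)
    have h7 : m₁ B ≤ K * ENNReal.ofReal (-c) * M := by
      rw [h6]
      calc _ ≤ ∫⁻ x in Subtype.val '' B, K * ENNReal.ofReal (-c)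
            ∂(Measure.euclideanHausdorffMeasure 2) := by
            refine setLIntegral_mono' hBm' ?_
            rintro _ ⟨y, hy, rfl⟩
            rw [← ENNReal.ofReal_coe_nnreal, ← ENNReal.ofReal_mul hK0.le]
            exact ENNReal.ofReal_le_ofReal (hB hy).2.1.le
        _ = _ := by rw [setLIntegral_const]
    have h8 : ENNReal.ofReal (-c) * M ≤ K * m₁ B := by
      rw [h6]
      calc ENNReal.ofReal (-c) * M
          = ∫⁻ x in Subtype.val '' B, ENNReal.ofReal (-c)
            ∂(Measure.euclideanHausdorffMeasure 2) := by rw [setLIntegral_const]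
        _ ≤ ∫⁻ x in Subtype.val '' B, K * ENNReal.ofReal (-inner ℝ u (outerNormal Ω x))
            ∂(Measure.euclideanHausdorffMeasure 2) := by
            refine setLIntegral_mono' hBm' ?_
            rintro _ ⟨y, hy, rfl⟩
            rw [← ENNReal.ofReal_coe_nnreal, ← ENNReal.ofReal_mul hK0.le]
            refine ENNReal.ofReal_le_ofReal ?_
            have := mul_le_mul_of_nonneg_left (hB hy).2.2.le hK0.le
            rwa [← mul_assoc, mul_inv_cancel₀ hK0.ne', one_mul] at this
        _ = _ := lintegral_const_mul' _ _ (by simp)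
    constructor
    · calc m₁ B ≤ K * ENNReal.ofReal (-c) * M := h7
        _ ≤ K * ENNReal.ofReal (-c) * (K ^ 2 * _) := by gcongr
        _ = K ^ 3 * m₂ B := by rw [h5]; ring
    · calc m₂ B ≤ ENNReal.ofReal (-c) * (K ^ 2 * M) := by rw [h5]; gcongr
        _ = K ^ 2 * (ENNReal.ofReal (-c) * M) := by ring
        _ ≤ K ^ 2 * (K * m₁ B) := by gcongr
        _ = K ^ 3 * m₁ B := by ring
  have heq : m₁ = m₂ := by
    refine le_antisymm ?_ ?_
    · refine measure_le_of_forall_one_lt_mul fun K hK B hB =>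
        measure_le_mul_of_locally_le (fun x => ?_) B hB
      obtain ⟨U, hU, h⟩ := hloc K hK x
      exact ⟨U, hU, fun B hB hBm => (h B hB hBm).1⟩
    · refine measure_le_of_forall_one_lt_mul fun K hK B hB =>
        measure_le_mul_of_locally_le (fun x => ?_) B hB
      obtain ⟨U, hU, h⟩ := hloc K hK x
      exact ⟨U, hU, fun B hB hBm => (h B hB hBm).2⟩
  have hAS : (Subtype.val '' (Subtype.val ⁻¹' A : Set S) : Set E3) = A ∩ S := by
    rw [Subtype.image_preimage_coe, inter_comm]
  have h3 : fluxMeasure Ω u A = fluxMeasure Ω u (A ∩ S) := by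
    rw [fluxMeasure, withDensity_apply _ hA, withDensity_apply _ (hA.inter hSm),
      Measure.restrict_restrict hA, Measure.restrict_restrict (hA.inter hSm), inter_assoc,
      inter_self]
  rw [h3, ← hAS, ← h1, ← h2, heq]

/-! ### Integration along lines -/

/-- Off the boundary the default value `0` applies: a zero of a defining function is not in `Ω`, and
away from the closure it would be a local minimum, contradicting the nonzero gradient. -/
theorem measurable_outerNormal {Ω : Set E3} (hΩ : IsC2ConvexDomain Ω) :
    Measurable (outerNormal Ω) := by
  classical
  have h0 : ∀ x, x ∉ frontier Ω → outerNormal Ω x = 0 := by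
    intro x hx
    rw [outerNormal, dif_neg]
    rintro ⟨ν, ρ, hρ, -⟩
    have hxΩ : x ∉ Ω := fun h => absurd (hρ.2.2.2.self_of_nhds.1 h) (by rw [hρ.2.1]; exact lt_irrefl 0)
    have hxc : x ∉ closure Ω := fun h => hx (by rw [hΩ.isOpen.frontier_eq]; exact ⟨h, hxΩ⟩)
    have hmin : IsLocalMin ρ x := by
      filter_upwards [hρ.2.2.2, isClosed_closure.isOpen_compl.mem_nhds hxc] with y hy hyc
      rw [hρ.2.1]
      by_contra! h
      exact hyc (subset_closure (hy.2 h))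
    exact hρ.2.2.1 (by rw [gradient, hmin.fderiv_eq_zero, map_zero])
  have : outerNormal Ω = (frontier Ω).piecewise (outerNormal Ω) (fun _ => 0) := by
    ext1 x
    by_cases hx : x ∈ frontier Ω
    · rw [piecewise_eq_of_mem _ _ _ hx]
    · rw [piecewise_eq_of_notMem _ _ _ hx, h0 x hx]
  rw [this]
  exact (continuousOn_outerNormal hΩ).measurable_piecewise continuousOn_const
    isClosed_frontier.measurableSet

/-- The points of the plane orthogonal to `u` whose line in the direction `u` meets `Ω`. -/
def shadow (Ω : Set E3) (u : E3) : Set ((ℝ ∙ u)ᗮ : Submodule ℝ E3) :=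
  {y | ∃ s : ℝ, (y : E3) + s • u ∈ Ω}

theorem isOpen_shadow {Ω : Set E3} (hΩ : IsOpen Ω) (u : E3) : IsOpen (shadow Ω u) := by
  have : shadow Ω u = ⋃ s : ℝ, (fun y : ((ℝ ∙ u)ᗮ : Submodule ℝ E3) => (y : E3) + s • u) ⁻¹' Ω := by
    ext y
    simp [shadow]
  rw [this]
  exact isOpen_iUnion fun s => hΩ.preimage (by fun_prop)

theorem perp_mem {u : E3} (hu : ‖u‖ = 1) (x : E3) : perp u x ∈ ((ℝ ∙ u)ᗮ : Submodule ℝ E3) := by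
  have huu : inner ℝ u u = (1 : ℝ) := by rw [real_inner_self_eq_norm_sq, hu]; norm_num
  rw [Submodule.mem_orthogonal_singleton_iff_inner_right, perp_apply, inner_sub_right,
    real_inner_smul_right, huu, mul_one, sub_self]

theorem perp_coe {u : E3} (y : ((ℝ ∙ u)ᗮ : Submodule ℝ E3)) : perp u y = y := by
  have := Submodule.mem_orthogonal_singleton_iff_inner_right.1 y.2
  rw [perp_apply, this, zero_smul, sub_zero]

theorem perp_eq_sub (u x : E3) : ∃ s : ℝ, perp u x + s • u = x :=
  ⟨inner ℝ u x, by rw [perp_apply]; module⟩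

/-- Every line that meets `Ω` enters `Ω` at a boundary point. -/
theorem exists_inflow_of_mem {Ω : Set E3} (hΩ : IsC2ConvexDomain Ω) {u x : E3} (hu : ‖u‖ = 1)
    (hx : x ∈ Ω) : ∃ t : ℝ, 0 < t ∧ x - t • u ∈ inflow Ω u := by
  set I : Set ℝ := {s | 0 ≤ s ∧ x - s • u ∉ Ω} with hI
  have hcont : Continuous fun s : ℝ => x - s • u := by fun_prop
  have hcl : IsClosed I := isClosed_Ici.inter (hΩ.isOpen.isClosed_compl.preimage hcont)
  obtain ⟨R, hR⟩ := Metric.isBounded_iff.1 hΩ.isBounded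
  have hR0 : 0 ≤ R := by simpa using hR hx hx
  have hne : I.Nonempty := by
    refine ⟨R + 1, by linarith, fun h => ?_⟩
    have := hR hx h
    rw [dist_eq_norm, sub_sub_cancel, norm_smul, hu, mul_one, Real.norm_of_nonneg (by linarith)]
      at this
    linarith
  have hbdd : BddBelow I := ⟨0, fun s hs => hs.1⟩
  set t := sInf I with ht
  have htI : t ∈ I := hcl.csInf_mem hne hbdd
  have ht0 : 0 < t := lt_of_le_of_ne htI.1 fun h => htI.2 (by rw [← h]; simpa using hx)
  have hlt : ∀ s, 0 ≤ s → s < t → x - s • u ∈ Ω := fun s h0 hs => by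
    by_contra h
    exact absurd (csInf_le hbdd ⟨h0, h⟩) (not_le.2 hs)
  have hclo : x - t • u ∈ closure Ω := by
    have h1 : t ∈ closure (Ico 0 t) := by rw [closure_Ico ht0.ne]; exact ⟨ht0.le, le_rfl⟩
    exact map_mem_closure (f := fun s : ℝ => x - s • u) hcont h1 fun s hs => hlt s hs.1 hs.2
  have hfr : x - t • u ∈ frontier Ω := by
    rw [hΩ.isOpen.frontier_eq]
    exact ⟨hclo, htI.2⟩
  exact ⟨t, ht0, mem_inflow_of_mem hΩ hfr ht0 (by simpa using hx)⟩

/-- A line parallel to `u` meets `Ω` exactly when it has an entry point, so the projected inflow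
part is the whole shadow. -/
theorem map_perp_fluxMeasure {Ω : Set E3} (hΩ : IsC2ConvexDomain Ω) {u : E3} (hu : ‖u‖ = 1) :
    (fluxMeasure Ω u).map (fun x => (⟨perp u x, perp_mem hu x⟩ : ((ℝ ∙ u)ᗮ : Submodule ℝ E3)))
      = volume.restrict (shadow Ω u) := by
  have hq : Measurable fun x => (⟨perp u x, perp_mem hu x⟩ : ((ℝ ∙ u)ᗮ : Submodule ℝ E3)) :=
    (perp u).continuous.measurable.subtype_mk
  ext B hB
  rw [Measure.map_apply hq hB, Measure.restrict_apply hB, fluxMeasure_apply hΩ hu (hq hB),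
    volume_orthogonal_span hu]
  congr 1
  ext y
  constructor
  · rintro ⟨x, ⟨hxB, hx⟩, rfl⟩
    refine ⟨⟨perp u x, perp_mem hu x⟩, ⟨hxB, ?_⟩, rfl⟩
    obtain ⟨L, hL, hiff, -⟩ := exists_chord hΩ hu hx
    obtain ⟨s, hs⟩ := perp_eq_sub u x
    refine ⟨s + L / 2, ?_⟩
    have : perp u x + (s + L / 2) • u = x + (L / 2) • u := by
      conv_rhs => rw [← hs]
      module
    change perp u x + (s + L / 2) • u ∈ Ω
    rw [this, hiff]
    constructor <;> linarith
  · rintro ⟨w, ⟨hwB, s, hs⟩, rfl⟩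
    obtain ⟨t, -, ht⟩ := exists_inflow_of_mem hΩ hu hs
    have h1 : perp u ((w : E3) + s • u - t • u) = w := by
      have : (w : E3) + s • u - t • u = w + (s - t) • u := by module
      rw [this, perp_add_smul hu, perp_coe]
    refine ⟨_, ⟨?_, ht⟩, h1⟩
    change (⟨perp u _, _⟩ : ((ℝ ∙ u)ᗮ : Submodule ℝ E3)) ∈ B
    simpa only [h1] using hwB

/-- Fubini along `u`. Starting each line at its entry point rather than in the orthogonal plane is a
translation in the line parameter. -/
theorem lintegral_fluxMeasure_line {Ω : Set E3} (hΩ : IsC2ConvexDomain Ω) {u : E3} (hu : ‖u‖ = 1)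
    {G : E3 → ℝ≥0∞} (hG : Measurable G) :
    ∫⁻ x, (∫⁻ s : ℝ, Ω.indicator G (x + s • u)) ∂(fluxMeasure Ω u) = ∫⁻ x in Ω, G x := by
  have hGi : Measurable (Ω.indicator G) := hG.indicator hΩ.isOpen.measurableSet
  have hq : Measurable fun x => (⟨perp u x, perp_mem hu x⟩ : ((ℝ ∙ u)ᗮ : Submodule ℝ E3)) :=
    (perp u).continuous.measurable.subtype_mk
  set W : Submodule ℝ E3 := (ℝ ∙ u)ᗮ
  have hjm : Measurable fun p : W × ℝ => Ω.indicator G ((p.1 : E3) + p.2 • u) :=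
    hGi.comp (by fun_prop)
  have hHm : Measurable fun y : W => ∫⁻ s : ℝ, Ω.indicator G ((y : E3) + s • u) :=
    hjm.lintegral_prod_right'
  have h1 : ∀ x, ∫⁻ s : ℝ, Ω.indicator G (x + s • u)
      = ∫⁻ s : ℝ, Ω.indicator G (perp u x + s • u) := by
    intro x
    obtain ⟨r, hr⟩ := perp_eq_sub u x
    rw [← lintegral_add_left_eq_self (fun s : ℝ => Ω.indicator G (perp u x + s • u)) r]
    refine lintegral_congr fun s => ?_
    conv_lhs => rw [← hr]
    congr 1
    module
  calc ∫⁻ x, (∫⁻ s : ℝ, Ω.indicator G (x + s • u)) ∂(fluxMeasure Ω u)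
      = ∫⁻ x, (fun y : W => ∫⁻ s : ℝ, Ω.indicator G ((y : E3) + s • u)) ⟨perp u x, perp_mem hu x⟩
        ∂(fluxMeasure Ω u) := lintegral_congr h1
    _ = ∫⁻ y in shadow Ω u, ∫⁻ s : ℝ, Ω.indicator G ((y : E3) + s • u) := by
        rw [← map_perp_fluxMeasure hΩ hu, lintegral_map hHm hq]
    _ = ∫⁻ y : W, ∫⁻ s : ℝ, Ω.indicator G ((y : E3) + s • u) := by
        rw [← lintegral_indicator (isOpen_shadow hΩ.isOpen u).measurableSet]
        refine lintegral_congr fun y => ?_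
        by_cases hy : y ∈ shadow Ω u
        · rw [indicator_of_mem hy]
        · rw [indicator_of_notMem hy]
          symm
          exact (lintegral_congr fun s => indicator_of_notMem (fun h => hy ⟨s, h⟩) _).trans
            lintegral_zero
    _ = ∫⁻ p : W × ℝ, Ω.indicator G ((p.1 : E3) + p.2 • u) := by
        rw [Measure.volume_eq_prod, lintegral_prod _ hjm.aemeasurable]
    _ = ∫⁻ x, Ω.indicator G x := by
        rw [← (measurePreserving_lineCoord u hu).lintegral_comp hGi]
        simp only [lineCoord_apply]
        rfl
    _ = ∫⁻ x in Ω, G x := lintegral_indicator hΩ.isOpen.measurableSet _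

/-- The length of the ray from `z.1` in the direction `z.2` inside `Ω`. -/
def chordLength (Ω : Set E3) (x u : E3) : ℝ := (volume {s : ℝ | 0 < s ∧ x + s • u ∈ Ω}).toReal

theorem chordLength_eq {Ω : Set E3} {x u : E3} {L : ℝ} (hL : 0 < L)
    (h : ∀ s : ℝ, 0 < s → (x + s • u ∈ Ω ↔ s < L)) : chordLength Ω x u = L := by
  have : {s : ℝ | 0 < s ∧ x + s • u ∈ Ω} = Ioo 0 L := by
    ext s
    exact ⟨fun hs => ⟨hs.1, (h s hs.1).1 hs.2⟩, fun hs => ⟨hs.1, (h s hs.1).2 hs.2⟩⟩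
  rw [chordLength, this, Real.volume_Ioo, sub_zero, ENNReal.toReal_ofReal hL.le]

theorem chord_spec {Ω : Set E3} (hΩ : IsC2ConvexDomain Ω) {u x : E3} (hu : ‖u‖ = 1)
    (hx : x ∈ inflow Ω u) :
    0 < chordLength Ω x u ∧ (∀ s : ℝ, x + s • u ∈ Ω ↔ s ∈ Ioo 0 (chordLength Ω x u)) ∧
      x + chordLength Ω x u • u ∈ inflow Ω (-u) := by
  obtain ⟨L, hL, h1, h2⟩ := exists_chord hΩ hu hx
  have : chordLength Ω x u = L :=
    chordLength_eq hL fun s hs => by rw [h1]; exact ⟨fun h => h.2, fun h => ⟨hs, h⟩⟩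
  rw [this]
  exact ⟨hL, h1, h2⟩

theorem chordLength_add_smul {Ω : Set E3} (hΩ : IsC2ConvexDomain Ω) {u x : E3} (hu : ‖u‖ = 1)
    (hx : x ∈ inflow Ω u) {s : ℝ} (hs : 0 < s) (hsL : s ≤ chordLength Ω x u) :
    chordLength Ω (x + s • u) (-u) = s := by
  obtain ⟨-, h1, -⟩ := chord_spec hΩ hu hx
  refine chordLength_eq hs fun r hr => ?_
  have : x + s • u + r • -u = x + (s - r) • u := by module
  rw [this, h1]
  constructor
  · rintro ⟨h2, -⟩; linarith
  · intro h2; constructor <;> linarith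

/-- Defining the length as the measure of a section of an open condition makes its joint
measurability part of Tonelli's theorem. -/
theorem measurable_chordLength {Ω : Set E3} (hΩ : IsOpen Ω) :
    Measurable fun p : E3 × E3 => chordLength Ω p.1 p.2 := by
  have hS : MeasurableSet {q : (E3 × E3) × ℝ | 0 < q.2 ∧ q.1.1 + q.2 • q.1.2 ∈ Ω} := by
    refine (measurableSet_lt measurable_const measurable_snd).inter ?_
    have : Continuous fun q : (E3 × E3) × ℝ => q.1.1 + q.2 • q.1.2 := by fun_prop
    exact (hΩ.preimage this).measurableSet
  exact (measurable_measure_prodMk_left hS).ennreal_toReal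

/-- Both ends of a chord have the same projection along `u`, and each flux measure is the area of
that projection. -/
theorem fluxMeasure_neg_eq_map {Ω : Set E3} (hΩ : IsC2ConvexDomain Ω) {u : E3} (hu : ‖u‖ = 1) :
    fluxMeasure Ω (-u) = (fluxMeasure Ω u).map fun x => x + chordLength Ω x u • u := by
  have hE : Measurable fun x => x + chordLength Ω x u • u :=
    measurable_id.add (((measurable_chordLength hΩ.isOpen).comp
      (measurable_id.prodMk measurable_const)).smul_const u)
  ext A hA
  rw [Measure.map_apply hE hA, fluxMeasure_apply hΩ hu (hE hA),
    fluxMeasure_apply hΩ (by rwa [norm_neg]) hA]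
  have hp : perp (-u) = perp u := by
    ext1 x
    rw [perp_apply, perp_apply, inner_neg_left]
    module
  rw [hp]
  congr 1
  ext y
  constructor
  · rintro ⟨x, ⟨hxA, hx⟩, rfl⟩
    obtain ⟨h1, h2, h3⟩ := chord_spec hΩ (by rwa [norm_neg]) hx
    set L := chordLength Ω x (-u)
    rw [neg_neg] at h3
    have h4 : chordLength Ω (x + L • -u) u = L := by
      have := chordLength_add_smul hΩ (by rwa [norm_neg]) hx h1 le_rfl
      rwa [neg_neg] at this
    have h5 : x + L • -u + L • u = x := by module
    refine ⟨x + L • -u, ⟨?_, h3⟩, ?_⟩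
    · change x + L • -u + chordLength Ω (x + L • -u) u • u ∈ A
      rwa [h4, h5]
    · rw [← perp_add_smul hu _ L, h5]
  · rintro ⟨x, ⟨hxA, hx⟩, rfl⟩
    obtain ⟨h1, h2, h3⟩ := chord_spec hΩ hu hx
    exact ⟨_, ⟨hxA, h3⟩, perp_add_smul hu _ _⟩

/-! ### The phase space in characteristic coordinates -/

instance : IsFiniteMeasure dirMeasure := by
  unfold dirMeasure
  infer_instance

theorem norm_dir (β : Dir) : ‖(β : E3)‖ = 1 := norm_eq_of_mem_sphere β

theorem isFiniteMeasure_phaseMeasure {Ω : Set E3} (hΩ : IsC2ConvexDomain Ω) :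
    IsFiniteMeasure (phaseMeasure Ω) := by
  have : IsFiniteMeasure (volume.restrict Ω) :=
    ⟨by simpa using hΩ.isBounded.measure_lt_top⟩
  unfold phaseMeasure
  infer_instance

theorem measurable_inner_outerNormal {Ω : Set E3} (hΩ : IsC2ConvexDomain Ω) :
    Measurable fun z : E3 × Dir => (inner ℝ (z.2 : E3) (outerNormal Ω z.1) : ℝ) :=
  (measurable_subtype_coe.comp measurable_snd).inner ((measurable_outerNormal hΩ).comp measurable_fst)

theorem measurableSet_boundaryPart {Ω : Set E3} (hΩ : IsC2ConvexDomain Ω) (s : ℝ) :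
    MeasurableSet (boundaryPart Ω s) :=
  (isClosed_frontier.measurableSet.preimage measurable_fst).inter
    (measurableSet_lt measurable_const ((measurable_inner_outerNormal hΩ).const_mul s))

theorem isFiniteMeasure_boundaryMeasure {Ω : Set E3} (hΩ : IsC2ConvexDomain Ω) (s : ℝ) :
    IsFiniteMeasure (boundaryMeasure Ω s) := by
  have := isFiniteMeasure_surfaceMeasure hΩ
  have hb : ∀ z : E3 × Dir, z ∈ boundaryPart Ω s →
      ENNReal.ofReal (s * inner ℝ (z.2 : E3) (outerNormal Ω z.1)) ≤ ENNReal.ofReal |s| := by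
    intro z hz
    refine ENNReal.ofReal_le_ofReal ((le_abs_self _).trans ?_)
    rw [abs_mul]
    have := abs_real_inner_le_norm (z.2 : E3) (outerNormal Ω z.1)
    rw [norm_dir, norm_outerNormal hΩ hz.1, one_mul] at this
    exact mul_le_of_le_one_right (abs_nonneg s) this
  refine isFiniteMeasure_withDensity (ne_of_lt ?_)
  refine (setLIntegral_mono' (measurableSet_boundaryPart hΩ s) hb).trans_lt ?_
  rw [setLIntegral_const]
  exact ENNReal.mul_lt_top ENNReal.ofReal_lt_top (measure_lt_top _ _)

/-- Freezing the direction reduces both boundary measures to flux measures: `β` enters through the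
inflow part, and `-β` enters through the outflow part. -/
theorem lintegral_boundaryMeasure {Ω : Set E3} (hΩ : IsC2ConvexDomain Ω) (s : ℝ)
    {G : E3 × Dir → ℝ≥0∞} (hG : Measurable G) :
    ∫⁻ z, G z ∂(boundaryMeasure Ω s)
      = ∫⁻ β : Dir, (∫⁻ x, G (x, β) ∂(fluxMeasure Ω (-s • (β : E3)))) ∂dirMeasure := by
  have := isFiniteMeasure_surfaceMeasure hΩ
  have hd : Measurable fun z : E3 × Dir =>
      ENNReal.ofReal (s * inner ℝ (z.2 : E3) (outerNormal Ω z.1)) :=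
    ((measurable_inner_outerNormal hΩ).const_mul s).ennreal_ofReal
  have hm := measurableSet_boundaryPart hΩ s
  rw [boundaryMeasure, lintegral_withDensity_eq_lintegral_mul _ hd hG, ← lintegral_indicator hm,
    lintegral_prod_symm' _ ((hd.mul hG).indicator hm)]
  refine lintegral_congr fun β => ?_
  have hinf : ∀ x, (x, β) ∈ boundaryPart Ω s ↔ x ∈ frontier Ω ∧ x ∈ inflow Ω (-s • (β : E3)) := by
    intro x
    simp only [boundaryPart, inflow, mem_ofPred_eq, real_inner_smul_left]
    constructor
    · rintro ⟨h1, h2⟩; exact ⟨h1, h1, by linarith⟩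
    · rintro ⟨h1, -, h2⟩; exact ⟨h1, by linarith⟩
  have hd' : Measurable fun x => ENNReal.ofReal (-inner ℝ (-s • (β : E3)) (outerNormal Ω x)) :=
    ((measurable_const.inner (measurable_outerNormal hΩ)).neg).ennreal_ofReal
  have hGβ : Measurable fun x => G (x, β) := hG.comp (measurable_id.prodMk measurable_const)
  rw [fluxMeasure, lintegral_withDensity_eq_lintegral_mul _ hd' hGβ,
    ← lintegral_indicator (measurableSet_inflow hΩ _)]
  refine lintegral_congr fun x => ?_
  by_cases hx : (x, β) ∈ boundaryPart Ω s
  · rw [indicator_of_mem hx, indicator_of_mem ((hinf x).1 hx).2]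
    simp [real_inner_smul_left]
  · rw [indicator_of_notMem hx, indicator_of_notMem fun h => hx ((hinf x).2 ⟨h.1, h⟩)]

theorem mem_boundaryPart_neg_one {Ω : Set E3} {z : E3 × Dir} :
    z ∈ boundaryPart Ω (-1) ↔ z.1 ∈ inflow Ω (z.2 : E3) := by
  simp [boundaryPart, inflow]

theorem ae_boundaryMeasure_mem {Ω : Set E3} (hΩ : IsC2ConvexDomain Ω) (s : ℝ) :
    ∀ᵐ z ∂(boundaryMeasure Ω s), z ∈ boundaryPart Ω s :=
  (withDensity_absolutelyContinuous _ _).ae_le (ae_restrict_mem (measurableSet_boundaryPart hΩ s))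

/-- Transport along the direction for time `s`. -/
def flow (p : (E3 × Dir) × ℝ) : E3 × Dir := (p.1.1 + p.2 • (p.1.2 : E3), p.1.2)

theorem continuous_flow : Continuous flow := by
  unfold flow
  fun_prop

/-- The characteristic coordinates `(z, s)`, `z` an entry point and `0 < s` less than the length of
the chord, with the measure `|β·n| dΓ dβ ds`. -/
def charMeasure (Ω : Set E3) : Measure ((E3 × Dir) × ℝ) :=
  ((boundaryMeasure Ω (-1)).prod volume).restrict {p | (flow p).1 ∈ Ω}

theorem measurableSet_flow_mem {Ω : Set E3} (hΩ : IsOpen Ω) :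
    MeasurableSet {p : (E3 × Dir) × ℝ | (flow p).1 ∈ Ω} :=
  (hΩ.preimage (continuous_fst.comp continuous_flow)).measurableSet

theorem lintegral_charMeasure {Ω : Set E3} (hΩ : IsC2ConvexDomain Ω)
    {G : (E3 × Dir) × ℝ → ℝ≥0∞} (hG : Measurable G) :
    ∫⁻ p, G p ∂(charMeasure Ω)
      = ∫⁻ z, (∫⁻ s in Ioo 0 (chordLength Ω z.1 z.2), G (z, s)) ∂(boundaryMeasure Ω (-1)) := by
  have := isFiniteMeasure_boundaryMeasure hΩ (-1)
  have hm := measurableSet_flow_mem hΩ.isOpen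
  rw [charMeasure, ← lintegral_indicator hm, lintegral_prod _ (hG.indicator hm).aemeasurable]
  refine lintegral_congr_ae ?_
  filter_upwards [ae_boundaryMeasure_mem hΩ (-1)] with z hz
  rw [← lintegral_indicator measurableSet_Ioo]
  refine lintegral_congr fun s => ?_
  have := (chord_spec hΩ (norm_dir z.2) (mem_boundaryPart_neg_one.1 hz)).2.1 s
  by_cases hs : s ∈ Ioo 0 (chordLength Ω z.1 z.2)
  · rw [indicator_of_mem hs, indicator_of_mem]
    exact this.2 hs
  · rw [indicator_of_notMem hs, indicator_of_notMem]
    exact fun h => hs (this.1 h)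

/-- The change of variables behind all later estimates: for each direction it is Fubini along the
chords. -/
theorem measurePreserving_flow {Ω : Set E3} (hΩ : IsC2ConvexDomain Ω) :
    MeasurePreserving flow (charMeasure Ω) (phaseMeasure Ω) := by
  have := isFiniteMeasure_boundaryMeasure hΩ (-1)
  have hf := continuous_flow.measurable
  refine ⟨hf, Measure.ext_of_lintegral _ fun G hG => ?_⟩
  have hm := measurableSet_flow_mem hΩ.isOpen
  have hGm : Measurable fun p => {p : (E3 × Dir) × ℝ | (flow p).1 ∈ Ω}.indicator (G ∘ flow) p :=
    (hG.comp hf).indicator hm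
  rw [lintegral_map hG hf, phaseMeasure, lintegral_prod_symm' _ hG]
  change ∫⁻ p, (G ∘ flow) p ∂(charMeasure Ω) = _
  rw [charMeasure, ← lintegral_indicator hm, lintegral_prod _ hGm.aemeasurable,
    lintegral_boundaryMeasure hΩ (-1) hGm.lintegral_prod_right']
  refine lintegral_congr fun β => ?_
  have hGβ : Measurable fun x => G (x, β) := hG.comp (measurable_id.prodMk measurable_const)
  rw [neg_neg, one_smul, ← lintegral_fluxMeasure_line hΩ (norm_dir β) hGβ]
  refine lintegral_congr fun x => lintegral_congr fun s => ?_
  rfl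

/-- The map from the entry point of a chord to its exit point. -/
def exitPoint (Ω : Set E3) (z : E3 × Dir) : E3 × Dir := flow (z, chordLength Ω z.1 z.2)

theorem measurable_chord {Ω : Set E3} (hΩ : IsOpen Ω) :
    Measurable fun z : E3 × Dir => chordLength Ω z.1 z.2 :=
  Measurable.comp (g := fun p : E3 × E3 => chordLength Ω p.1 p.2)
    (f := fun z : E3 × Dir => (z.1, (z.2 : E3))) (measurable_chordLength hΩ)
    (measurable_fst.prodMk (measurable_subtype_coe.comp measurable_snd))

theorem measurePreserving_exitPoint {Ω : Set E3} (hΩ : IsC2ConvexDomain Ω) :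
    MeasurePreserving (exitPoint Ω) (boundaryMeasure Ω (-1)) (boundaryMeasure Ω 1) := by
  have he : Measurable (exitPoint Ω) :=
    continuous_flow.measurable.comp (measurable_id.prodMk (measurable_chord hΩ.isOpen))
  refine ⟨he, Measure.ext_of_lintegral _ fun G hG => ?_⟩
  have hGe : Measurable fun z => G (exitPoint Ω z) := hG.comp he
  rw [lintegral_map hG he, lintegral_boundaryMeasure hΩ 1 hG,
    lintegral_boundaryMeasure hΩ (-1) hGe]
  refine lintegral_congr fun β => ?_
  have hGβ : Measurable fun x => G (x, β) := hG.comp (measurable_id.prodMk measurable_const)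
  have hx : Measurable fun x : E3 => x + chordLength Ω x β • (β : E3) :=
    measurable_id.add (((measurable_chordLength hΩ.isOpen).comp
      (measurable_id.prodMk measurable_const)).smul_const _)
  rw [neg_neg, one_smul, neg_one_smul, fluxMeasure_neg_eq_map hΩ (norm_dir β),
    lintegral_map hGβ hx]
  rfl

/-! ### The transport equation on a chord -/

/-- Green's formula on a single chord. Since `f` is only integrable, `u` is merely absolutely
continuous and satisfies `u' = f - u` almost everywhere, which is enough to integrate the derivative
of `u ψ`. -/
theorem integral_transport_by_parts {f ψ : ℝ → ℝ} {L c : ℝ}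
    (hf : IntervalIntegrable f volume 0 L) (hψ : ContDiff ℝ 1 ψ) :
    let u : ℝ → ℝ := fun s => Real.exp (-s) * (c + ∫ r in (0 : ℝ)..s, Real.exp r * f r)
    ∫ s in (0 : ℝ)..L, ((f s - u s) * ψ s + u s * deriv ψ s) = u L * ψ L - c * ψ 0 := by
  intro u
  have hef : IntervalIntegrable (fun r => Real.exp r * f r) volume 0 L :=
    hf.continuousOn_mul Real.continuous_exp.continuousOn
  have hac1 : AbsolutelyContinuousOnInterval (fun s => ∫ r in (0 : ℝ)..s, Real.exp r * f r) 0 L :=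
    hef.absolutelyContinuousOnInterval_intervalIntegral (by simp)
  have hac2 : AbsolutelyContinuousOnInterval (fun _ : ℝ => c) 0 L :=
    (contDiff_const (n := 1)).contDiffOn.absolutelyContinuousOnInterval
  have hac3 : AbsolutelyContinuousOnInterval (fun s : ℝ => Real.exp (-s)) 0 L := by
    have : ContDiff ℝ 1 (fun s : ℝ => Real.exp (-s)) := by fun_prop
    exact this.contDiffOn.absolutelyContinuousOnInterval
  have hacu : AbsolutelyContinuousOnInterval u 0 L := hac3.fun_mul (hac2.fun_add hac1)
  have hacψ : AbsolutelyContinuousOnInterval ψ 0 L := hψ.contDiffOn.absolutelyContinuousOnInterval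
  have h := hacu.integral_deriv_mul_eq_sub hacψ
  have hu0 : u 0 = c := by simp [u]
  rw [hu0] at h
  rw [← h]
  refine intervalIntegral.integral_congr_ae ?_
  filter_upwards [hef.ae_hasDerivAt_integral] with s hs hsL
  have h1 := (hs (uIoc_subset_uIcc hsL) 0 (by simp)).const_add c
  have h2 : HasDerivAt (fun s : ℝ => Real.exp (-s)) (-Real.exp (-s)) s := by
    simpa using (hasDerivAt_neg s).exp
  have h3 : HasDerivAt u (f s - u s) s := by
    have := h2.mul h1
    refine this.congr_deriv ?_
    have h4 : Real.exp (-s) * Real.exp s = 1 := by rw [← Real.exp_add]; simp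
    simp only [u]
    linear_combination f s * h4
  rw [h3.deriv]

theorem sq_lintegral_le {α : Type*} [MeasurableSpace α] (μ : Measure α) {f : α → ℝ≥0∞}
    (hf : AEMeasurable f μ) : (∫⁻ a, f a ∂μ) ^ 2 ≤ μ univ * ∫⁻ a, f a ^ 2 ∂μ := by
  have h := ENNReal.lintegral_mul_le_Lp_mul_Lq μ Real.HolderConjugate.two_two hf
    (aemeasurable_const (b := (1 : ℝ≥0∞)))
  simp only [Pi.mul_apply, mul_one, lintegral_const, ENNReal.rpow_two, one_pow, one_mul] at h
  calc (∫⁻ a, f a ∂μ) ^ 2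
      ≤ ((∫⁻ a, f a ^ 2 ∂μ) ^ (1 / 2 : ℝ) * μ univ ^ (1 / 2 : ℝ)) ^ 2 := by gcongr
    _ = μ univ * ∫⁻ a, f a ^ 2 ∂μ := by
      rw [mul_pow, ← ENNReal.rpow_two, ← ENNReal.rpow_two, ← ENNReal.rpow_mul, ← ENNReal.rpow_mul,
        mul_comm]
      norm_num

/-- The solution of `u' + u = F` along the characteristic starting at `z` with `u = g z` there. -/
def charSol (F g : E3 × Dir → ℝ) (p : (E3 × Dir) × ℝ) : ℝ :=
  Real.exp (-p.2) * (g p.1 + ∫ r in (0 : ℝ)..p.2, Real.exp r * F (flow (p.1, r)))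

/-- The solution of `v + β·∇v = F` with `v = g` at the entry points. -/
def transportSol (Ω : Set E3) (F g : E3 × Dir → ℝ) (z : E3 × Dir) : ℝ :=
  charSol F g (flow (z, -chordLength Ω z.1 (-(z.2 : E3))), chordLength Ω z.1 (-(z.2 : E3)))

/-- Truncating the time at `0` makes the oriented integral an integral of an indicator, measurable
in its parameter. Chord lengths are nonnegative, so nothing is lost. -/
theorem measurable_charSol {F g : E3 × Dir → ℝ} (hF : Measurable F) (hg : Measurable g) :
    Measurable fun p : (E3 × Dir) × ℝ => charSol F g (p.1, max p.2 0) := by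
  have h1 : Measurable fun q : ((E3 × Dir) × ℝ) × ℝ =>
      (Ioc 0 (max q.1.2 0)).indicator (fun r => Real.exp r * F (flow (q.1.1, r))) q.2 := by
    have hS : MeasurableSet {q : ((E3 × Dir) × ℝ) × ℝ | q.2 ∈ Ioc 0 (max q.1.2 0)} :=
      (measurableSet_lt measurable_const measurable_snd).inter
        (measurableSet_le measurable_snd (by fun_prop))
    have h2 : Measurable fun q : ((E3 × Dir) × ℝ) × ℝ => Real.exp q.2 * F (flow (q.1.1, q.2)) :=
      (Real.measurable_exp.comp measurable_snd).mul
        (hF.comp (continuous_flow.measurable.comp (by fun_prop)))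
    exact h2.indicator hS
  have h3 : Measurable fun p : (E3 × Dir) × ℝ =>
      ∫ r in (0 : ℝ)..(max p.2 0), Real.exp r * F (flow (p.1, r)) := by
    have := (h1.stronglyMeasurable.integral_prod_right' (ν := volume)).measurable
    simp only [integral_indicator measurableSet_Ioc] at this
    simpa only [intervalIntegral.integral_of_le (le_max_right _ (0 : ℝ))] using this
  unfold charSol
  exact (by fun_prop : Measurable fun p : (E3 × Dir) × ℝ => Real.exp (-(max p.2 0))).mul
    ((hg.comp measurable_fst).add h3)

theorem chordLength_nonneg (Ω : Set E3) (x u : E3) : 0 ≤ chordLength Ω x u :=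
  ENNReal.toReal_nonneg

theorem measurable_transportSol {Ω : Set E3} (hΩ : IsOpen Ω) {F g : E3 × Dir → ℝ}
    (hF : Measurable F) (hg : Measurable g) : Measurable (transportSol Ω F g) := by
  have hc : Measurable fun z : E3 × Dir => chordLength Ω z.1 (-(z.2 : E3)) :=
    Measurable.comp (g := fun p : E3 × E3 => chordLength Ω p.1 p.2)
      (f := fun z : E3 × Dir => (z.1, -(z.2 : E3))) (measurable_chordLength hΩ)
      (measurable_fst.prodMk (measurable_subtype_coe.comp measurable_snd).neg)
  have h := (measurable_charSol hF hg).comp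
    ((continuous_flow.measurable.comp (measurable_id.prodMk hc.neg)).prodMk hc)
  convert! h using 1
  ext1 z
  exact (congrArg (fun s => charSol F g (flow (z, -chordLength Ω z.1 (-(z.2 : E3))), s))
    (max_eq_left (chordLength_nonneg Ω z.1 (-(z.2 : E3))))).symm

/-- The case where `s` is the full chord length is included, so that the same function also
furnishes the trace on the outflow boundary. -/
theorem transportSol_flow {Ω : Set E3} (hΩ : IsC2ConvexDomain Ω) {F g : E3 × Dir → ℝ}
    {z : E3 × Dir} (hz : z ∈ boundaryPart Ω (-1)) {s : ℝ} (hs : 0 < s)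
    (hsL : s ≤ chordLength Ω z.1 z.2) :
    transportSol Ω F g (flow (z, s)) = charSol F g (z, s) := by
  have h := chordLength_add_smul hΩ (norm_dir z.2) (mem_boundaryPart_neg_one.1 hz) hs hsL
  have h1 : chordLength Ω (flow (z, s)).1 (-((flow (z, s)).2 : E3)) = s := h
  rw [transportSol, h1]
  congr 2
  refine Prod.ext ?_ rfl
  simp [flow]

theorem exists_chord_bound {Ω : Set E3} (hΩ : IsC2ConvexDomain Ω) :
    ∃ D : ℝ≥0, 0 < D ∧ (∀ x ∈ Ω, ∀ y ∈ Ω, dist x y < D) ∧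
      ∀ z ∈ boundaryPart Ω (-1), chordLength Ω z.1 z.2 ≤ D := by
  obtain ⟨R, hR⟩ := Metric.isBounded_iff.1 hΩ.isBounded
  obtain ⟨x₀, hx₀⟩ := hΩ.nonempty
  have hR0 : 0 ≤ R := by simpa using hR hx₀ hx₀
  refine ⟨(R + 1).toNNReal, by simp; linarith, ?_, ?_⟩
  · intro x hx y hy
    rw [Real.coe_toNNReal _ (by linarith)]
    linarith [hR hx hy]
  · intro z hz
    rw [Real.coe_toNNReal _ (by linarith)]
    obtain ⟨h1, h2, -⟩ := chord_spec hΩ (norm_dir z.2) (mem_boundaryPart_neg_one.1 hz)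
    set L := chordLength Ω z.1 z.2
    by_contra! h
    -- The ends of the chord are outside `Ω`; the points at distance `1/4` from them are inside and
    -- at mutual distance `L - 1/2`, too far apart if `L > R + 1`.
    have ha := (h2 ((1 : ℝ) / 4)).2 ⟨by norm_num, by linarith⟩
    have hb := (h2 (L - 1 / 4)).2 ⟨by linarith, by linarith⟩
    have := hR hb ha
    rw [dist_add_left, dist_eq_norm, ← sub_smul, norm_smul, norm_dir, mul_one] at this
    linarith [le_abs_self (L - 1 / 4 - 1 / 4), Real.norm_eq_abs (L - 1 / 4 - 1 / 4)]

/-- In Duhamel's formula the exponential factors are at most `1`, and Cauchy–Schwarz on a chord of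
length at most `D` costs the factor `D`. The bound does not depend on `s`, so it serves inside and
at the exit point alike. -/
theorem sq_enorm_charSol_le {F g : E3 × Dir → ℝ} (hF : Measurable F) {z : E3 × Dir} {s L : ℝ}
    {D : ℝ≥0} (hs : 0 < s) (hsL : s ≤ L) (hL : L ≤ D) :
    ‖charSol F g (z, s)‖ₑ ^ 2
      ≤ 2 * ‖g z‖ₑ ^ 2 + 2 * D * ∫⁻ r in Ioo 0 L, ‖F (flow (z, r))‖ₑ ^ 2 := by
  have h1 : charSol F g (z, s)
      = Real.exp (-s) * g z + ∫ r in Ioc 0 s, Real.exp (-s) * (Real.exp r * F (flow (z, r))) := by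
    rw [charSol, mul_add, intervalIntegral.integral_of_le hs.le, integral_const_mul]
  have h2 : ‖Real.exp (-s) * g z‖ₑ ≤ ‖g z‖ₑ := by
    rw [enorm_mul]
    refine mul_le_of_le_one_left (zero_le) ?_
    rw [Real.enorm_eq_ofReal (Real.exp_pos _).le, ENNReal.ofReal_le_one]
    exact Real.exp_le_one_iff.2 (by linarith)
  have h3 : ‖∫ r in Ioc 0 s, Real.exp (-s) * (Real.exp r * F (flow (z, r)))‖ₑ
      ≤ ∫⁻ r in Ioo 0 L, ‖F (flow (z, r))‖ₑ := by
    refine (enorm_integral_le_lintegral_enorm _).trans ?_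
    refine (setLIntegral_mono_ae' measurableSet_Ioc (Eventually.of_forall fun r hr => ?_)).trans
      ((lintegral_mono_set (Ioc_subset_Ioc_right hsL)).trans (setLIntegral_congr Ioo_ae_eq_Ioc).ge)
    rw [← mul_assoc, ← Real.exp_add, enorm_mul]
    refine mul_le_of_le_one_left (zero_le) ?_
    rw [Real.enorm_eq_ofReal (Real.exp_pos _).le, ENNReal.ofReal_le_one]
    exact Real.exp_le_one_iff.2 (by linarith [hr.2])
  have hm : Measurable fun r : ℝ => ‖F (flow (z, r))‖ₑ :=
    (hF.comp (continuous_flow.measurable.comp (by fun_prop))).enorm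
  have h4 : (∫⁻ r in Ioo 0 L, ‖F (flow (z, r))‖ₑ) ^ 2
      ≤ D * ∫⁻ r in Ioo 0 L, ‖F (flow (z, r))‖ₑ ^ 2 := by
    refine (sq_lintegral_le _ hm.aemeasurable).trans ?_
    gcongr
    rw [Measure.restrict_apply_univ, Real.volume_Ioo, sub_zero, ← ENNReal.ofReal_coe_nnreal]
    exact ENNReal.ofReal_le_ofReal hL
  have h5 : ∀ a b : ℝ≥0∞, (a + b) ^ 2 ≤ 2 * a ^ 2 + 2 * b ^ 2 := by
    intro a b
    have := ENNReal.rpow_add_le_mul_rpow_add_rpow a b (p := 2) (by norm_num)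
    norm_num at this
    simpa [mul_add] using this
  calc ‖charSol F g (z, s)‖ₑ ^ 2
      ≤ (‖g z‖ₑ + ∫⁻ r in Ioo 0 L, ‖F (flow (z, r))‖ₑ) ^ 2 := by
        rw [h1]
        gcongr
        exact (enorm_add_le _ _).trans (add_le_add h2 h3)
    _ ≤ _ := (h5 _ _).trans (by rw [mul_assoc]; gcongr)

/-! ### Existence for the stationary transport problem -/

theorem chord_pos {Ω : Set E3} (hΩ : IsC2ConvexDomain Ω) {z : E3 × Dir}
    (hz : z ∈ boundaryPart Ω (-1)) : 0 < chordLength Ω z.1 z.2 :=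
  (chord_spec hΩ (norm_dir z.2) (mem_boundaryPart_neg_one.1 hz)).1

theorem lintegral_phaseMeasure {Ω : Set E3} (hΩ : IsC2ConvexDomain Ω)
    {G : E3 × Dir → ℝ≥0∞} (hG : Measurable G) :
    ∫⁻ z, G z ∂(phaseMeasure Ω) = ∫⁻ z, (∫⁻ s in Ioo 0 (chordLength Ω z.1 z.2), G (flow (z, s)))
      ∂(boundaryMeasure Ω (-1)) := by
  rw [← (measurePreserving_flow hΩ).lintegral_comp hG]
  exact lintegral_charMeasure hΩ (hG.comp continuous_flow.measurable)

theorem integral_charMeasure {Ω : Set E3} (hΩ : IsC2ConvexDomain Ω)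
    {G : (E3 × Dir) × ℝ → ℝ} (hG : Integrable G (charMeasure Ω)) :
    ∫ p, G p ∂(charMeasure Ω)
      = ∫ z, (∫ s in (0 : ℝ)..(chordLength Ω z.1 z.2), G (z, s)) ∂(boundaryMeasure Ω (-1)) := by
  have := isFiniteMeasure_boundaryMeasure hΩ (-1)
  have hm := measurableSet_flow_mem hΩ.isOpen
  rw [charMeasure, ← integral_indicator hm,
    integral_prod _ ((integrable_indicator_iff hm).2 hG)]
  refine integral_congr_ae ?_
  filter_upwards [ae_boundaryMeasure_mem hΩ (-1)] with z hz
  rw [intervalIntegral.integral_of_le (chordLength_nonneg _ _ _), integral_Ioc_eq_integral_Ioo,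
    ← integral_indicator measurableSet_Ioo]
  refine integral_congr_ae (Eventually.of_forall fun s => ?_)
  have := (chord_spec hΩ (norm_dir z.2) (mem_boundaryPart_neg_one.1 hz)).2.1 s
  by_cases hs : s ∈ Ioo 0 (chordLength Ω z.1 z.2)
  · simp only
    rw [indicator_of_mem hs, indicator_of_mem]
    exact this.2 hs
  · simp only
    rw [indicator_of_notMem hs, indicator_of_notMem]
    exact fun h => hs (this.1 h)

/-- The chordwise bound is integrated over entry points; the interior estimate has one more factor
`D` from the integration along the chord. -/
theorem lintegral_sq_transportSol_le {Ω : Set E3} (hΩ : IsC2ConvexDomain Ω) {D : ℝ≥0}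
    (hD : ∀ z ∈ boundaryPart Ω (-1), chordLength Ω z.1 z.2 ≤ D) {F g : E3 × Dir → ℝ}
    (hF : Measurable F) (hg : Measurable g) :
    ∫⁻ z, ‖transportSol Ω F g z‖ₑ ^ 2 ∂(phaseMeasure Ω)
      ≤ D * (2 * ∫⁻ z, ‖g z‖ₑ ^ 2 ∂(boundaryMeasure Ω (-1))
        + 2 * D * ∫⁻ z, ‖F z‖ₑ ^ 2 ∂(phaseMeasure Ω)) ∧
    ∫⁻ z, ‖transportSol Ω F g z‖ₑ ^ 2 ∂(boundaryMeasure Ω 1)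
      ≤ 2 * ∫⁻ z, ‖g z‖ₑ ^ 2 ∂(boundaryMeasure Ω (-1))
        + 2 * D * ∫⁻ z, ‖F z‖ₑ ^ 2 ∂(phaseMeasure Ω) := by
  have hv := measurable_transportSol hΩ.isOpen hF hg
  have hgm : Measurable fun z => 2 * ‖g z‖ₑ ^ 2 := (hg.enorm.pow_const 2).const_mul _
  have hsum : ∫⁻ z, (2 * ‖g z‖ₑ ^ 2 + 2 * D * ∫⁻ r in Ioo 0 (chordLength Ω z.1 z.2),
      ‖F (flow (z, r))‖ₑ ^ 2) ∂(boundaryMeasure Ω (-1))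
      = 2 * ∫⁻ z, ‖g z‖ₑ ^ 2 ∂(boundaryMeasure Ω (-1))
        + 2 * D * ∫⁻ z, ‖F z‖ₑ ^ 2 ∂(phaseMeasure Ω) := by
    rw [lintegral_add_left hgm, lintegral_const_mul _ (hg.enorm.pow_const 2),
      lintegral_const_mul' _ _ (by finiteness),
      lintegral_phaseMeasure hΩ (hF.enorm.pow_const 2)]
  constructor
  · rw [lintegral_phaseMeasure hΩ (hv.enorm.pow_const 2), ← hsum,
      ← lintegral_const_mul' _ _ (by finiteness)]
    refine lintegral_mono_ae ?_
    filter_upwards [ae_boundaryMeasure_mem hΩ (-1)] with z hz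
    refine (setLIntegral_mono' measurableSet_Ioo fun s hs => ?_).trans
      (setLIntegral_const _ (2 * ‖g z‖ₑ ^ 2 + 2 * D * ∫⁻ r in Ioo 0 (chordLength Ω z.1 z.2),
      ‖F (flow (z, r))‖ₑ ^ 2) |>.le.trans ?_)
    · rw [transportSol_flow hΩ hz hs.1 hs.2.le]
      exact sq_enorm_charSol_le hF hs.1 hs.2.le (hD z hz)
    · rw [mul_comm, Real.volume_Ioo, sub_zero, ← ENNReal.ofReal_coe_nnreal]
      gcongr
      exact hD z hz
  · rw [← (measurePreserving_exitPoint hΩ).lintegral_comp (hv.enorm.pow_const 2), ← hsum]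
    refine lintegral_mono_ae ?_
    filter_upwards [ae_boundaryMeasure_mem hΩ (-1)] with z hz
    rw [exitPoint, transportSol_flow hΩ hz (chord_pos hΩ hz) le_rfl]
    exact sq_enorm_charSol_le hF (chord_pos hΩ hz) le_rfl (hD z hz)

theorem memLp_two_iff {α : Type*} [MeasurableSpace α] {μ : Measure α} {f : α → ℝ}
    (hf : AEStronglyMeasurable f μ) : MemLp f 2 μ ↔ ∫⁻ a, ‖f a‖ₑ ^ 2 ∂μ < ⊤ := by
  have h := eLpNorm_lt_top_iff_lintegral_rpow_enorm_lt_top (μ := μ) (f := f) (p := 2)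
    (by norm_num) (by norm_num)
  simp only [ENNReal.toReal_ofNat, ENNReal.rpow_two] at h
  exact ⟨fun hm => h.1 hm.2, fun hl => ⟨hf, h.2 hl⟩⟩

theorem memLp_transportSol {Ω : Set E3} (hΩ : IsC2ConvexDomain Ω) {F g : E3 × Dir → ℝ}
    (hF : Measurable F) (hg : Measurable g) (hF2 : MemLp F 2 (phaseMeasure Ω))
    (hg2 : MemLp g 2 (boundaryMeasure Ω (-1))) :
    MemLp (transportSol Ω F g) 2 (phaseMeasure Ω) ∧
      MemLp (transportSol Ω F g) 2 (boundaryMeasure Ω 1) := by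
  obtain ⟨D, -, -, hD⟩ := exists_chord_bound hΩ
  obtain ⟨h1, h2⟩ := lintegral_sq_transportSol_le hΩ hD hF hg
  have hv := (measurable_transportSol hΩ.isOpen hF hg)
  have h3 := (memLp_two_iff hF.aestronglyMeasurable).1 hF2
  have h4 := (memLp_two_iff hg.aestronglyMeasurable).1 hg2
  exact ⟨(memLp_two_iff hv.aestronglyMeasurable).2 (h1.trans_lt (by finiteness)),
    (memLp_two_iff hv.aestronglyMeasurable).2 (h2.trans_lt (by finiteness))⟩

theorem dirDeriv_flow {φ : E3 × E3 → ℝ} (hφ : ContDiff ℝ ∞ φ) (z : E3 × Dir) (s : ℝ) :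
    HasDerivAt (fun s => φ ((flow (z, s)).1, ((flow (z, s)).2 : E3))) (dirDeriv φ (flow (z, s))) s := by
  have h1 : HasDerivAt (fun s : ℝ => ((z.1 + s • (z.2 : E3), (z.2 : E3)) : E3 × E3))
      ((z.2 : E3), 0) s := by
    refine HasDerivAt.prodMk ?_ (hasDerivAt_const _ _)
    simpa using ((hasDerivAt_id s).smul_const (z.2 : E3)).const_add z.1
  exact ((hφ.differentiable (by simp)).differentiableAt.hasFDerivAt).comp_hasDerivAt s h1

theorem continuous_dirDeriv {φ : E3 × E3 → ℝ} (hφ : ContDiff ℝ ∞ φ) :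
    Continuous (dirDeriv φ) := by
  have := hφ.continuous_fderiv (by simp)
  unfold dirDeriv
  fun_prop

theorem exists_bound_dirDeriv {φ : E3 × E3 → ℝ} (hφ : ContDiff ℝ ∞ φ) (hc : HasCompactSupport φ) :
    ∃ M, ∀ z : E3 × Dir, ‖dirDeriv φ z‖ ≤ M := by
  obtain ⟨M, hM⟩ := (hc.fderiv (𝕜 := ℝ)).exists_bound_of_continuous (hφ.continuous_fderiv (by simp))
  refine ⟨M, fun z => ?_⟩
  refine ((fderiv ℝ φ (z.1, (z.2 : E3))).le_opNorm _).trans ?_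
  have : ‖(((z.2 : E3), 0) : E3 × E3)‖ = 1 := by simp [Prod.norm_def]
  rw [this, mul_one]
  exact hM _

theorem integrable_mul_test {μ : Measure (E3 × Dir)} {v : E3 × Dir → ℝ} {φ : E3 × E3 → ℝ}
    (hv : Integrable v μ) (hφ : ContDiff ℝ ∞ φ) (hc : HasCompactSupport φ) :
    Integrable (fun z => v z * dirDeriv φ z) μ ∧
      Integrable (fun z => v z * φ (z.1, (z.2 : E3))) μ := by
  obtain ⟨M, hM⟩ := exists_bound_dirDeriv hφ hc
  obtain ⟨M', hM'⟩ := hc.exists_bound_of_continuous hφ.continuous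
  have hcφ : Continuous fun z : E3 × Dir => φ (z.1, (z.2 : E3)) := by
    have := hφ.continuous
    fun_prop
  exact ⟨hv.mul_bdd (continuous_dirDeriv hφ).aestronglyMeasurable (Eventually.of_forall hM),
    hv.mul_bdd hcφ.aestronglyMeasurable (Eventually.of_forall fun z => hM' _)⟩

/-- Green's formula for the solution of the transport problem. -/
theorem green_transportSol {Ω : Set E3} (hΩ : IsC2ConvexDomain Ω) {F g : E3 × Dir → ℝ}
    (hF : Measurable F) (hg : Measurable g) (hF2 : MemLp F 2 (phaseMeasure Ω))
    (hg2 : MemLp g 2 (boundaryMeasure Ω (-1))) {φ : E3 × E3 → ℝ} (hφ : ContDiff ℝ ∞ φ)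
    (hc : HasCompactSupport φ) :
    ∫ z, (F z - transportSol Ω F g z) * φ (z.1, (z.2 : E3)) ∂(phaseMeasure Ω)
      + ∫ z, transportSol Ω F g z * dirDeriv φ z ∂(phaseMeasure Ω)
      = ∫ z, transportSol Ω F g z * φ (z.1, (z.2 : E3)) ∂(boundaryMeasure Ω 1)
        - ∫ z, g z * φ (z.1, (z.2 : E3)) ∂(boundaryMeasure Ω (-1)) := by
  have := isFiniteMeasure_phaseMeasure hΩ
  have := isFiniteMeasure_boundaryMeasure hΩ (-1)
  have := isFiniteMeasure_boundaryMeasure hΩ 1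
  obtain ⟨hv2, hγ2⟩ := memLp_transportSol hΩ hF hg hF2 hg2
  have hFi := hF2.integrable one_le_two
  have hvi := hv2.integrable one_le_two
  have hγi := hγ2.integrable one_le_two
  have hgi := hg2.integrable one_le_two
  have hvm := measurable_transportSol hΩ.isOpen hF hg
  obtain ⟨h1, -⟩ := integrable_mul_test hvi hφ hc
  obtain ⟨-, h2⟩ := integrable_mul_test (hFi.sub hvi) hφ hc
  obtain ⟨-, h3⟩ := integrable_mul_test hγi hφ hc
  obtain ⟨-, h4⟩ := integrable_mul_test hgi hφ hc
  have hmp := measurePreserving_flow hΩ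
  have hme := measurePreserving_exitPoint hΩ
  simp only [Pi.sub_apply] at h2
  have h5 : Integrable (fun z => (F z - transportSol Ω F g z) * φ (z.1, (z.2 : E3))
      + transportSol Ω F g z * dirDeriv φ z) (phaseMeasure Ω) := h2.add h1
  rw [← integral_add h2 h1, ← hmp.map_eq,
    integral_map hmp.measurable.aemeasurable (by rw [hmp.map_eq]; exact h5.aestronglyMeasurable),
    integral_charMeasure hΩ (G := fun p => (F (flow p) - transportSol Ω F g (flow p)) *
      φ ((flow p).1, ((flow p).2 : E3)) + transportSol Ω F g (flow p) * dirDeriv φ (flow p))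
      (hmp.integrable_comp_of_integrable h5)]
  have h6 : ∫ z, transportSol Ω F g z * φ (z.1, (z.2 : E3)) ∂(boundaryMeasure Ω 1)
      = ∫ z, transportSol Ω F g (exitPoint Ω z) * φ ((exitPoint Ω z).1, ((exitPoint Ω z).2 : E3))
        ∂(boundaryMeasure Ω (-1)) := by
    rw [← hme.map_eq, integral_map hme.measurable.aemeasurable
      (by rw [hme.map_eq]; exact h3.aestronglyMeasurable)]
  have h7 : Integrable (fun z => transportSol Ω F g (exitPoint Ω z) *
      φ ((exitPoint Ω z).1, ((exitPoint Ω z).2 : E3))) (boundaryMeasure Ω (-1)) :=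
    hme.integrable_comp_of_integrable h3
  rw [h6, ← integral_sub h7 h4]
  refine integral_congr_ae ?_
  have hm := measurableSet_flow_mem hΩ.isOpen
  have hfin := ((integrable_indicator_iff hm).2
    (hmp.integrable_comp_of_integrable hFi)).prod_right_ae
  filter_upwards [ae_boundaryMeasure_mem hΩ (-1), hfin] with z hz hzfin
  have hL := chord_pos hΩ hz
  set L := chordLength Ω z.1 z.2 with hLdef
  have hint : IntervalIntegrable (fun s => F (flow (z, s))) volume 0 L := by
    rw [intervalIntegrable_iff_integrableOn_Ioo_of_le hL.le,
      ← integrable_indicator_iff measurableSet_Ioo]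
    refine hzfin.congr (Eventually.of_forall fun s => ?_)
    have := (chord_spec hΩ (norm_dir z.2) (mem_boundaryPart_neg_one.1 hz)).2.1 s
    by_cases hs : s ∈ Ioo 0 L
    · simp only
      rw [indicator_of_mem hs, indicator_of_mem]
      · rfl
      · exact this.2 hs
    · simp only
      rw [indicator_of_notMem hs, indicator_of_notMem]
      exact fun h => hs (this.1 h)
  have hψ : ContDiff ℝ 1 fun s => φ ((flow (z, s)).1, ((flow (z, s)).2 : E3)) := by
    have h8 : ContDiff ℝ 1 φ := hφ.of_le (by simp)
    simp only [flow]
    fun_prop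
  have hparts := integral_transport_by_parts (c := g z) hint hψ
  rw [exitPoint, transportSol_flow hΩ hz hL le_rfl]
  have h0 : flow (z, 0) = z := by simp [flow]
  simp only [h0] at hparts
  refine Eq.trans ?_ hparts
  refine intervalIntegral.integral_congr_ae (Eventually.of_forall fun s hs => ?_)
  rw [uIoc_of_le hL.le] at hs
  rw [transportSol_flow hΩ hz hs.1 hs.2, (dirDeriv_flow hφ z s).deriv]
  rfl

/-- All three are the same Green formula; the support condition on the test function removes both
boundary terms, or the one on the opposite part. -/
theorem isWeakDirDeriv_transportSol {Ω : Set E3} (hΩ : IsC2ConvexDomain Ω) {F g : E3 × Dir → ℝ}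
    (hF : Measurable F) (hg : Measurable g) (hF2 : MemLp F 2 (phaseMeasure Ω))
    (hg2 : MemLp g 2 (boundaryMeasure Ω (-1))) :
    IsWeakDirDeriv Ω (transportSol Ω F g) (F - transportSol Ω F g) ∧
      IsTrace Ω 1 (transportSol Ω F g) (F - transportSol Ω F g) (transportSol Ω F g) ∧
      IsTrace Ω (-1) (transportSol Ω F g) (F - transportSol Ω F g) g := by
  have := isFiniteMeasure_phaseMeasure hΩ
  have := isFiniteMeasure_boundaryMeasure hΩ (-1)
  have := isFiniteMeasure_boundaryMeasure hΩ 1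
  obtain ⟨hv2, hγ2⟩ := memLp_transportSol hΩ hF hg hF2 hg2
  have hFi := hF2.integrable one_le_two
  have hvi := hv2.integrable one_le_two
  have hγi := hγ2.integrable one_le_two
  have hgi := hg2.integrable one_le_two
  have hzero : ∀ {s : ℝ} {γ : E3 × Dir → ℝ} {φ : E3 × E3 → ℝ},
      (∀ z ∈ boundaryPart Ω s, (z.1, (z.2 : E3)) ∉ tsupport φ) →
      ∫ z, γ z * φ (z.1, (z.2 : E3)) ∂(boundaryMeasure Ω s) = 0 := by
    intro s γ φ h
    refine integral_eq_zero_of_ae ?_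
    filter_upwards [ae_boundaryMeasure_mem hΩ s] with z hz
    rw [image_eq_zero_of_notMem_tsupport (h z hz)]
    simp
  refine ⟨fun φ hφ hc hs => ?_, fun φ hφ hc hs => ?_, fun φ hφ hc hs => ?_⟩
  all_goals
    have hgreen := green_transportSol hΩ hF hg hF2 hg2 hφ hc
    obtain ⟨h1, -⟩ := integrable_mul_test hvi hφ hc
    obtain ⟨-, h2⟩ := integrable_mul_test (hFi.sub hvi) hφ hc
    obtain ⟨-, h3⟩ := integrable_mul_test hγi hφ hc
    obtain ⟨-, h4⟩ := integrable_mul_test hgi hφ hc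
  · refine ⟨h1, h2, ?_⟩
    have hb : ∀ s, ∀ z ∈ boundaryPart Ω s, (z.1, (z.2 : E3)) ∉ tsupport φ := by
      intro s z hz hm
      have := hz.1
      rw [hΩ.isOpen.frontier_eq] at this
      exact this.2 (hs hm).1
    rw [hzero (hb 1), hzero (hb (-1))] at hgreen
    simp only [Pi.sub_apply]
    linarith
  · refine ⟨h1, h2, h3, ?_⟩
    rw [hzero (s := -1) fun z hz hm => ?_] at hgreen
    · simp only [Pi.sub_apply]
      linarith
    · have h5 := (hs z.1 hz.1 z.2 hm).2
      have h6 := hz.2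
      simp only at h5
      linarith
  · refine ⟨h1, h2, h4, ?_⟩
    rw [hzero (s := 1) fun z hz hm => ?_] at hgreen
    · simp only [Pi.sub_apply]
      linarith
    · have h5 := (hs z.1 hz.1 z.2 hm).2
      have h6 := hz.2
      simp only at h5
      linarith

theorem IsWeakDirDeriv.congr {Ω : Set E3} {v v' d d' : E3 × Dir → ℝ} (h : IsWeakDirDeriv Ω v d)
    (hv : v' =ᵐ[phaseMeasure Ω] v) (hd : d' =ᵐ[phaseMeasure Ω] d) : IsWeakDirDeriv Ω v' d' :=
  h.smul (c := 1) (by simpa using hv) (by simpa using hd)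

theorem IsTrace.congr {Ω : Set E3} {s : ℝ} {v v' d d' γ γ' : E3 × Dir → ℝ} (h : IsTrace Ω s v d γ)
    (hv : v' =ᵐ[phaseMeasure Ω] v) (hd : d' =ᵐ[phaseMeasure Ω] d)
    (hγ : γ' =ᵐ[boundaryMeasure Ω s] γ) : IsTrace Ω s v' d' γ' :=
  h.smul (c := 1) (by simpa using hv) (by simpa using hd) (by simpa using hγ)

/-- `w` solves `w + β·∇w = F` with `w = g` on `∂Ω₋`. -/
def Solves {Ω : Set E3} (F : L2Phase Ω) (g : L2Minus Ω) (w : transportSpace Ω) : Prop :=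
  fn w + dirD w = F ∧ IsTrace Ω (-1) (fn w) (dirD w) g

theorem enorm_sq_Lp {α : Type*} [MeasurableSpace α] {μ : Measure α} (f : Lp ℝ 2 μ) :
    ‖f‖ₑ ^ 2 = ∫⁻ a, ‖f a‖ₑ ^ 2 ∂μ := by
  rw [Lp.enorm_def, eLpNorm_eq_lintegral_rpow_enorm_toReal (by norm_num) (by norm_num)]
  simp only [ENNReal.toReal_ofNat, ENNReal.rpow_two]
  rw [← ENNReal.rpow_two, ← ENNReal.rpow_mul]
  norm_num

/-- The representatives of the data are left free so that they can be taken nonnegative everywhere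
when positivity is wanted. The constant dominates the coefficients `6 D + 2` of `‖g‖²` and `6 D² + 2
D + 2` of `‖F‖²` that result from `‖F - v‖² ≤ 2 ‖F‖² + 2 ‖v‖²`. -/
theorem exists_solves_of_ae_eq {Ω : Set E3} (hΩ : IsC2ConvexDomain Ω) {D : ℝ≥0}
    (hD : ∀ z ∈ boundaryPart Ω (-1), chordLength Ω z.1 z.2 ≤ D) (F : L2Phase Ω) (g : L2Minus Ω)
    {F₀ g₀ : E3 × Dir → ℝ} (hF : Measurable F₀) (hg : Measurable g₀)
    (hFF : F =ᵐ[phaseMeasure Ω] F₀) (hgg : g =ᵐ[boundaryMeasure Ω (-1)] g₀) :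
    ∃ w : transportSpace Ω, Solves F g w ∧ fn w =ᵐ[phaseMeasure Ω] transportSol Ω F₀ g₀ ∧
      ‖w‖ ^ 2 ≤ (6 * D + 6 * D ^ 2 + 2 * D + 4) * (‖F‖ + ‖g‖) ^ 2 := by
  have hF2 : MemLp F₀ 2 (phaseMeasure Ω) := (memLp_congr_ae hFF).1 (Lp.memLp F)
  have hg2 : MemLp g₀ 2 (boundaryMeasure Ω (-1)) := (memLp_congr_ae hgg).1 (Lp.memLp g)
  obtain ⟨hv2, hγ2⟩ := memLp_transportSol hΩ hF hg hF2 hg2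
  obtain ⟨h1, h2, h3⟩ := isWeakDirDeriv_transportSol hΩ hF hg hF2 hg2
  have hd : (F - hv2.toLp : L2Phase Ω) =ᵐ[phaseMeasure Ω] F₀ - transportSol Ω F₀ g₀ :=
    (Lp.coeFn_sub _ _).trans (hFF.sub hv2.coeFn_toLp)
  let w : transportSpace Ω := ⟨WithLp.toLp 2 (hv2.toLp, WithLp.toLp 2 (F - hv2.toLp, hγ2.toLp)),
    h1.congr hv2.coeFn_toLp hd, h2.congr hv2.coeFn_toLp hd hγ2.coeFn_toLp⟩
  have hw1 : fn w = hv2.toLp := rfl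
  have hw2 : dirD w = F - hv2.toLp := rfl
  have hw3 : outTrace w = hγ2.toLp := rfl
  refine ⟨w, ⟨?_, ?_⟩, hv2.coeFn_toLp, ?_⟩
  · rw [hw1, hw2, add_sub_cancel]
  · exact h3.congr hv2.coeFn_toLp hd hgg
  obtain ⟨h4, h5⟩ := lintegral_sq_transportSol_le hΩ hD hF hg
  have e1 : ∫⁻ z, ‖transportSol Ω F₀ g₀ z‖ₑ ^ 2 ∂(phaseMeasure Ω) = ‖hv2.toLp‖ₑ ^ 2 := by
    rw [enorm_sq_Lp]
    exact lintegral_congr_ae (by filter_upwards [hv2.coeFn_toLp] with z hz; rw [hz])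
  have e2 : ∫⁻ z, ‖transportSol Ω F₀ g₀ z‖ₑ ^ 2 ∂(boundaryMeasure Ω 1) = ‖hγ2.toLp‖ₑ ^ 2 := by
    rw [enorm_sq_Lp]
    exact lintegral_congr_ae (by filter_upwards [hγ2.coeFn_toLp] with z hz; rw [hz])
  have e3 : ∫⁻ z, ‖F₀ z‖ₑ ^ 2 ∂(phaseMeasure Ω) = ‖F‖ₑ ^ 2 := by
    rw [enorm_sq_Lp]
    exact lintegral_congr_ae (by filter_upwards [hFF] with z hz; rw [hz])
  have e4 : ∫⁻ z, ‖g₀ z‖ₑ ^ 2 ∂(boundaryMeasure Ω (-1)) = ‖g‖ₑ ^ 2 := by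
    rw [enorm_sq_Lp]
    exact lintegral_congr_ae (by filter_upwards [hgg] with z hz; rw [hz])
  rw [e1, e3, e4] at h4
  rw [e2, e3, e4] at h5
  have r4 : ‖hv2.toLp‖ ^ 2 ≤ D * (2 * ‖g‖ ^ 2 + 2 * D * ‖F‖ ^ 2) := by
    have := ENNReal.toReal_mono (by finiteness) h4
    rw [ENNReal.toReal_mul, ENNReal.toReal_add (by finiteness) (by finiteness)] at this
    simpa using this
  have r5 : ‖hγ2.toLp‖ ^ 2 ≤ 2 * ‖g‖ ^ 2 + 2 * D * ‖F‖ ^ 2 := by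
    have := ENNReal.toReal_mono (by finiteness) h5
    rw [ENNReal.toReal_add (by finiteness) (by finiteness)] at this
    simpa using this
  have r6 : ‖F - hv2.toLp‖ ^ 2 ≤ 2 * ‖F‖ ^ 2 + 2 * ‖hv2.toLp‖ ^ 2 := by
    have := norm_sub_le F hv2.toLp
    nlinarith [norm_nonneg (F - hv2.toLp), sq_nonneg (‖F‖ - ‖hv2.toLp‖)]
  rw [norm_sq_eq, hw1, hw2, hw3]
  have hD0 : (0 : ℝ) ≤ D := D.2
  have hx := norm_nonneg F
  have hy := norm_nonneg g
  have hs : ‖F‖ ^ 2 + ‖g‖ ^ 2 ≤ (‖F‖ + ‖g‖) ^ 2 := by nlinarith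
  have hk : (0 : ℝ) ≤ 6 * D + 6 * D ^ 2 + 2 * D + 4 := by positivity
  refine le_trans ?_ (mul_le_mul_of_nonneg_left hs hk)
  have p1 : 0 ≤ (D : ℝ) * ‖F‖ ^ 2 := by positivity
  have p2 : 0 ≤ (D : ℝ) * ‖g‖ ^ 2 := by positivity
  have p3 : 0 ≤ (D : ℝ) ^ 2 * ‖g‖ ^ 2 := by positivity
  nlinarith [sq_nonneg ‖F‖, sq_nonneg ‖g‖]

theorem transportSol_nonneg {Ω : Set E3} {F g : E3 × Dir → ℝ} (hF : ∀ z, 0 ≤ F z)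
    (hg : ∀ z, 0 ≤ g z) (z : E3 × Dir) : 0 ≤ transportSol Ω F g z := by
  refine mul_nonneg (Real.exp_pos _).le (add_nonneg (hg _) ?_)
  exact intervalIntegral.integral_nonneg (chordLength_nonneg _ _ _) fun r _ =>
    mul_nonneg (Real.exp_pos _).le (hF _)

/-- Existence for the stationary transport problem. -/
theorem exists_solves {Ω : Set E3} (hΩ : IsC2ConvexDomain Ω) :
    ∃ C : ℝ, 0 < C ∧ ∀ (F : L2Phase Ω) (g : L2Minus Ω), ∃ w : transportSpace Ω,
      Solves F g w ∧ ‖w‖ ≤ C * (‖F‖ + ‖g‖) ∧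
      ((∀ᵐ z ∂(phaseMeasure Ω), 0 ≤ F z) → (∀ᵐ z ∂(boundaryMeasure Ω (-1)), 0 ≤ g z) →
        ∀ᵐ z ∂(phaseMeasure Ω), 0 ≤ fn w z) := by
  obtain ⟨D, -, -, hD⟩ := exists_chord_bound hΩ
  have hk : (0 : ℝ) < 6 * D + 6 * D ^ 2 + 2 * D + 4 := by positivity
  refine ⟨√(6 * D + 6 * D ^ 2 + 2 * D + 4), Real.sqrt_pos.2 hk, fun F g => ?_⟩
  have hnorm : ∀ w : transportSpace Ω,
      ‖w‖ ^ 2 ≤ (6 * D + 6 * D ^ 2 + 2 * D + 4) * (‖F‖ + ‖g‖) ^ 2 →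
      ‖w‖ ≤ √(6 * D + 6 * D ^ 2 + 2 * D + 4) * (‖F‖ + ‖g‖) := by
    intro w hw
    refine abs_le_of_sq_le_sq' ?_ (by positivity) |>.2
    rwa [mul_pow, Real.sq_sqrt hk.le]
  have hFm : Measurable F := (Lp.stronglyMeasurable F).measurable
  have hgm : Measurable g := (Lp.stronglyMeasurable g).measurable
  -- Nonnegative data are replaced by their positive parts, which are nonnegative at every point and
  -- hence along every chord.
  by_cases hpos : (∀ᵐ z ∂(phaseMeasure Ω), 0 ≤ F z) ∧ ∀ᵐ z ∂(boundaryMeasure Ω (-1)), 0 ≤ g z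
  · obtain ⟨w, h1, h2, h3⟩ := exists_solves_of_ae_eq hΩ hD F g (hFm.max measurable_const)
      (hgm.max measurable_const) (F₀ := fun z => max (F z) 0) (g₀ := fun z => max (g z) 0)
      (by filter_upwards [hpos.1] with z hz; rw [max_eq_left hz])
      (by filter_upwards [hpos.2] with z hz; rw [max_eq_left hz])
    refine ⟨w, h1, hnorm w h3, fun _ _ => ?_⟩
    filter_upwards [h2] with z hz
    rw [hz]
    exact transportSol_nonneg (fun _ => le_max_right _ _) (fun _ => le_max_right _ _) z
  · obtain ⟨w, h1, -, h3⟩ := exists_solves_of_ae_eq hΩ hD F g hFm hgm ae_eq_rfl ae_eq_rfl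
    exact ⟨w, h1, hnorm w h3, fun h4 h5 => absurd ⟨h4, h5⟩ hpos⟩

/-! ### Uniqueness for the stationary transport problem -/

/-- The embedding of the phase space into `ℝ³ × ℝ³`. -/
def phaseEmb (z : E3 × Dir) : E3 × E3 := (z.1, (z.2 : E3))

theorem measurableEmbedding_phaseEmb : MeasurableEmbedding phaseEmb :=
  MeasurableEmbedding.id.prodMap (MeasurableEmbedding.subtype_coe Metric.isClosed_sphere.measurableSet)

theorem continuous_phaseEmb : Continuous phaseEmb := by
  unfold phaseEmb
  fun_prop

/-- The test functions live on `ℝ³ × ℝ³`, so the measure is pushed forward there and `v` extended by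
zero off the embedded phase space; the fundamental lemma of the calculus of variations then applies.
-/
theorem ae_eq_zero_of_integral_test_eq_zero {μ : Measure (E3 × Dir)} {U : Set (E3 × E3)}
    (hU : IsOpen U) {v : E3 × Dir → ℝ} (hv : Integrable v μ)
    (h : ∀ θ : E3 × E3 → ℝ, ContDiff ℝ ∞ θ → HasCompactSupport θ → tsupport θ ⊆ U →
      ∫ z, v z * θ (phaseEmb z) ∂μ = 0) :
    ∀ᵐ z ∂μ, phaseEmb z ∈ U → v z = 0 := by
  have he := measurableEmbedding_phaseEmb
  set V : E3 × E3 → ℝ := Function.extend phaseEmb v 0 with hV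
  have hVv : ∀ z, V (phaseEmb z) = v z := fun z => he.injective.extend_apply _ _ _
  have hVi : Integrable V (μ.map phaseEmb) := by
    rw [he.integrable_map_iff]
    exact hv.congr (Eventually.of_forall fun z => (hVv z).symm)
  have key := hU.ae_eq_zero_of_integral_contDiff_smul_eq_zero (μ := μ.map phaseEmb)
    (hVi.locallyIntegrable.locallyIntegrableOn U) fun θ hθ hc hs => by
      rw [he.integral_map, ← h θ hθ hc hs]
      refine integral_congr_ae (Eventually.of_forall fun z => ?_)
      simp only [hVv, smul_eq_mul, mul_comm]
  have := (he.ae_map_iff).1 key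
  filter_upwards [this] with z hz hzU
  rw [← hVv, hz hzU]

/-- The solution, with zero outflow values, of the adjoint transport equation `β·∇φ - φ = θ`. -/
def adjointSol (R : ℝ) (θ : E3 × E3 → ℝ) (p : E3 × E3) : ℝ :=
  -∫ r in (0 : ℝ)..R, Real.exp (-r) * θ (p.1 + r • p.2, p.2)

/-- The integral is a convolution, evaluated at `0`, of a truncated exponential with a function
depending smoothly on the parameter `p`. The bump `χ` makes the latter compactly supported in the
line variable and is `1` where the exponential lives. -/
theorem contDiff_adjointSol {R : ℝ} (hR : 0 ≤ R) {θ : E3 × E3 → ℝ} (hθ : ContDiff ℝ ∞ θ) :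
    ContDiff ℝ ∞ (adjointSol R θ) := by
  let χ : ContDiffBump (0 : ℝ) := ⟨R + 1, R + 2, by linarith, by linarith⟩
  have hf : LocallyIntegrable ((Ioc 0 R).indicator fun r : ℝ => Real.exp (-r)) volume := by
    have : LocallyIntegrable (fun r : ℝ => Real.exp (-r)) volume :=
      (by fun_prop : Continuous fun r : ℝ => Real.exp (-r)).locallyIntegrable
    exact this.indicator measurableSet_Ioc
  have hg : ContDiff ℝ ∞ (fun q : (E3 × E3) × ℝ => χ q.2 * θ (q.1.1 - q.2 • q.1.2, q.1.2)) := by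
    have h1 : ContDiff ℝ ∞ χ := χ.contDiff
    fun_prop
  have h := contDiffOn_convolution_right_with_param_comp (n := ⊤) (μ := volume)
    (ContinuousLinearMap.lsmul ℝ ℝ)
    (v := fun _ : E3 × E3 => (0 : ℝ)) (s := univ) contDiffOn_const isOpen_univ
    (isCompact_closedBall (0 : ℝ) (R + 2))
    (f := (Ioc 0 R).indicator fun r : ℝ => Real.exp (-r))
    (g := fun p s => χ s * θ (p.1 - s • p.2, p.2))
    (fun p s _ hs => by
      have : χ s = 0 := χ.zero_of_le_dist (by
        rw [Metric.mem_closedBall, not_le] at hs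
        exact hs.le)
      rw [this, zero_mul]) hf hg.contDiffOn
  rw [contDiffOn_univ] at h
  have he : adjointSol R θ = fun p => -MeasureTheory.convolution
      ((Ioc 0 R).indicator fun r : ℝ => Real.exp (-r))
      (fun s => χ s * θ (p.1 - s • p.2, p.2)) (ContinuousLinearMap.lsmul ℝ ℝ) volume 0 := by
    ext1 p
    rw [adjointSol, convolution, intervalIntegral.integral_of_le hR,
      ← integral_indicator measurableSet_Ioc]
    congr 1
    refine integral_congr_ae (Eventually.of_forall fun r => ?_)
    simp only
    by_cases hr : r ∈ Ioc 0 R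
    · rw [indicator_of_mem hr, indicator_of_mem hr]
      have : χ (0 - r) = 1 := χ.one_of_mem_closedBall (by
        simp only [zero_sub, Metric.mem_closedBall, dist_zero_right, norm_neg, Real.norm_eq_abs]
        change |r| ≤ R + 1
        rw [abs_of_pos hr.1]
        linarith [hr.2])
      rw [this]
      simp
    · rw [indicator_of_notMem hr, indicator_of_notMem hr]
      simp
  rw [he]
  exact h.neg

/-- The support consists of points whose forward ray meets the support of `θ`. If the latter lies
over `Ω`, a boundary point in the support is therefore an entry point, which makes the function
admissible for the inflow trace. -/
theorem tsupport_adjointSol {R : ℝ} (hR : 0 ≤ R) {θ : E3 × E3 → ℝ} (hc : HasCompactSupport θ) :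
    HasCompactSupport (adjointSol R θ) ∧ ∀ p ∈ tsupport (adjointSol R θ),
      ∃ r : ℝ, 0 ≤ r ∧ (p.1 + r • p.2, p.2) ∈ tsupport θ := by
  set K : Set (E3 × E3) := (fun q : (E3 × E3) × ℝ => (q.1.1 - q.2 • q.1.2, q.1.2)) ''
    (tsupport θ ×ˢ Icc 0 R) with hK
  have hKc : IsCompact K := (hc.isCompact.prod isCompact_Icc).image (by fun_prop)
  have h0 : ∀ p, p ∉ K → adjointSol R θ p = 0 := by
    intro p hp
    rw [adjointSol, neg_eq_zero]
    refine intervalIntegral.integral_zero_ae (Eventually.of_forall fun r hr => ?_)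
    rw [uIoc_of_le hR] at hr
    have hm : (p.1 + r • p.2, p.2) ∉ tsupport θ := fun hm =>
      hp ⟨((p.1 + r • p.2, p.2), r), ⟨hm, ⟨hr.1.le, hr.2⟩⟩, by simp⟩
    rw [image_eq_zero_of_notMem_tsupport hm, mul_zero]
  refine ⟨HasCompactSupport.intro hKc h0, fun p hp => ?_⟩
  have hsub : tsupport (adjointSol R θ) ⊆ K :=
    closure_minimal (fun p hp => by_contra fun h => hp (h0 p h)) hKc.isClosed
  obtain ⟨⟨⟨y, b⟩, r⟩, ⟨hy, hr⟩, rfl⟩ := hsub hp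
  exact ⟨r, hr.1, by simpa using hy⟩

/-- Moving the base point along `β` only shifts the limits of integration, up to a factor `exp t`;
the fundamental theorem of calculus gives the equation, and the far limit contributes nothing since
`θ` vanishes there. -/
theorem dirDeriv_adjointSol {R : ℝ} (hR : 0 ≤ R) {θ : E3 × E3 → ℝ} (hθ : ContDiff ℝ ∞ θ)
    {z : E3 × Dir} (hz : θ (phaseEmb (flow (z, R))) = 0) :
    dirDeriv (adjointSol R θ) z = adjointSol R θ (phaseEmb z) + θ (phaseEmb z) := by
  have h1 := dirDeriv_flow (contDiff_adjointSol hR hθ) z 0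
  have h0 : flow (z, 0) = z := by simp [flow]
  rw [h0] at h1
  set f : ℝ → ℝ := fun u => Real.exp (-u) * θ (phaseEmb (flow (z, u))) with hf
  have hfc : Continuous f := by
    have := hθ.continuous
    have h2 : Continuous fun u : ℝ => phaseEmb (flow (z, u)) :=
      continuous_phaseEmb.comp (continuous_flow.comp (by fun_prop))
    fun_prop
  have h2 : ∀ t : ℝ, adjointSol R θ ((flow (z, t)).1, ((flow (z, t)).2 : E3))
      = -(Real.exp t * ((∫ u in (0 : ℝ)..(t + R), f u) - ∫ u in (0 : ℝ)..t, f u)) := by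
    intro t
    rw [intervalIntegral.integral_interval_sub_left (hfc.intervalIntegrable _ _)
      (hfc.intervalIntegrable _ _), adjointSol, ← intervalIntegral.integral_const_mul]
    have := intervalIntegral.integral_comp_add_left (a := 0) (b := R)
      (fun u => Real.exp t * f u) t
    rw [add_zero] at this
    rw [← this]
    congr 1
    refine intervalIntegral.integral_congr fun r _ => ?_
    simp only [hf, ← mul_assoc, ← Real.exp_add, flow, phaseEmb, add_smul, add_assoc]
    congr 2
    ring
  simp only [h2] at h1
  have h3 : HasDerivAt (fun t : ℝ => ∫ u in (0 : ℝ)..(t + R), f u) (f R) 0 := by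
    have := (intervalIntegral.integral_hasDerivAt_right (hfc.intervalIntegrable 0 (0 + R))
      hfc.stronglyMeasurable.stronglyMeasurableAtFilter hfc.continuousAt).comp_add_const (0 : ℝ) R
    simpa using this
  have h4 : HasDerivAt (fun t : ℝ => ∫ u in (0 : ℝ)..t, f u) (f 0) 0 :=
    intervalIntegral.integral_hasDerivAt_right (hfc.intervalIntegrable 0 0)
      hfc.stronglyMeasurable.stronglyMeasurableAtFilter hfc.continuousAt
  have h5 := ((Real.hasDerivAt_exp 0).mul (h3.sub h4)).neg
  have h6 := h1.unique h5
  rw [h6]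
  have h7 : f R = 0 := by simp only [hf, hz, mul_zero]
  have h8 : f 0 = θ (phaseEmb z) := by simp [hf, h0]
  have h9 := h2 0
  rw [h0] at h9
  have h10 : adjointSol R θ (phaseEmb z) = adjointSol R θ (z.1, (z.2 : E3)) := rfl
  rw [h10, h9, h7, h8]
  simp
  ring

/-- Its complement is the open set on which functions may be tested against the outflow trace. -/
theorem isClosed_compl_boundaryPart {Ω : Set E3} (hΩ : IsC2ConvexDomain Ω) :
    IsClosed (phaseEmb '' {z | z.1 ∈ frontier Ω ∧ z ∉ boundaryPart Ω 1}) := by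
  have hcpt : IsCompact (frontier Ω) :=
    Metric.isCompact_of_isClosed_isBounded isClosed_frontier
      (hΩ.isBounded.closure.subset frontier_subset_closure)
  have hK : IsCompact (frontier Ω ×ˢ (univ : Set Dir)) := hcpt.prod isCompact_univ
  have hcont : ContinuousOn (fun z : E3 × Dir => (inner ℝ (z.2 : E3) (outerNormal Ω z.1) : ℝ))
      (frontier Ω ×ˢ (univ : Set Dir)) :=
    (by fun_prop : Continuous fun z : E3 × Dir => (z.2 : E3)).continuousOn.inner
      ((continuousOn_outerNormal hΩ).comp continuousOn_fst fun z hz => hz.1)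
  have hcl := hcont.preimage_isClosed_of_isClosed hK.isClosed (isClosed_Iic (a := (0 : ℝ)))
  have he : {z : E3 × Dir | z.1 ∈ frontier Ω ∧ z ∉ boundaryPart Ω 1}
      = (frontier Ω ×ˢ (univ : Set Dir)) ∩
        (fun z : E3 × Dir => (inner ℝ (z.2 : E3) (outerNormal Ω z.1) : ℝ)) ⁻¹' Iic 0 := by
    ext z
    simp only [boundaryPart, mem_ofPred_eq, one_mul, mem_inter_iff, mem_prod, mem_univ, and_true,
      mem_preimage, mem_Iic, not_and, not_lt]
    exact ⟨fun h => ⟨h.1, h.2 h.1⟩, fun h => ⟨h.1, fun _ => h.2⟩⟩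
  rw [he]
  exact ((hK.of_isClosed_subset hcl inter_subset_left).image continuous_phaseEmb).isClosed

/-- The transport problem with zero data has only the zero solution. -/
theorem eq_zero_of_solves_zero {Ω : Set E3} (hΩ : IsC2ConvexDomain Ω) {w : transportSpace Ω}
    (h : Solves 0 0 w) : w = 0 := by
  have := isFiniteMeasure_phaseMeasure hΩ
  have := isFiniteMeasure_boundaryMeasure hΩ 1
  obtain ⟨D, hD0, hD, -⟩ := exists_chord_bound hΩ
  have hd : dirD w = -fn w := (neg_eq_of_add_eq_zero_right h.1).symm
  have hdae : dirD w =ᵐ[phaseMeasure Ω] -fn w := by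
    rw [hd]
    exact Lp.coeFn_neg _
  have haeΩ : ∀ᵐ z ∂(phaseMeasure Ω), z.1 ∈ Ω := by
    have : ∀ᵐ x ∂(volume.restrict Ω), x ∈ Ω := ae_restrict_mem hΩ.isOpen.measurableSet
    exact Measure.quasiMeasurePreserving_fst.ae this
  have hvi : Integrable (fn w) (phaseMeasure Ω) := (Lp.memLp _).integrable one_le_two
  have hv0 : ∀ᵐ z ∂(phaseMeasure Ω), fn w z = 0 := by
    -- Green's formula for the adjoint solution `φ` of `θ` has no boundary term and reads `∫ v (β·∇φ
    -- - φ) = 0`, that is, `∫ v θ = 0`.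
    have key := ae_eq_zero_of_integral_test_eq_zero (hΩ.isOpen.prod isOpen_univ) hvi
      fun θ hθ hc hs => ?_
    · filter_upwards [key, haeΩ] with z hz hzΩ
      exact hz ⟨hzΩ, mem_univ _⟩
    have hD' : (0 : ℝ) ≤ D := D.2
    obtain ⟨hcφ, hsφ⟩ := tsupport_adjointSol hD' hc
    have hφ := contDiff_adjointSol hD' hθ
    obtain ⟨h1, h2, h3, h4⟩ := h.2 (adjointSol D θ) hφ hcφ fun x hx β hm => by
      obtain ⟨r, hr, hrm⟩ := hsφ _ hm
      have hxr : x + r • (β : E3) ∈ Ω := (hs hrm).1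
      have hr0 : 0 < r := lt_of_le_of_ne hr fun h0 => by
        rw [← h0, zero_smul, add_zero] at hxr
        rw [hΩ.isOpen.frontier_eq] at hx
        exact hx.2 hxr
      exact mem_boundaryPart_neg_one.2 (mem_inflow_of_mem hΩ hx hr0 hxr)
    have h5 : ∫ z, (0 : L2Minus Ω) z * adjointSol D θ (z.1, (z.2 : E3)) ∂(boundaryMeasure Ω (-1))
        = 0 := (integrable_zero_mul (Lp.coeFn_zero ℝ 2 (boundaryMeasure Ω (-1)))).2
    rw [h5, mul_zero, ← integral_add h2 h1] at h4
    rw [← h4]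
    refine integral_congr_ae ?_
    filter_upwards [hdae, haeΩ] with z hz hzΩ
    -- The bound `D` exceeds every distance in `Ω` strictly, so after time `D` a ray starting in `Ω`
    -- has left it.
    have hz0 : θ (phaseEmb (flow (z, D))) = 0 := by
      refine image_eq_zero_of_notMem_tsupport fun hm => ?_
      have := hD _ (hs hm).1 _ hzΩ
      simp only [phaseEmb, flow, dist_eq_norm, add_sub_cancel_left, norm_smul, norm_dir, mul_one,
        Real.norm_of_nonneg hD'] at this
      exact lt_irrefl _ this
    rw [dirDeriv_adjointSol hD' hθ hz0, hz, Pi.neg_apply]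
    simp only [phaseEmb]
    ring
  have hfn : fn w = 0 := by
    ext1
    filter_upwards [hv0, Lp.coeFn_zero ℝ 2 (phaseMeasure Ω)] with z h1 h2
    rw [h1, h2, Pi.zero_apply]
  have hdD : dirD w = 0 := by rw [hd, hfn, neg_zero]
  have hγi : Integrable (outTrace w) (boundaryMeasure Ω 1) := (Lp.memLp _).integrable one_le_two
  -- An element of the space carries its outflow trace as separate data; once `v` and its derivative
  -- vanish, Green's formula forces the trace to vanish too.
  have hγ0 : ∀ᵐ z ∂(boundaryMeasure Ω 1), outTrace w z = 0 := by
    have key := ae_eq_zero_of_integral_test_eq_zero (isClosed_compl_boundaryPart hΩ).isOpen_compl hγi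
      fun θ hθ hc hs => ?_
    · filter_upwards [key, ae_boundaryMeasure_mem hΩ 1] with z hz hzb
      refine hz ?_
      rintro ⟨z', hz', he⟩
      rw [measurableEmbedding_phaseEmb.injective he] at hz'
      exact hz'.2 hzb
    obtain ⟨h1, h2, h3, h4⟩ := w.2.2 θ hθ hc fun x hx β hm => by
      by_contra hn
      exact hs hm ⟨(x, β), ⟨hx, hn⟩, rfl⟩
    have h5 : ∫ z, dirD w z * θ (z.1, (z.2 : E3)) ∂(phaseMeasure Ω) = 0 := by
      rw [hdD]
      exact (integrable_zero_mul (Lp.coeFn_zero ℝ 2 (phaseMeasure Ω))).2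
    have h6 : ∫ z, fn w z * dirDeriv θ z ∂(phaseMeasure Ω) = 0 := by
      rw [hfn]
      exact (integrable_zero_mul (Lp.coeFn_zero ℝ 2 (phaseMeasure Ω))).2
    change ∫ z, dirD w z * θ (z.1, (z.2 : E3)) ∂(phaseMeasure Ω)
      + ∫ z, fn w z * dirDeriv θ z ∂(phaseMeasure Ω)
      = 1 * ∫ z, outTrace w z * θ (z.1, (z.2 : E3)) ∂(boundaryMeasure Ω 1) at h4
    rw [h5, h6, add_zero, one_mul] at h4
    exact h4.symm
  have hout : outTrace w = 0 := by
    ext1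
    filter_upwards [hγ0, Lp.coeFn_zero ℝ 2 (boundaryMeasure Ω 1)] with z h1 h2
    rw [h1, h2, Pi.zero_apply]
  have hn := norm_sq_eq w
  rw [hfn, hdD, hout] at hn
  simpa using hn

theorem fn_add {Ω : Set E3} (w w' : transportSpace Ω) : fn (w + w') = fn w + fn w' := rfl

theorem fn_smul {Ω : Set E3} (c : ℝ) (w : transportSpace Ω) : fn (c • w) = c • fn w := rfl

theorem dirD_add {Ω : Set E3} (w w' : transportSpace Ω) : dirD (w + w') = dirD w + dirD w' := rfl

theorem dirD_smul {Ω : Set E3} (c : ℝ) (w : transportSpace Ω) : dirD (c • w) = c • dirD w := rfl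

theorem Solves.add {Ω : Set E3} {F F' : L2Phase Ω} {g g' : L2Minus Ω} {w w' : transportSpace Ω}
    (h : Solves F g w) (h' : Solves F' g' w') : Solves (F + F') (g + g') (w + w') := by
  refine ⟨?_, h.2.add h'.2 (Lp.coeFn_add _ _) (Lp.coeFn_add _ _) (Lp.coeFn_add _ _)⟩
  rw [fn_add, dirD_add, ← h.1, ← h'.1]
  abel

theorem Solves.smul {Ω : Set E3} {F : L2Phase Ω} {g : L2Minus Ω} {w : transportSpace Ω} (c : ℝ)
    (h : Solves F g w) : Solves (c • F) (c • g) (c • w) := by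
  refine ⟨?_, h.2.smul (Lp.coeFn_smul _ _) (Lp.coeFn_smul _ _) (Lp.coeFn_smul _ _)⟩
  rw [fn_smul, dirD_smul, ← h.1, smul_add]

theorem Solves.unique {Ω : Set E3} (hΩ : IsC2ConvexDomain Ω) {F : L2Phase Ω} {g : L2Minus Ω}
    {w w' : transportSpace Ω} (h : Solves F g w) (h' : Solves F g w') : w = w' := by
  have := h.add (h'.smul (-1))
  rw [neg_one_smul, neg_one_smul, neg_one_smul, add_neg_cancel, add_neg_cancel] at this
  have := eq_zero_of_solves_zero hΩ this
  rwa [add_neg_eq_zero] at this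

/-- The solution operator of the stationary transport problem. -/
theorem exists_solution_operator {Ω : Set E3} (hΩ : IsC2ConvexDomain Ω) :
    ∃ S : L2Phase Ω × L2Minus Ω →L[ℝ] transportSpace Ω, ∀ F g, Solves F g (S (F, g)) ∧
      ((∀ᵐ z ∂(phaseMeasure Ω), 0 ≤ F z) → (∀ᵐ z ∂(boundaryMeasure Ω (-1)), 0 ≤ g z) →
        ∀ᵐ z ∂(phaseMeasure Ω), 0 ≤ fn (S (F, g)) z) := by
  obtain ⟨C, hC, h⟩ := exists_solves hΩ
  choose w hw using h
  let S₀ : L2Phase Ω × L2Minus Ω →ₗ[ℝ] transportSpace Ω :=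
    { toFun := fun p => w p.1 p.2
      map_add' := fun p q => (hw _ _).1.unique hΩ ((hw p.1 p.2).1.add (hw q.1 q.2).1)
      map_smul' := fun c p => (hw _ _).1.unique hΩ ((hw p.1 p.2).1.smul c) }
  -- Linearity came from uniqueness; the factor `2` compares the sum of the two norms with the
  -- maximum norm of the product.
  refine ⟨S₀.mkContinuous (C * 2) fun p => ?_, fun F g => ⟨(hw F g).1, (hw F g).2.2⟩⟩
  refine (hw p.1 p.2).2.1.trans ?_
  rw [mul_assoc]
  have h1 := norm_fst_le p
  have h2 := norm_snd_le p
  exact mul_le_mul_of_nonneg_left (by linarith) hC.le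

/-! ### Square integrable functions on a product as functions with values in `L²` -/

/-- An open set is a countable union of balls centred in a countable dense set, and the hypothesis
measures the preimages of balls. -/
theorem measurable_of_measurable_edist {α X : Type*} [MeasurableSpace α] [PseudoEMetricSpace X]
    [SecondCountableTopology X] [MeasurableSpace X] [BorelSpace X] {f : α → X}
    (h : ∀ x, Measurable fun a => edist (f a) x) : Measurable f := by
  refine measurable_of_isOpen fun U hU => ?_
  obtain ⟨s, hs, hsd⟩ := TopologicalSpace.exists_countable_dense X
  have he : f ⁻¹' U = ⋃ p ∈ {p : X × ℕ | p.1 ∈ s ∧ Metric.eball p.1 ((p.2 : ℝ≥0∞) + 1)⁻¹ ⊆ U},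
      f ⁻¹' (Metric.eball p.1 ((p.2 : ℝ≥0∞) + 1)⁻¹) := by
    ext a
    simp only [mem_preimage, mem_ofPred_eq, mem_iUnion, exists_prop, Prod.exists]
    constructor
    · intro ha
      obtain ⟨ε, hε, hεU⟩ := EMetric.isOpen_iff.1 hU _ ha
      obtain ⟨n, hn⟩ := ENNReal.exists_inv_nat_lt (ENNReal.half_pos hε.ne').ne'
      have hn' : ((n : ℝ≥0∞) + 1)⁻¹ < ε / 2 := (ENNReal.inv_le_inv.2 le_self_add).trans_lt hn
      have hpos : (0 : ℝ≥0∞) < ((n : ℝ≥0∞) + 1)⁻¹ := ENNReal.inv_pos.2 (by finiteness)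
      obtain ⟨x, hx, hxs⟩ := hsd.inter_open_nonempty _ (Metric.isOpen_eball (x := f a))
        ⟨f a, Metric.mem_eball_self hpos⟩
      refine ⟨x, n, ⟨hxs, fun y hy => hεU ?_⟩, Metric.mem_eball_comm.1 hx⟩
      rw [Metric.mem_eball] at hx hy ⊢
      calc edist y (f a) ≤ edist y x + edist x (f a) := edist_triangle _ _ _
        _ < ε / 2 + ε / 2 := ENNReal.add_lt_add (hy.trans hn') (hx.trans hn')
        _ = ε := ENNReal.add_halves ε
    · rintro ⟨x, n, ⟨-, hU⟩, ha⟩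
      exact hU ha
  rw [he]
  refine MeasurableSet.biUnion (Countable.mono (s₂ := s ×ˢ (univ : Set ℕ))
    (fun p hp => ⟨hp.1, trivial⟩) (hs.prod countable_univ)) fun p _ => ?_
  exact (h p.1) measurableSet_Iio

theorem eLpNorm_two_sq {α E : Type*} [MeasurableSpace α] [NormedAddCommGroup E] {μ : Measure α}
    (f : α → E) : eLpNorm f 2 μ ^ 2 = ∫⁻ a, ‖f a‖ₑ ^ 2 ∂μ := by
  rw [eLpNorm_eq_lintegral_rpow_enorm_toReal (by norm_num) (by norm_num)]
  simp only [ENNReal.toReal_ofNat, ENNReal.rpow_two]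
  rw [← ENNReal.rpow_two, ← ENNReal.rpow_mul]
  norm_num

/-- The only issue is measurability into `L²(ν)`. That space is separable because the σ-algebra is
countably generated, so it suffices that distances to fixed elements are measurable, and these are
integrals over sections. -/
theorem exists_curry_Lp {α β : Type*} [MeasurableSpace α] [MeasurableSpace β]
    [MeasurableSpace.CountablyGenerated β] {μ : Measure α} {ν : Measure β} [SFinite μ] [SFinite ν]
    {F : α × β → ℝ} (hF : MemLp F 2 (μ.prod ν)) :
    ∃ f : Lp (Lp ℝ 2 ν) 2 μ, (∀ᵐ a ∂μ, f a =ᵐ[ν] fun b => F (a, b)) ∧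
      ‖f‖ₑ = eLpNorm F 2 (μ.prod ν) := by
  classical
  borelize ↥(Lp ℝ 2 ν)
  have : Fact ((2 : ℝ≥0∞) ≠ ⊤) := ⟨by norm_num⟩
  set F' := hF.1.mk F with hF'
  have hm : Measurable F' := hF.1.stronglyMeasurable_mk.measurable
  have hFF : ∀ᵐ a ∂μ, ∀ᵐ b ∂ν, F (a, b) = F' (a, b) := Measure.ae_ae_of_ae_prod hF.1.ae_eq_mk
  have hsec : ∀ a, AEStronglyMeasurable (fun b => F' (a, b)) ν := fun a =>
    (hm.comp measurable_prodMk_left).aestronglyMeasurable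
  set A : Set α := {a | ∫⁻ b, ‖F' (a, b)‖ₑ ^ 2 ∂ν < ⊤} with hA
  have hN : Measurable fun a => ∫⁻ b, ‖F' (a, b)‖ₑ ^ 2 ∂ν :=
    (hm.enorm.pow_const 2).lintegral_prod_right'
  have hAm : MeasurableSet A := measurableSet_lt hN measurable_const
  have hmem : ∀ a ∈ A, MemLp (fun b => F' (a, b)) 2 ν := fun a ha => (memLp_two_iff (hsec a)).2 ha
  set f₀ : α → Lp ℝ 2 ν := fun a => if h : a ∈ A then (hmem a h).toLp else 0 with hf₀
  have hf₀A : ∀ a ∈ A, f₀ a =ᵐ[ν] fun b => F' (a, b) := fun a ha => by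
    simp only [hf₀, dif_pos ha]
    exact MemLp.coeFn_toLp _
  have hf₀n : ∀ a ∈ A, ∀ g : Lp ℝ 2 ν, ‖f₀ a - g‖ₑ ^ 2 = ∫⁻ b, ‖F' (a, b) - g b‖ₑ ^ 2 ∂ν := by
    intro a ha g
    rw [enorm_sq_Lp]
    refine lintegral_congr_ae ?_
    filter_upwards [hf₀A a ha, Lp.coeFn_sub (f₀ a) g] with b h1 h2
    rw [h2, Pi.sub_apply, h1]
  have hf₀m : Measurable f₀ := by
    refine measurable_of_measurable_edist fun g => ?_
    have h1 : Measurable fun a => (∫⁻ b, ‖F' (a, b) - g b‖ₑ ^ 2 ∂ν) ^ (1 / 2 : ℝ) := by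
      refine Measurable.pow_const ?_ _
      have h2 : Measurable fun p : α × β => ‖F' p - g p.2‖ₑ ^ 2 :=
        ((hm.sub ((Lp.stronglyMeasurable g).measurable.comp measurable_snd)).enorm).pow_const 2
      exact h2.lintegral_prod_right'
    have h3 : (fun a => edist (f₀ a) g) = A.piecewise
        (fun a => (∫⁻ b, ‖F' (a, b) - g b‖ₑ ^ 2 ∂ν) ^ (1 / 2 : ℝ)) fun _ => edist 0 g := by
      ext1 a
      by_cases ha : a ∈ A
      · rw [piecewise_eq_of_mem _ _ _ ha, ← hf₀n a ha g, ← ENNReal.rpow_two, ← ENNReal.rpow_mul,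
          edist_eq_enorm_sub]
        norm_num
      · rw [piecewise_eq_of_notMem _ _ _ ha]
        simp only [hf₀, dif_neg ha]
    rw [h3]
    exact h1.piecewise hAm measurable_const
  have hsq : ∫⁻ a, ∫⁻ b, ‖F' (a, b)‖ₑ ^ 2 ∂ν ∂μ = eLpNorm F 2 (μ.prod ν) ^ 2 := by
    rw [eLpNorm_congr_ae hF.1.ae_eq_mk, eLpNorm_two_sq,
      lintegral_prod _ (hm.enorm.pow_const 2).aemeasurable]
  have hAae : ∀ᵐ a ∂μ, a ∈ A := by
    refine ae_lt_top hN ?_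
    rw [hsq]
    have := hF.2.ne
    finiteness
  have hnorm : eLpNorm f₀ 2 μ = eLpNorm F 2 (μ.prod ν) := by
    have : eLpNorm f₀ 2 μ ^ 2 = eLpNorm F 2 (μ.prod ν) ^ 2 := by
      rw [eLpNorm_two_sq, ← hsq]
      refine lintegral_congr_ae ?_
      filter_upwards [hAae] with a ha
      rw [enorm_sq_Lp]
      refine lintegral_congr_ae ?_
      filter_upwards [hf₀A a ha] with b hb
      rw [hb]
    exact (ENNReal.pow_right_strictMono two_ne_zero).injective this
  have hLp : MemLp f₀ 2 μ :=
    ⟨hf₀m.aestronglyMeasurable, by rw [hnorm]; exact hF.2⟩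
  refine ⟨hLp.toLp, ?_, ?_⟩
  · filter_upwards [hLp.coeFn_toLp, hAae, hFF] with a h1 h2 h3
    rw [h1]
    filter_upwards [hf₀A a h2, h3] with b h4 h5
    rw [h4, h5]
  · rw [Lp.enorm_def, eLpNorm_congr_ae hLp.coeFn_toLp, hnorm]

/-! ### Averages over parabolic boxes and the potential of order two -/

/-- The parabolic box of radius `R` and scale `l` centred at `p`. -/
def parabolicBox (R l : ℝ) (p : ℝ × E3) : Set (ℝ × E3) :=
  Metric.closedBall p.1 (l ^ 2 * R) ×ˢ Metric.closedBall p.2 (l * R)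

theorem mem_parabolicBox {R l : ℝ} {p z : ℝ × E3} :
    z ∈ parabolicBox R l p ↔ dist z.1 p.1 ≤ l ^ 2 * R ∧ dist z.2 p.2 ≤ l * R := Iff.rfl

theorem mem_parabolicBox_comm {R l : ℝ} {p z : ℝ × E3} :
    z ∈ parabolicBox R l p ↔ p ∈ parabolicBox R l z := by
  rw [mem_parabolicBox, mem_parabolicBox, dist_comm z.1, dist_comm z.2]

/-- The volume of the parabolic box of scale one. -/
def boxVolume (R : ℝ) : ℝ≥0∞ := volume (parabolicBox R 1 0)

theorem boxVolume_ne_top (R : ℝ) : boxVolume R ≠ ⊤ :=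
  ((isCompact_closedBall _ _).prod (isCompact_closedBall _ _)).measure_lt_top.ne

/-- The exponent `5 = 2 + 3` is the parabolic dimension: time scales like `l²`, each space direction
like `l`. -/
theorem volume_parabolicBox {R l : ℝ} (hl : 0 < l) (p : ℝ × E3) :
    volume (parabolicBox R l p) = ENNReal.ofReal l ^ 5 * boxVolume R := by
  have h1 : ∀ (s : ℝ) (q : ℝ × E3), volume (parabolicBox R s q)
      = volume (Metric.closedBall (0 : ℝ) (s ^ 2 * R)) * volume (Metric.closedBall (0 : E3) (s * R)) :=
    fun s q => by
      rw [parabolicBox, Measure.volume_eq_prod, Measure.prod_prod,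
        Measure.addHaar_closedBall_center, Measure.addHaar_closedBall_center volume q.2]
  rw [boxVolume, h1, h1, Measure.addHaar_closedBall_mul_of_pos _ _ (pow_pos hl 2),
    Measure.addHaar_closedBall_mul_of_pos _ _ hl, one_pow, one_mul]
  simp only [Module.finrank_self, finrank_euclideanSpace, Fintype.card_fin, pow_one]
  rw [ENNReal.ofReal_pow hl.le, ENNReal.ofReal_pow hl.le]
  ring

theorem isClosed_setOf_mem_parabolicBox (R : ℝ) :
    IsClosed {q : (ℝ × (ℝ × E3)) × (ℝ × E3) | q.2 ∈ parabolicBox R q.1.1 q.1.2} := by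
  simp only [mem_parabolicBox, ofPred_and]
  exact (isClosed_le (by fun_prop) (by fun_prop)).inter (isClosed_le (by fun_prop) (by fun_prop))

/-- The average of `h` over the parabolic box, up to the constant `boxVolume R`. -/
def boxAvg (μ : Measure (ℝ × E3)) (R : ℝ) (h : ℝ × E3 → ℝ≥0∞) (l : ℝ) (p : ℝ × E3) : ℝ≥0∞ :=
  (ENNReal.ofReal l ^ 5)⁻¹ * ∫⁻ z in parabolicBox R l p, h z ∂μ

theorem measurableSet_parabolicBox (R l : ℝ) (p : ℝ × E3) : MeasurableSet (parabolicBox R l p) :=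
  Metric.isClosed_closedBall.measurableSet.prod Metric.isClosed_closedBall.measurableSet

theorem boxAvg_eq (μ : Measure (ℝ × E3)) (R : ℝ) (h : ℝ × E3 → ℝ≥0∞) (l : ℝ) (p : ℝ × E3) :
    boxAvg μ R h l p = (ENNReal.ofReal l ^ 5)⁻¹ * ∫⁻ z, {q : (ℝ × (ℝ × E3)) × (ℝ × E3) |
      q.2 ∈ parabolicBox R q.1.1 q.1.2}.indicator (fun q => h q.2) ((l, p), z) ∂μ := by
  rw [boxAvg, ← lintegral_indicator (measurableSet_parabolicBox R l p)]
  rfl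

theorem measurable_indicator_parabolicBox (R : ℝ) {h : ℝ × E3 → ℝ≥0∞} (hh : Measurable h) :
    Measurable ({q : (ℝ × (ℝ × E3)) × (ℝ × E3) |
      q.2 ∈ parabolicBox R q.1.1 q.1.2}.indicator fun q => h q.2) :=
  (hh.comp measurable_snd).indicator (isClosed_setOf_mem_parabolicBox R).measurableSet

theorem measurable_boxAvg {μ : Measure (ℝ × E3)} [SFinite μ] (R : ℝ) {h : ℝ × E3 → ℝ≥0∞}
    (hh : Measurable h) : Measurable fun q : ℝ × (ℝ × E3) => boxAvg μ R h q.1 q.2 := by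
  simp only [boxAvg_eq]
  refine Measurable.mul ?_ (measurable_indicator_parabolicBox R hh).lintegral_prod_right'
  exact ((ENNReal.measurable_ofReal.comp measurable_fst).pow_const 5).inv

theorem measurable_boxAvg_right {μ : Measure (ℝ × E3)} [SFinite μ] (R : ℝ) {h : ℝ × E3 → ℝ≥0∞}
    (hh : Measurable h) (l : ℝ) : Measurable (boxAvg μ R h l) := by
  have := (measurable_boxAvg (μ := μ) R hh).comp (measurable_prodMk_left (x := l))
  simpa only [Function.comp_def] using this

/-- Boundedness in `L¹` uniformly in the scale: being in each other's box is symmetric, so after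
Tonelli the inner integral is the volume of a box. -/
theorem lintegral_boxAvg {μ ν : Measure (ℝ × E3)} [SFinite μ] [SFinite ν] (hν : ν ≤ volume) (R : ℝ)
    {h : ℝ × E3 → ℝ≥0∞} (hh : Measurable h) {l : ℝ} (hl : 0 < l) :
    ∫⁻ p, boxAvg μ R h l p ∂ν ≤ boxVolume R * ∫⁻ z, h z ∂μ := by
  simp only [boxAvg_eq]
  have hm := measurable_indicator_parabolicBox R hh
  have hm2 : Measurable (Function.uncurry fun p z => {q : (ℝ × (ℝ × E3)) × (ℝ × E3) |
      q.2 ∈ parabolicBox R q.1.1 q.1.2}.indicator (fun q => h q.2) ((l, p), z)) :=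
    hm.comp (by fun_prop : Measurable fun x : (ℝ × E3) × (ℝ × E3) => ((l, x.1), x.2))
  have hl0 : ENNReal.ofReal l ^ 5 ≠ 0 := by positivity
  have hl1 : ENNReal.ofReal l ^ 5 ≠ ⊤ := by finiteness
  rw [lintegral_const_mul' _ _ (ENNReal.inv_ne_top.2 hl0),
    lintegral_lintegral_swap hm2.aemeasurable]
  have h1 : ∀ z, ∫⁻ p, {q : (ℝ × (ℝ × E3)) × (ℝ × E3) |
      q.2 ∈ parabolicBox R q.1.1 q.1.2}.indicator (fun q => h q.2) ((l, p), z) ∂ν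
      ≤ ENNReal.ofReal l ^ 5 * boxVolume R * h z := fun z => by
    have : ∀ p, {q : (ℝ × (ℝ × E3)) × (ℝ × E3) |
        q.2 ∈ parabolicBox R q.1.1 q.1.2}.indicator (fun q => h q.2) ((l, p), z)
        = (parabolicBox R l z).indicator (fun _ => h z) p := fun p => by
      by_cases hp : z ∈ parabolicBox R l p
      · rw [indicator_of_mem (mem_parabolicBox_comm.1 hp), indicator_of_mem]
        exact hp
      · rw [indicator_of_notMem (fun h => hp (mem_parabolicBox_comm.1 h)), indicator_of_notMem]
        exact hp
    simp only [this]
    rw [lintegral_indicator_const (measurableSet_parabolicBox R l z), mul_comm,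
      ← volume_parabolicBox hl z]
    gcongr
  calc _ ≤ (ENNReal.ofReal l ^ 5)⁻¹ * ∫⁻ z, ENNReal.ofReal l ^ 5 * boxVolume R * h z ∂μ := by
        gcongr with z
        exact h1 z
    _ = _ := by
        rw [lintegral_const_mul' _ _ (ENNReal.mul_ne_top hl1 (boxVolume_ne_top R)), mul_assoc,
          ← mul_assoc, ENNReal.inv_mul_cancel hl0 hl1, one_mul]

theorem boxAvg_sq_le {μ : Measure (ℝ × E3)} (hμ : μ ≤ volume) (R : ℝ) {h : ℝ × E3 → ℝ≥0∞}
    (hh : Measurable h) {l : ℝ} (hl : 0 < l) (p : ℝ × E3) :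
    boxAvg μ R h l p ^ 2 ≤ boxVolume R * boxAvg μ R (fun z => h z ^ 2) l p := by
  have hl0 : ENNReal.ofReal l ^ 5 ≠ 0 := by positivity
  have hl1 : ENNReal.ofReal l ^ 5 ≠ ⊤ := by finiteness
  have h1 : (μ.restrict (parabolicBox R l p)) univ ≤ ENNReal.ofReal l ^ 5 * boxVolume R := by
    rw [Measure.restrict_apply_univ, ← volume_parabolicBox hl p]
    exact hμ _
  rw [boxAvg, boxAvg, mul_pow]
  calc _ ≤ (ENNReal.ofReal l ^ 5)⁻¹ ^ 2 * (ENNReal.ofReal l ^ 5 * boxVolume R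
        * ∫⁻ z in parabolicBox R l p, h z ^ 2 ∂μ) := by
        gcongr
        exact (sq_lintegral_le _ hh.aemeasurable).trans (by gcongr)
    _ = _ := by
        rw [sq, mul_assoc, mul_assoc (ENNReal.ofReal l ^ 5), ← mul_assoc (_)⁻¹ (ENNReal.ofReal l ^ 5),
          ENNReal.inv_mul_cancel hl0 hl1, one_mul]
        ring

theorem boxAvg_le {μ : Measure (ℝ × E3)} (R : ℝ) (h : ℝ × E3 → ℝ≥0∞) (l : ℝ) (p : ℝ × E3) :
    boxAvg μ R h l p ≤ (ENNReal.ofReal l ^ 5)⁻¹ * ∫⁻ z, h z ∂μ :=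
  mul_le_mul_right (setLIntegral_le_lintegral _ _) _

/-- From `L²` to `L⁸`: by Cauchy–Schwarz the eighth power is at most a multiple of the fourth power
of the average of `h²`. Three factors are bounded by the supremum `l⁻⁵ ∫ h²`, the last one is
integrated. -/
theorem lintegral_boxAvg_pow_eight {μ ν : Measure (ℝ × E3)} [SFinite μ] [SFinite ν]
    (hμ : μ ≤ volume) (hν : ν ≤ volume) (R : ℝ)
    {h : ℝ × E3 → ℝ≥0∞} (hh : Measurable h) {l : ℝ} (hl : 0 < l) :
    ∫⁻ p, boxAvg μ R h l p ^ 8 ∂ν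
      ≤ (ENNReal.ofReal l ^ 15)⁻¹ * (boxVolume R ^ 5 * (∫⁻ z, h z ^ 2 ∂μ) ^ 4) := by
  set H := ∫⁻ z, h z ^ 2 ∂μ with hH
  have hb : ∀ p, boxAvg μ R h l p ^ 8 ≤ (boxVolume R ^ 4 * ((ENNReal.ofReal l ^ 5)⁻¹ * H) ^ 3)
      * boxAvg μ R (fun z => h z ^ 2) l p := fun p => by
    have h2 := boxAvg_sq_le hμ R hh hl p
    have h3 := boxAvg_le (μ := μ) R (fun z => h z ^ 2) l p
    calc boxAvg μ R h l p ^ 8 = (boxAvg μ R h l p ^ 2) ^ 4 := by rw [← pow_mul]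
      _ ≤ (boxVolume R * boxAvg μ R (fun z => h z ^ 2) l p) ^ 4 := by gcongr
      _ = boxVolume R ^ 4 * boxAvg μ R (fun z => h z ^ 2) l p ^ 3
          * boxAvg μ R (fun z => h z ^ 2) l p := by ring
      _ ≤ _ := by gcongr
  calc _ ≤ ∫⁻ p, (boxVolume R ^ 4 * ((ENNReal.ofReal l ^ 5)⁻¹ * H) ^ 3)
      * boxAvg μ R (fun z => h z ^ 2) l p ∂ν := lintegral_mono hb
    _ = (boxVolume R ^ 4 * ((ENNReal.ofReal l ^ 5)⁻¹ * H) ^ 3)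
      * ∫⁻ p, boxAvg μ R (fun z => h z ^ 2) l p ∂ν := by
        exact lintegral_const_mul _ (measurable_boxAvg_right R (hh.pow_const 2) l)
    _ ≤ (boxVolume R ^ 4 * ((ENNReal.ofReal l ^ 5)⁻¹ * H) ^ 3) * (boxVolume R * H) := by
        gcongr
        exact lintegral_boxAvg hν R (hh.pow_const 2) hl
    _ = (((ENNReal.ofReal l) ^ 5)⁻¹) ^ 3 * (boxVolume R ^ 5 * H ^ 4) := by ring
    _ = _ := by rw [ENNReal.inv_pow, ← pow_mul, ← ENNReal.inv_pow]

/-- Jensen's inequality as three applications of Cauchy–Schwarz, since `8 = 2³`. -/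
theorem lintegral_pow_eight_le {α : Type*} [MeasurableSpace α] (μ : Measure α)
    [IsProbabilityMeasure μ] {f : α → ℝ≥0∞} (hf : AEMeasurable f μ) :
    (∫⁻ a, f a ∂μ) ^ 8 ≤ ∫⁻ a, f a ^ 8 ∂μ := by
  have h : ∀ g : α → ℝ≥0∞, AEMeasurable g μ → (∫⁻ a, g a ∂μ) ^ 2 ≤ ∫⁻ a, g a ^ 2 ∂μ :=
    fun g hg => (sq_lintegral_le μ hg).trans_eq (by rw [measure_univ, one_mul])
  calc (∫⁻ a, f a ∂μ) ^ 8 = (((∫⁻ a, f a ∂μ) ^ 2) ^ 2) ^ 2 := by rw [← pow_mul, ← pow_mul]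
    _ ≤ ((∫⁻ a, f a ^ 2 ∂μ) ^ 2) ^ 2 := by gcongr; exact h f hf
    _ ≤ (∫⁻ a, (f a ^ 2) ^ 2 ∂μ) ^ 2 := by gcongr; exact h _ (hf.pow_const 2)
    _ ≤ ∫⁻ a, ((f a ^ 2) ^ 2) ^ 2 ∂μ := h _ ((hf.pow_const 2).pow_const 2)
    _ = _ := by simp only [← pow_mul]

/-- A potential of parabolic order two, in the variable `r` with scale `r ^ 8`. -/
def boxPotential (μ : Measure (ℝ × E3)) (R : ℝ) (h : ℝ × E3 → ℝ≥0∞) (p : ℝ × E3) : ℝ≥0∞ :=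
  ∫⁻ r in Ioo (0 : ℝ) 1, ENNReal.ofReal r ^ 15 * boxAvg μ R h (r ^ 8) p

theorem measurable_boxPotential_integrand {μ : Measure (ℝ × E3)} [SFinite μ] (R : ℝ)
    {h : ℝ × E3 → ℝ≥0∞} (hh : Measurable h) :
    Measurable fun q : (ℝ × E3) × ℝ => ENNReal.ofReal q.2 ^ 15 * boxAvg μ R h (q.2 ^ 8) q.1 := by
  have h1 : Measurable fun q : (ℝ × E3) × ℝ => ENNReal.ofReal q.2 ^ 15 := by fun_prop
  have h2 : Measurable fun q : (ℝ × E3) × ℝ => (q.2 ^ 8, q.1) := by fun_prop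
  have h3 := (measurable_boxAvg (μ := μ) R hh).comp h2
  simp only [Function.comp_def] at h3
  exact h1.mul h3

theorem measurable_boxPotential {μ : Measure (ℝ × E3)} [SFinite μ] (R : ℝ)
    {h : ℝ × E3 → ℝ≥0∞} (hh : Measurable h) : Measurable (boxPotential μ R h) :=
  (measurable_boxPotential_integrand R hh).lintegral_prod_right'

/-- In the scale `l = r⁸` the potential is, up to a constant, the integral of the averages against
`l dl`. Their `L⁸` norms grow like `l^(-15/8)`, and `l^(-7/8) dl` is `8 dr`: in the variable `r` the
integrand is uniformly bounded in `L⁸`, as `r¹²⁰` cancels `(r⁸)⁻¹⁵`, and Jensen on `(0, 1)`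
finishes. -/
theorem lintegral_boxPotential_pow_eight {μ ν : Measure (ℝ × E3)} [SFinite μ] [SFinite ν]
    (hμ : μ ≤ volume) (hν : ν ≤ volume) (R : ℝ) {h : ℝ × E3 → ℝ≥0∞} (hh : Measurable h) :
    ∫⁻ p, boxPotential μ R h p ^ 8 ∂ν ≤ boxVolume R ^ 5 * (∫⁻ z, h z ^ 2 ∂μ) ^ 4 := by
  have : IsProbabilityMeasure (volume.restrict (Ioo (0 : ℝ) 1)) := ⟨by simp⟩
  have hm := measurable_boxPotential_integrand (μ := μ) R hh
  calc _ ≤ ∫⁻ p, (∫⁻ r in Ioo (0 : ℝ) 1,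
        (ENNReal.ofReal r ^ 15 * boxAvg μ R h (r ^ 8) p) ^ 8) ∂ν := by
        refine lintegral_mono fun p => lintegral_pow_eight_le _ ?_
        have h4 := hm.comp (measurable_prodMk_left (x := p))
        simp only [Function.comp_def] at h4
        exact h4.aemeasurable
    _ = ∫⁻ r in Ioo (0 : ℝ) 1, (∫⁻ p,
        (ENNReal.ofReal r ^ 15 * boxAvg μ R h (r ^ 8) p) ^ 8 ∂ν) :=
        lintegral_lintegral_swap (hm.pow_const 8).aemeasurable
    _ ≤ ∫⁻ r in Ioo (0 : ℝ) 1, boxVolume R ^ 5 * (∫⁻ z, h z ^ 2 ∂μ) ^ 4 := by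
        refine setLIntegral_mono' measurableSet_Ioo fun r hr => ?_
        have hr0 := hr.1
        have h1 : ENNReal.ofReal r ^ 120 ≠ 0 := by positivity
        have h2 : ENNReal.ofReal r ^ 120 ≠ ⊤ := by finiteness
        simp only [mul_pow, ← pow_mul]
        rw [lintegral_const_mul' _ _ h2]
        have h3 := lintegral_boxAvg_pow_eight (μ := μ) (ν := ν) hμ hν R hh (pow_pos hr0 8)
        rw [ENNReal.ofReal_pow hr0.le, ← pow_mul] at h3
        calc _ ≤ ENNReal.ofReal r ^ 120 * ((ENNReal.ofReal r ^ 120)⁻¹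
              * (boxVolume R ^ 5 * (∫⁻ z, h z ^ 2 ∂μ) ^ 4)) := by gcongr
          _ = _ := by rw [← mul_assoc, ENNReal.mul_inv_cancel h1 h2, one_mul]
    _ = _ := by rw [lintegral_const, measure_univ, mul_one]

/-! ### Parabolic dilations of test functions and their pairings -/

/-- The parabolic dilation with centre `p` and factor `k`. -/
def dilate (p : ℝ × E3) (k : ℝ) (z : ℝ × E3) : ℝ × E3 :=
  (p.1 + k ^ 2 * (z.1 - p.1), p.2 + k • (z.2 - p.2))

theorem dilate_inv_dilate (p : ℝ × E3) {k : ℝ} (hk : k ≠ 0) (z : ℝ × E3) :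
    dilate p k⁻¹ (dilate p k z) = z := by
  ext1
  · simp only [dilate]
    field_simp
    ring
  · simp only [dilate, add_sub_cancel_left, smul_smul, inv_mul_cancel₀ hk, one_smul]
    abel

theorem continuous_dilate (p : ℝ × E3) (k : ℝ) : Continuous (dilate p k) := by
  unfold dilate
  fun_prop

/-- The parabolic dilation as a homeomorphism. -/
def dilateHomeomorph (p : ℝ × E3) {k : ℝ} (hk : k ≠ 0) : (ℝ × E3) ≃ₜ (ℝ × E3) where
  toFun := dilate p k
  invFun := dilate p k⁻¹
  left_inv := dilate_inv_dilate p hk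
  right_inv z := by
    have := dilate_inv_dilate p (inv_ne_zero hk) z
    rwa [inv_inv] at this
  continuous_toFun := continuous_dilate p k
  continuous_invFun := continuous_dilate p k⁻¹

theorem hasFDerivAt_dilate (p : ℝ × E3) (k : ℝ) (z : ℝ × E3) :
    HasFDerivAt (dilate p k) ((k ^ 2 • ContinuousLinearMap.fst ℝ ℝ E3).prod
      (k • ContinuousLinearMap.snd ℝ ℝ E3)) z := by
  refine HasFDerivAt.prodMk ?_ ?_
  · have := (((hasFDerivAt_fst (𝕜 := ℝ) (p := z)).sub_const p.1).const_mul (k ^ 2)).const_add p.1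
    exact this
  · have := (((hasFDerivAt_snd (𝕜 := ℝ) (p := z)).sub_const p.2).const_smul k).const_add p.2
    exact this

theorem contDiff_dilate (p : ℝ × E3) (k : ℝ) : ContDiff ℝ ∞ (dilate p k) := by
  unfold dilate
  fun_prop

/-- Convexity enters here: contracting towards a point of the cylinder stays inside. Dilated test
functions remain admissible at every scale `k ≥ 1` and every centre `p`. -/
theorem dilate_mem_cylinder {Ω : Set E3} (hΩ : Convex ℝ Ω) {τ : ℝ} {p z : ℝ × E3} {k : ℝ}
    (hp : p ∈ cylinder Ω τ) (hk : 1 ≤ k) (hz : dilate p k z ∈ cylinder Ω τ) :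
    z ∈ cylinder Ω τ := by
  have hk0 : 0 < k := by linarith
  rw [← dilate_inv_dilate p hk0.ne' z]
  set q := dilate p k z
  have h1 : 0 ≤ k⁻¹ := by positivity
  have h2 : k⁻¹ ≤ 1 := inv_le_one_of_one_le₀ hk
  refine ⟨?_, ?_⟩
  · have := (convex_Ioo (0 : ℝ) τ).add_smul_sub_mem hp.1 hz.1
      (t := k⁻¹ ^ 2) ⟨by positivity, pow_le_one₀ h1 h2⟩
    exact this
  · exact hΩ.add_smul_sub_mem hp.2 hz.2 ⟨h1, h2⟩

/-- Smooth functions with compact support in `U`. -/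
structure IsTestFun (U : Set (ℝ × E3)) (χ : ℝ × E3 → ℝ) : Prop where
  contDiff : ContDiff ℝ ∞ χ
  hasCompactSupport : HasCompactSupport χ
  tsupport_subset : tsupport χ ⊆ U

namespace IsTestFun

variable {U : Set (ℝ × E3)} {χ ψ : ℝ × E3 → ℝ}

theorem continuous (h : IsTestFun U χ) : Continuous χ := h.contDiff.continuous

theorem exists_bound (h : IsTestFun U χ) : ∃ C, ∀ q, ‖χ q‖ ≤ C :=
  h.continuous.bounded_above_of_compact_support h.hasCompactSupport

theorem eq_zero (h : IsTestFun U χ) {q : ℝ × E3} (hq : q ∉ U) : χ q = 0 :=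
  image_eq_zero_of_notMem_tsupport fun h' => hq (h.tsupport_subset h')

theorem mul_left (h : IsTestFun U χ) {f : ℝ × E3 → ℝ} (hf : ContDiff ℝ ∞ f) :
    IsTestFun U (fun q => f q * χ q) :=
  ⟨hf.mul h.contDiff, h.hasCompactSupport.mul_left,
    (tsupport_mul_subset_right (f := f)).trans h.tsupport_subset⟩

theorem add (h : IsTestFun U χ) (h' : IsTestFun U ψ) : IsTestFun U (fun q => χ q + ψ q) :=
  ⟨h.contDiff.add h'.contDiff, h.hasCompactSupport.add h'.hasCompactSupport,
    (tsupport_add χ ψ).trans (union_subset h.tsupport_subset h'.tsupport_subset)⟩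

theorem sum {ι : Type*} (s : Finset ι) {χ : ι → ℝ × E3 → ℝ} (h : ∀ i ∈ s, IsTestFun U (χ i)) :
    IsTestFun U (fun q => ∑ i ∈ s, χ i q) := by
  classical
  induction s using Finset.induction_on with
  | empty =>
    simp only [Finset.sum_empty]
    exact ⟨contDiff_const, HasCompactSupport.zero, by simp [tsupport, Function.support]⟩
  | insert a s ha ih =>
    simp only [Finset.sum_insert ha]
    exact (h a (Finset.mem_insert_self a s)).add
      (ih fun i hi => h i (Finset.mem_insert_of_mem hi))

theorem fderiv_apply (h : IsTestFun U χ) (e : ℝ × E3) :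
    IsTestFun U (fun q => fderiv ℝ χ q e) :=
  ⟨(h.contDiff.fderiv_right (m := ∞) le_rfl).clm_apply contDiff_const,
    h.hasCompactSupport.fderiv_apply (𝕜 := ℝ) e,
    (tsupport_fderiv_apply_subset ℝ e).trans h.tsupport_subset⟩

theorem comp_dilate {Ω : Set E3} (hΩ : Convex ℝ Ω) {τ : ℝ} (h : IsTestFun (cylinder Ω τ) χ)
    {p : ℝ × E3} (hp : p ∈ cylinder Ω τ) {k : ℝ} (hk : 1 ≤ k) :
    IsTestFun (cylinder Ω τ) (fun z => k ^ 5 * χ (dilate p k z)) := by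
  have hk0 : k ≠ 0 := by positivity
  refine IsTestFun.mul_left ⟨h.contDiff.comp (contDiff_dilate p k),
    h.hasCompactSupport.comp_homeomorph (dilateHomeomorph p hk0), fun z hz => ?_⟩ contDiff_const
  exact dilate_mem_cylinder hΩ hp hk
    (h.tsupport_subset (tsupport_comp_subset_preimage χ (continuous_dilate p k) hz))

end IsTestFun

/-- The pairing of `v` with a dilated test function. -/
def dilPair (U : Set (ℝ × E3)) (p : ℝ × E3) (v χ : ℝ × E3 → ℝ) (k : ℝ) : ℝ :=
  ∫ z in U, k ^ 5 * χ (dilate p k z) * v z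

theorem integrableOn_dilPair {U : Set (ℝ × E3)} {v χ : ℝ × E3 → ℝ} (hv : IntegrableOn v U)
    (hχ : IsTestFun U χ) (p : ℝ × E3) (k : ℝ) :
    IntegrableOn (fun z => k ^ 5 * χ (dilate p k z) * v z) U := by
  obtain ⟨C, hC⟩ := hχ.exists_bound
  refine Integrable.bdd_mul (c := |k ^ 5| * C) hv ?_ (.of_forall fun z => ?_)
  · exact ((hχ.continuous.comp (continuous_dilate p k)).const_smul (k ^ 5)).aestronglyMeasurable
  · rw [norm_mul, Real.norm_eq_abs]
    gcongr
    exact hC _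

theorem dilPair_add {U : Set (ℝ × E3)} {v χ ψ : ℝ × E3 → ℝ} (hv : IntegrableOn v U)
    (hχ : IsTestFun U χ) (hψ : IsTestFun U ψ) (p : ℝ × E3) (k : ℝ) :
    dilPair U p v (fun q => χ q + ψ q) k = dilPair U p v χ k + dilPair U p v ψ k := by
  rw [dilPair, dilPair, dilPair, ← integral_add (integrableOn_dilPair hv hχ p k)
    (integrableOn_dilPair hv hψ p k)]
  congr with z
  ring

theorem dilPair_const_mul (U : Set (ℝ × E3)) (v χ : ℝ × E3 → ℝ) (p : ℝ × E3) (c k : ℝ) :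
    dilPair U p v (fun q => c * χ q) k = c * dilPair U p v χ k := by
  rw [dilPair, dilPair, ← integral_const_mul]
  congr with z
  ring

theorem dilPair_sum {ι : Type*} (s : Finset ι) {U : Set (ℝ × E3)} {v : ℝ × E3 → ℝ}
    {χ : ι → ℝ × E3 → ℝ} (hv : IntegrableOn v U) (hχ : ∀ i ∈ s, IsTestFun U (χ i)) (p : ℝ × E3)
    (k : ℝ) :
    dilPair U p v (fun q => ∑ i ∈ s, χ i q) k = ∑ i ∈ s, dilPair U p v (χ i) k := by
  simp only [dilPair]
  rw [← integral_finsetSum s fun i hi => integrableOn_dilPair hv (hχ i hi) p k]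
  congr with z
  rw [Finset.mul_sum, Finset.sum_mul]

theorem fderiv_comp_dilate {χ : ℝ × E3 → ℝ} (hχ : Differentiable ℝ χ) (p z e : ℝ × E3) (k : ℝ) :
    fderiv ℝ (fun z => k ^ 5 * χ (dilate p k z)) z e
      = k ^ 5 * fderiv ℝ χ (dilate p k z) (k ^ 2 * e.1, k • e.2) := by
  have h := ((hχ (dilate p k z)).hasFDerivAt.comp z (hasFDerivAt_dilate p k z)).const_mul (k ^ 5)
  have h' : fderiv ℝ (fun z => k ^ 5 * χ (dilate p k z)) z = _ := h.fderiv
  rw [h']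
  rfl

/-- The direction `e` is an eigenvector of the dilation with eigenvalue `c`, which is `k` in space
and `k²` in time; each integration by parts thus gains a power of the scale. -/
theorem dilPair_weakDeriv {Ω : Set E3} (hΩ : Convex ℝ Ω) {τ : ℝ} {v g χ : ℝ × E3 → ℝ}
    {e : ℝ × E3} (hg : IsL2WeakDeriv (cylinder Ω τ) e v g) (hχ : IsTestFun (cylinder Ω τ) χ)
    {p : ℝ × E3} (hp : p ∈ cylinder Ω τ) {k c : ℝ} (hk : 1 ≤ k)
    (hc : ((k ^ 2 * e.1, k • e.2) : ℝ × E3) = c • e) :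
    c * dilPair (cylinder Ω τ) p v (fun q => fderiv ℝ χ q e) k
      = -dilPair (cylinder Ω τ) p g χ k := by
  obtain ⟨h1, h2, h3⟩ := hχ.comp_dilate hΩ hp hk
  have h4 := hg.2 _ h1 h2 h3
  simp only [fderiv_comp_dilate (hχ.contDiff.differentiable (by simp)), hc, map_smul,
    smul_eq_mul] at h4
  rw [dilPair, dilPair, ← integral_const_mul]
  calc _ = _ := by
        congr with z
        ring
    _ = _ := h4
    _ = _ := by
        congr with z
        ring

theorem dilPair_dirX {Ω : Set E3} (hΩ : Convex ℝ Ω) {τ : ℝ} {v g χ : ℝ × E3 → ℝ}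
    {i : Fin 3} (hg : IsL2WeakDeriv (cylinder Ω τ) (dirX i) v g) (hχ : IsTestFun (cylinder Ω τ) χ)
    {p : ℝ × E3} (hp : p ∈ cylinder Ω τ) {k : ℝ} (hk : 1 ≤ k) :
    dilPair (cylinder Ω τ) p v (fun q => fderiv ℝ χ q (dirX i)) k
      = -(k⁻¹ * dilPair (cylinder Ω τ) p g χ k) := by
  have h := dilPair_weakDeriv hΩ hg hχ hp hk (c := k) (by ext1 <;> simp [dirX])
  have hk0 : k ≠ 0 := by positivity
  rw [← mul_neg, ← h, inv_mul_cancel_left₀ hk0]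

theorem dilPair_dirT {Ω : Set E3} (hΩ : Convex ℝ Ω) {τ : ℝ} {v g χ : ℝ × E3 → ℝ}
    (hg : IsL2WeakDeriv (cylinder Ω τ) dirT v g) (hχ : IsTestFun (cylinder Ω τ) χ)
    {p : ℝ × E3} (hp : p ∈ cylinder Ω τ) {k : ℝ} (hk : 1 ≤ k) :
    dilPair (cylinder Ω τ) p v (fun q => fderiv ℝ χ q dirT) k
      = -((k ^ 2)⁻¹ * dilPair (cylinder Ω τ) p g χ k) := by
  have h := dilPair_weakDeriv hΩ hg hχ hp hk (c := k ^ 2) (by ext1 <;> simp [dirT])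
  have hk0 : k ^ 2 ≠ 0 := by positivity
  rw [← mul_neg, ← h, inv_mul_cancel_left₀ hk0]

/-- The operator which turns a test function into the derivative of its dilations with respect to
the dilation factor. -/
def eulerD (p : ℝ × E3) (χ : ℝ × E3 → ℝ) (q : ℝ × E3) : ℝ :=
  5 * χ q + fderiv ℝ χ q (2 * (q.1 - p.1), q.2 - p.2)

theorem IsTestFun.eulerD {U : Set (ℝ × E3)} {χ : ℝ × E3 → ℝ} (h : IsTestFun U χ) (p : ℝ × E3) :
    IsTestFun U (eulerD p χ) := by
  refine (h.mul_left contDiff_const).add ⟨?_, ?_, ?_⟩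
  · exact (h.contDiff.fderiv_right (m := ∞) le_rfl).clm_apply (by fun_prop)
  · refine (h.hasCompactSupport.fderiv ℝ).mono fun q hq hq' => hq ?_
    simp only [hq', zero_apply]
  · have hsub : Function.support (fun q => fderiv ℝ χ q (2 * (q.1 - p.1), q.2 - p.2))
        ⊆ Function.support (fderiv ℝ χ) := fun q hq hq' => hq (by simp only [hq', zero_apply])
    exact (closure_mono hsub).trans ((tsupport_fderiv_subset ℝ (f := χ)).trans h.tsupport_subset)

theorem hasDerivAt_dilate {χ : ℝ × E3 → ℝ} (hχ : Differentiable ℝ χ) (p z : ℝ × E3) (k : ℝ) :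
    HasDerivAt (fun k => k ^ 5 * χ (dilate p k z)) (k ^ 4 * eulerD p χ (dilate p k z)) k := by
  have h1 : HasDerivAt (fun k => dilate p k z) (2 * k * (z.1 - p.1), z.2 - p.2) k := by
    refine HasDerivAt.prodMk ?_ ?_
    · have := (((hasDerivAt_id k).pow 2).mul_const (z.1 - p.1)).const_add p.1
      simpa using this
    · have := ((hasDerivAt_id k).smul_const (z.2 - p.2)).const_add p.2
      simpa using this
  have h2 := (hasDerivAt_pow 5 k).mul
    ((hχ (dilate p k z)).hasFDerivAt.comp_hasDerivAt k h1)
  refine h2.congr_deriv ?_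
  have h3 : ((2 * ((dilate p k z).1 - p.1), (dilate p k z).2 - p.2) : ℝ × E3)
      = k • ((2 * k * (z.1 - p.1), z.2 - p.2) : ℝ × E3) := by
    ext1
    · simp [dilate]; ring
    · simp [dilate]
  rw [eulerD, h3, map_smul, smul_eq_mul]
  simp only [Function.comp_apply]
  push_cast
  ring

theorem hasDerivAt_dilPair {U : Set (ℝ × E3)} {v χ : ℝ × E3 → ℝ} (hv : IntegrableOn v U)
    (hχ : IsTestFun U χ) (p : ℝ × E3) {k : ℝ} (hk : 0 < k) :
    HasDerivAt (dilPair U p v χ) (k⁻¹ * dilPair U p v (eulerD p χ) k) k := by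
  obtain ⟨C, hC⟩ := (hχ.eulerD p).exists_bound
  have h := hasDerivAt_integral_of_dominated_loc_of_deriv_le (μ := volume.restrict U)
    (F := fun k z => k ^ 5 * χ (dilate p k z) * v z)
    (F' := fun k z => k ^ 4 * eulerD p χ (dilate p k z) * v z) (x₀ := k)
    (s := Ioo 0 (k + 1)) (bound := fun z => (k + 1) ^ 4 * C * ‖v z‖)
    (Ioo_mem_nhds hk (by linarith))
    (.of_forall fun x => (integrableOn_dilPair hv hχ p x).1)
    (integrableOn_dilPair hv hχ p k)
    ?_ (.of_forall fun z x hx => ?_) (hv.norm.const_mul _) (.of_forall fun z x hx => ?_)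
  · refine h.2.congr_deriv ?_
    rw [dilPair, ← integral_const_mul]
    congr with z
    field_simp
  · exact (((hχ.eulerD p).continuous.comp
      (continuous_dilate p k)).const_smul (k ^ 4)).aestronglyMeasurable.mul hv.1
  · rw [norm_mul, norm_mul, norm_pow, Real.norm_eq_abs, abs_of_pos hx.1]
    have := hx.1
    have := hx.2
    gcongr
    exact hC _
  · exact (hasDerivAt_dilate (hχ.contDiff.differentiable (by simp)) p z x).mul_const (v z)

theorem continuousOn_dilPair {U : Set (ℝ × E3)} {v χ : ℝ × E3 → ℝ} (hv : IntegrableOn v U)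
    (hχ : IsTestFun U χ) (p : ℝ × E3) : ContinuousOn (dilPair U p v χ) (Ioi 0) := fun _ hk =>
  (hasDerivAt_dilPair hv hχ p hk).continuousAt.continuousWithinAt

/-- Pairings with dilated test functions are dominated by averages over parabolic boxes. -/
theorem enorm_dilPair_le {U : Set (ℝ × E3)} {R : ℝ}
    (hR : ∀ q ∈ U, ∀ q' ∈ U, dist q q' ≤ R)
    {v χ : ℝ × E3 → ℝ} (hχ : IsTestFun U χ) {C : ℝ} (hC : ∀ q ∈ U, ‖χ q‖ ≤ C)
    {p : ℝ × E3} (hp : p ∈ U) {l : ℝ} (hl : 0 < l) {h : ℝ × E3 → ℝ≥0∞}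
    (hvh : ∀ᵐ z ∂(volume.restrict U), ‖v z‖ₑ ≤ h z) :
    ‖dilPair U p v χ l⁻¹‖ₑ ≤ ENNReal.ofReal C * boxAvg (volume.restrict U) R h l p := by
  rw [dilPair, boxAvg, ← lintegral_indicator (measurableSet_parabolicBox R l p), ← mul_assoc,
    ← lintegral_const_mul' _ _ (by finiteness)]
  refine (enorm_integral_le_lintegral_enorm _).trans (lintegral_mono_ae ?_)
  filter_upwards [hvh] with z hz
  by_cases hzU : dilate p l⁻¹ z ∈ U
  · have hzb : z ∈ parabolicBox R l p := by
      have h1 := hR _ hzU _ hp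
      rw [Prod.dist_eq, max_le_iff] at h1
      obtain ⟨h2, h3⟩ := h1
      rw [mem_parabolicBox]
      rw [dilate, dist_eq_norm, add_sub_cancel_left, norm_mul, norm_pow, norm_inv,
        Real.norm_of_nonneg hl.le] at h2
      rw [dilate, dist_eq_norm, add_sub_cancel_left, norm_smul, norm_inv,
        Real.norm_of_nonneg hl.le] at h3
      rw [dist_eq_norm, dist_eq_norm]
      rw [inv_pow, inv_mul_le_iff₀ (by positivity)] at h2
      rw [inv_mul_le_iff₀ hl] at h3
      exact ⟨h2, h3⟩
    rw [indicator_of_mem hzb, enorm_mul, enorm_mul, enorm_pow, mul_comm (ENNReal.ofReal C)]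
    gcongr
    · rw [Real.enorm_of_nonneg (by positivity), ENNReal.ofReal_inv_of_pos hl, ENNReal.inv_pow]
    · rw [← ofReal_norm]
      exact ENNReal.ofReal_le_ofReal (hC _ hzU)
  · rw [hχ.eq_zero hzU, mul_zero, zero_mul, enorm_zero]
    exact zero_le

/-! ### Taylor means and their derivative in the scale -/

/-- `Tt`, `Td` and `Tdd` are the weak derivatives of `T` on the cylinder which occur in the norm of
`W^{2,1}_2`. -/
structure ParabolicJet (Ω : Set E3) (τ : ℝ) (T Tt : ℝ × E3 → ℝ) (Td : Fin 3 → ℝ × E3 → ℝ)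
    (Tdd : Fin 3 → Fin 3 → ℝ × E3 → ℝ) : Prop where
  memLp : MemLp T 2 (volume.restrict (cylinder Ω τ))
  time : IsL2WeakDeriv (cylinder Ω τ) dirT T Tt
  space : ∀ i, IsL2WeakDeriv (cylinder Ω τ) (dirX i) T (Td i)
  space_space : ∀ i j, IsL2WeakDeriv (cylinder Ω τ) (dirX j) (Td i) (Tdd i j)

theorem volume_cylinder_lt_top {Ω : Set E3} (hb : Bornology.IsBounded Ω) (τ : ℝ) :
    volume (cylinder Ω τ) < ⊤ := by
  rw [cylinder, Measure.volume_eq_prod, Measure.prod_prod]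
  exact ENNReal.mul_lt_top measure_Ioo_lt_top hb.measure_lt_top

theorem integrableOn_cylinder {Ω : Set E3} (hb : Bornology.IsBounded Ω) {τ : ℝ} {v : ℝ × E3 → ℝ}
    (hv : MemLp v 2 (volume.restrict (cylinder Ω τ))) : IntegrableOn v (cylinder Ω τ) := by
  have : IsFiniteMeasure (volume.restrict (cylinder Ω τ)) :=
    ⟨by rw [Measure.restrict_apply_univ]; exact volume_cylinder_lt_top hb τ⟩
  exact hv.integrable (by norm_num)

theorem fderiv_time_mul {χ : ℝ × E3 → ℝ} (hχ : Differentiable ℝ χ) (p q e : ℝ × E3) :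
    fderiv ℝ (fun q => (q.1 - p.1) * χ q) q e = (q.1 - p.1) * fderiv ℝ χ q e + χ q * e.1 := by
  have h := ((hasFDerivAt_fst (𝕜 := ℝ) (p := q)).sub_const p.1).mul (hχ q).hasFDerivAt
  have h' : fderiv ℝ (fun q => (q.1 - p.1) * χ q) q = _ := h.fderiv
  rw [h']
  simp

theorem fderiv_space_mul {χ : ℝ × E3 → ℝ} (hχ : Differentiable ℝ χ) (p q e : ℝ × E3)
    (j : Fin 3) :
    fderiv ℝ (fun q => (q.2 j - p.2 j) * χ q) q e
      = (q.2 j - p.2 j) * fderiv ℝ χ q e + χ q * e.2 j := by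
  have h0 : HasFDerivAt (fun q : ℝ × E3 => q.2 j)
      ((EuclideanSpace.proj (𝕜 := ℝ) j).comp (ContinuousLinearMap.snd ℝ ℝ E3)) q :=
    ((EuclideanSpace.proj (𝕜 := ℝ) j).comp (ContinuousLinearMap.snd ℝ ℝ E3)).hasFDerivAt
  have h := (h0.sub_const (p.2 j)).mul (hχ q).hasFDerivAt
  have h' : fderiv ℝ (fun q => (q.2 j - p.2 j) * χ q) q = _ := h.fderiv
  rw [h']
  simp

/-- The derivative of the normalized dilations is a pure divergence, because the factor `5 = 2 + 3`
is the divergence of the dilation field. So it can be moved onto weak derivatives. -/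
theorem eulerD_eq {χ : ℝ × E3 → ℝ} (hχ : Differentiable ℝ χ) (p q : ℝ × E3) :
    eulerD p χ q = 2 * fderiv ℝ (fun q => (q.1 - p.1) * χ q) q dirT
      + ∑ j, fderiv ℝ (fun q => (q.2 j - p.2 j) * χ q) q (dirX j) := by
  have h : ((2 * (q.1 - p.1), q.2 - p.2) : ℝ × E3)
      = (2 * (q.1 - p.1)) • dirT + ∑ j, (q.2 j - p.2 j) • dirX j := by
    ext1
    · simp [dirT, dirX, Prod.fst_sum]
    · ext i
      simp [dirT, dirX, Prod.snd_sum, Pi.single_apply]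
  rw [eulerD, h, map_add, map_sum]
  simp only [map_smul, smul_eq_mul, fderiv_time_mul hχ, fderiv_space_mul hχ]
  simp [dirT, dirX, Finset.sum_add_distrib]
  ring

theorem IsTestFun.time_mul {U : Set (ℝ × E3)} {χ : ℝ × E3 → ℝ} (h : IsTestFun U χ) (p : ℝ × E3) :
    IsTestFun U (fun q => (q.1 - p.1) * χ q) :=
  h.mul_left (by fun_prop)

theorem IsTestFun.space_mul {U : Set (ℝ × E3)} {χ : ℝ × E3 → ℝ} (h : IsTestFun U χ) (p : ℝ × E3)
    (j : Fin 3) : IsTestFun U (fun q => (q.2 j - p.2 j) * χ q) :=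
  h.mul_left (by fun_prop)

theorem dilPair_eulerD {U : Set (ℝ × E3)} {v χ : ℝ × E3 → ℝ} (hv : IntegrableOn v U)
    (hχ : IsTestFun U χ) (p : ℝ × E3) (k : ℝ) :
    dilPair U p v (eulerD p χ) k
      = 2 * dilPair U p v (fun q => fderiv ℝ (fun q => (q.1 - p.1) * χ q) q dirT) k
        + ∑ j, dilPair U p v
            (fun q => fderiv ℝ (fun q => (q.2 j - p.2 j) * χ q) q (dirX j)) k := by
  have h : eulerD p χ = fun q => 2 * fderiv ℝ (fun q => (q.1 - p.1) * χ q) q dirT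
      + ∑ j, fderiv ℝ (fun q => (q.2 j - p.2 j) * χ q) q (dirX j) :=
    funext fun q => eulerD_eq (hχ.contDiff.differentiable (by simp)) p q
  rw [h, dilPair_add hv (((hχ.time_mul p).fderiv_apply dirT).mul_left contDiff_const)
    (IsTestFun.sum _ fun j _ => (hχ.space_mul p j).fderiv_apply (dirX j)), dilPair_const_mul,
    dilPair_sum _ hv fun j _ => (hχ.space_mul p j).fderiv_apply (dirX j)]

theorem fderiv_fderiv_comm {ψ : ℝ × E3 → ℝ} (hψ : ContDiff ℝ ∞ ψ) (e e' : ℝ × E3) :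
    (fun q => fderiv ℝ (fun q => fderiv ℝ ψ q e) q e')
      = fun q => fderiv ℝ (fun q => fderiv ℝ ψ q e') q e := by
  funext q
  have hd : DifferentiableAt ℝ (fderiv ℝ ψ) q :=
    ((hψ.fderiv_right (m := ∞) le_rfl).differentiable (by simp)) q
  have hs : IsSymmSndFDerivAt ℝ ψ q := hψ.contDiffAt.isSymmSndFDerivAt (by simp; exact ENat.LEInfty.out)
  rw [fderiv_clm_apply hd (by fun_prop), fderiv_clm_apply hd (by fun_prop)]
  simp
  exact hs e' e

section Jet

variable {Ω : Set E3} {τ : ℝ} {T Tt : ℝ × E3 → ℝ} {Td : Fin 3 → ℝ × E3 → ℝ}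
  {Tdd : Fin 3 → Fin 3 → ℝ × E3 → ℝ}

/-- No mixed derivative `T_{x_j t}` is at hand. Both derivatives are put on the test function and
commuted, then the time derivative is returned to `T`, so that only `T_t` occurs. -/
theorem ParabolicJet.dilPair_dirT_space (hc : Convex ℝ Ω) (hT : ParabolicJet Ω τ T Tt Td Tdd)
    {ψ : ℝ × E3 → ℝ} (hψ : IsTestFun (cylinder Ω τ) ψ) {p : ℝ × E3} (hp : p ∈ cylinder Ω τ)
    {k : ℝ} (hk : 1 ≤ k) (j : Fin 3) :
    dilPair (cylinder Ω τ) p (Td j) (fun q => fderiv ℝ ψ q dirT) k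
      = k⁻¹ * dilPair (cylinder Ω τ) p Tt (fun q => fderiv ℝ ψ q (dirX j)) k := by
  have h1 := dilPair_dirX hc (hT.space j) (hψ.fderiv_apply dirT) hp hk
  rw [fderiv_fderiv_comm hψ.contDiff, dilPair_dirT hc hT.time (hψ.fderiv_apply (dirX j)) hp hk]
    at h1
  have hk0 : k ≠ 0 := by positivity
  have h2 := neg_injective h1
  field_simp at h2
  rw [h2, inv_mul_cancel_left₀ hk0]

/-- Averages of the first order Taylor polynomials of `T`, evaluated at the point `p`. -/
def taylorMean (Ω : Set E3) (τ : ℝ) (p : ℝ × E3) (η T : ℝ × E3 → ℝ) (Td : Fin 3 → ℝ × E3 → ℝ)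
    (k : ℝ) : ℝ :=
  dilPair (cylinder Ω τ) p T η k
    - k⁻¹ * ∑ j, dilPair (cylinder Ω τ) p (Td j) (fun q => (q.2 j - p.2 j) * η q) k

/-- The remainder which controls the derivative of `taylorMean`. -/
def taylorRem (Ω : Set E3) (τ : ℝ) (p : ℝ × E3) (η Tt : ℝ × E3 → ℝ)
    (Tdd : Fin 3 → Fin 3 → ℝ × E3 → ℝ) (k : ℝ) : ℝ :=
  2 * dilPair (cylinder Ω τ) p Tt (fun q => (q.1 - p.1) * η q) k
    + ∑ j, (2 * dilPair (cylinder Ω τ) p Tt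
        (fun q => fderiv ℝ (fun q => (q.1 - p.1) * ((q.2 j - p.2 j) * η q)) q (dirX j)) k
      - ∑ i, dilPair (cylinder Ω τ) p (Tdd j i)
          (fun q => (q.2 i - p.2 i) * ((q.2 j - p.2 j) * η q)) k)

/-- Differentiating the plain mean produces a gradient term of size `k⁻²` only. Differentiating the
factor `k⁻¹` of the correction produces the same term with opposite sign; what is left involves
`T_t` and second derivatives and is of size `k⁻³`. -/
theorem ParabolicJet.hasDerivAt_taylorMean (hc : Convex ℝ Ω) (hb : Bornology.IsBounded Ω)
    (hT : ParabolicJet Ω τ T Tt Td Tdd) {η : ℝ × E3 → ℝ} (hη : IsTestFun (cylinder Ω τ) η)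
    {p : ℝ × E3} (hp : p ∈ cylinder Ω τ) {k : ℝ} (hk : 1 ≤ k) :
    HasDerivAt (taylorMean Ω τ p η T Td) (-((k ^ 3)⁻¹ * taylorRem Ω τ p η Tt Tdd k)) k := by
  have hk0 : 0 < k := by linarith
  have hT0 := integrableOn_cylinder hb hT.memLp
  have hTd := fun j => integrableOn_cylinder hb (hT.space j).1
  have h := (hasDerivAt_dilPair hT0 hη p hk0).sub
    ((hasDerivAt_inv hk0.ne').mul
      (HasDerivAt.fun_sum fun j (_ : j ∈ Finset.univ) =>
        hasDerivAt_dilPair (hTd j) (hη.space_mul p j) p hk0))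
  refine h.congr_deriv ?_
  have e1 : dilPair (cylinder Ω τ) p T (eulerD p η) k
      = -(2 * ((k ^ 2)⁻¹ * dilPair (cylinder Ω τ) p Tt (fun q => (q.1 - p.1) * η q) k))
        - k⁻¹ * ∑ j, dilPair (cylinder Ω τ) p (Td j) (fun q => (q.2 j - p.2 j) * η q) k := by
    rw [dilPair_eulerD hT0 hη, dilPair_dirT hc hT.time (hη.time_mul p) hp hk, Finset.mul_sum,
      Finset.sum_congr rfl fun j _ => dilPair_dirX hc (hT.space j) (hη.space_mul p j) hp hk,
      Finset.sum_neg_distrib]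
    ring
  have e2 : ∀ j, dilPair (cylinder Ω τ) p (Td j) (eulerD p fun q => (q.2 j - p.2 j) * η q) k
      = k⁻¹ * (2 * dilPair (cylinder Ω τ) p Tt
        (fun q => fderiv ℝ (fun q => (q.1 - p.1) * ((q.2 j - p.2 j) * η q)) q (dirX j)) k
      - ∑ i, dilPair (cylinder Ω τ) p (Tdd j i)
          (fun q => (q.2 i - p.2 i) * ((q.2 j - p.2 j) * η q)) k) := fun j => by
    rw [dilPair_eulerD (hTd j) (hη.space_mul p j),
      hT.dilPair_dirT_space hc ((hη.space_mul p j).time_mul p) hp hk j,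
      Finset.sum_congr rfl fun i _ =>
        dilPair_dirX hc (hT.space_space j i) ((hη.space_mul p j).space_mul p i) hp hk,
      Finset.sum_neg_distrib, ← Finset.mul_sum]
    ring
  simp only [e1, e2, taylorRem]
  rw [← Finset.mul_sum, ← Finset.mul_sum]
  field_simp
  ring

theorem ParabolicJet.continuousOn_taylorRem (hb : Bornology.IsBounded Ω)
    (hT : ParabolicJet Ω τ T Tt Td Tdd) {η : ℝ × E3 → ℝ} (hη : IsTestFun (cylinder Ω τ) η)
    (p : ℝ × E3) : ContinuousOn (taylorRem Ω τ p η Tt Tdd) (Ioi 0) := by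
  have hTt := integrableOn_cylinder hb hT.time.1
  unfold taylorRem
  refine ((continuousOn_dilPair hTt (hη.time_mul p) p).const_mul 2).add
    (continuousOn_finsetSum _ fun j _ => ((continuousOn_dilPair hTt
      (((hη.space_mul p j).time_mul p).fderiv_apply (dirX j)) p).const_mul 2).sub
    (continuousOn_finsetSum _ fun i _ => continuousOn_dilPair
      (integrableOn_cylinder hb (hT.space_space j i).1) ((hη.space_mul p j).space_mul p i) p))

end Jet

/-! ### Kernels and bounds for the Taylor means -/

/-- A normalized test function together with uniform bounds for the kernels which it generates. -/
structure IsKernel (U : Set (ℝ × E3)) (R M : ℝ) (η : ℝ × E3 → ℝ) : Prop where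
  isTestFun : IsTestFun U η
  integral_eq_one : ∫ q, η q = 1
  dist_le : ∀ q ∈ U, ∀ q' ∈ U, dist q q' ≤ R
  le : ∀ q, ‖η q‖ ≤ M
  time_le : ∀ p ∈ U, ∀ q ∈ U, ‖(q.1 - p.1) * η q‖ ≤ M
  space_le : ∀ p ∈ U, ∀ q ∈ U, ∀ j, ‖(q.2 j - p.2 j) * η q‖ ≤ M
  fderiv_le : ∀ p ∈ U, ∀ q ∈ U, ∀ j,
    ‖fderiv ℝ (fun q => (q.1 - p.1) * ((q.2 j - p.2 j) * η q)) q (dirX j)‖ ≤ M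
  space_space_le : ∀ p ∈ U, ∀ q ∈ U, ∀ i j,
    ‖(q.2 i - p.2 i) * ((q.2 j - p.2 j) * η q)‖ ≤ M

theorem exists_isKernel {U : Set (ℝ × E3)} (hU : IsOpen U) (hne : U.Nonempty)
    (hb : Bornology.IsBounded U) : ∃ R M η, IsKernel U R M η := by
  obtain ⟨p₀, hp₀⟩ := hne
  obtain ⟨ε, hε, hball⟩ := Metric.isOpen_iff.1 hU p₀ hp₀
  let f : ContDiffBump p₀ := ⟨ε / 4, ε / 2, by positivity, by linarith⟩
  have hη : IsTestFun U (f.normed volume) := by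
    refine ⟨f.contDiff_normed, f.hasCompactSupport_normed, ?_⟩
    rw [f.tsupport_normed_eq]
    exact (Metric.closedBall_subset_ball (half_lt_self hε)).trans hball
  obtain ⟨R₀, hR₀⟩ := Metric.isBounded_iff.1 hb
  obtain ⟨m₀, hm₀⟩ := hη.exists_bound
  choose m hm using fun j => (hη.fderiv_apply (dirX j)).exists_bound
  set η := f.normed volume with hηdef
  set R := max R₀ 0 with hRdef
  have hR : ∀ q ∈ U, ∀ q' ∈ U, dist q q' ≤ R := fun q hq q' hq' =>
    (hR₀ hq hq').trans (le_max_left _ _)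
  have hR0 : 0 ≤ R := le_max_right _ _
  set m' := 1 + ‖m₀‖ + ∑ j, ‖m j‖ with hm'
  have hsum : ∀ j, ‖m j‖ ≤ ∑ j, ‖m j‖ := fun j =>
    Finset.single_le_sum (f := fun j => ‖m j‖) (fun _ _ => norm_nonneg _) (Finset.mem_univ j)
  have hs0 : 0 ≤ ∑ j, ‖m j‖ := Finset.sum_nonneg fun _ _ => norm_nonneg _
  have hm1 : 1 ≤ m' := by have := norm_nonneg m₀; linarith
  have hm'0 : 0 ≤ m' := by linarith
  have hle : ∀ q, ‖η q‖ ≤ m' := fun q => by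
    have := (hm₀ q).trans (Real.le_norm_self m₀)
    linarith
  have hle' : ∀ j q, ‖fderiv ℝ η q (dirX j)‖ ≤ m' := fun j q => by
    have := (hm j q).trans (Real.le_norm_self _)
    have := hsum j
    have := norm_nonneg m₀
    linarith
  have ht : ∀ p ∈ U, ∀ q ∈ U, ‖q.1 - p.1‖ ≤ R := fun p hp q hq => by
    have := hR q hq p hp
    rw [Prod.dist_eq, max_le_iff, dist_eq_norm] at this
    exact this.1
  have hx : ∀ p ∈ U, ∀ q ∈ U, ∀ j, ‖q.2 j - p.2 j‖ ≤ R := fun p hp q hq j => by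
    have := hR q hq p hp
    rw [Prod.dist_eq, max_le_iff, dist_eq_norm q.2] at this
    exact (PiLp.norm_apply_le (q.2 - p.2) j).trans this.2
  -- Coordinate differences are at most `R`, while `η` and its first space derivatives are at most
  -- `m'`; the products that occur have at most two coordinate factors.
  refine ⟨R, (1 + R + R ^ 2) * m', η, hη, f.integral_normed, hR, fun q => ?_,
    fun p hp q hq => ?_, fun p hp q hq j => ?_, fun p hp q hq j => ?_, fun p hp q hq i j => ?_⟩
  · exact (hle q).trans (le_mul_of_one_le_left hm'0 (by nlinarith))
  · rw [norm_mul]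
    calc _ ≤ R * m' := mul_le_mul (ht p hp q hq) (hle q) (norm_nonneg _) hR0
      _ ≤ _ := by gcongr; nlinarith
  · rw [norm_mul]
    calc _ ≤ R * m' := mul_le_mul (hx p hp q hq j) (hle q) (norm_nonneg _) hR0
      _ ≤ _ := by gcongr; nlinarith
  · have hd := hη.contDiff.differentiable (by simp)
    rw [fderiv_time_mul ((hη.space_mul p j).contDiff.differentiable (by simp)),
      fderiv_space_mul hd]
    have e1 : (dirX j).1 = 0 := rfl
    have e2 : (dirX j).2 j = 1 := by simp [dirX]
    rw [e1, e2, mul_zero, add_zero, mul_one, norm_mul]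
    have h1 : ‖(q.2 j - p.2 j) * fderiv ℝ η q (dirX j) + η q‖ ≤ R * m' + m' := by
      refine (norm_add_le _ _).trans (add_le_add ?_ (hle q))
      rw [norm_mul]
      exact mul_le_mul (hx p hp q hq j) (hle' j q) (norm_nonneg _) hR0
    calc _ ≤ R * (R * m' + m') := mul_le_mul (ht p hp q hq) h1 (norm_nonneg _) hR0
      _ ≤ _ := by nlinarith
  · rw [norm_mul, norm_mul]
    calc _ ≤ R * (R * m') := mul_le_mul (hx p hp q hq i)
          (mul_le_mul (hx p hp q hq j) (hle q) (norm_nonneg _) hR0) (by positivity) hR0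
      _ ≤ _ := by nlinarith

theorem integral_comp_dilate {η : ℝ × E3 → ℝ} (hc : Continuous η) (hs : HasCompactSupport η)
    (p : ℝ × E3) {k : ℝ} (hk : 0 < k) : ∫ z, k ^ 5 * η (dilate p k z) = ∫ q, η q := by
  have h1 : ∀ s : ℝ, ∫ y : E3, η (s, p.2 + k • (y - p.2)) = (k ^ 3)⁻¹ * ∫ y, η (s, y) := fun s => by
    rw [integral_sub_right_eq_self (fun y => η (s, p.2 + k • y)) p.2,
      Measure.integral_comp_smul volume (fun y => η (s, p.2 + y)) k,
      integral_add_left_eq_self (fun y => η (s, y)) p.2]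
    simp [abs_of_pos hk]
  have h2 : ∀ f : ℝ → ℝ, ∫ s, f (p.1 + k ^ 2 * (s - p.1)) = (k ^ 2)⁻¹ * ∫ s, f s := fun f => by
    rw [integral_sub_right_eq_self (fun s => f (p.1 + k ^ 2 * s)) p.1,
      Measure.integral_comp_mul_left (fun s => f (p.1 + s)) (k ^ 2),
      integral_add_left_eq_self f p.1]
    simp
  have hη : Integrable η := hc.integrable_of_hasCompactSupport hs
  have hint : Integrable (fun z => k ^ 5 * η (dilate p k z)) :=
    ((hc.comp (continuous_dilate p k)).integrable_of_hasCompactSupport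
      (hs.comp_homeomorph (dilateHomeomorph p hk.ne'))).const_mul _
  rw [Measure.volume_eq_prod] at hint hη ⊢
  rw [integral_prod _ hint, integral_prod _ hη]
  simp only [integral_const_mul, dilate, h1]
  rw [h2 fun s => ∫ y, η (s, y)]
  field_simp

section Estimates

variable {Ω : Set E3} {τ R M : ℝ} {T Tt η : ℝ × E3 → ℝ} {Td : Fin 3 → ℝ × E3 → ℝ}
  {Tdd : Fin 3 → Fin 3 → ℝ × E3 → ℝ} {h : ℝ × E3 → ℝ≥0∞}

theorem IsKernel.dilPair_one (hc : Convex ℝ Ω) (hη : IsKernel (cylinder Ω τ) R M η)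
    {p : ℝ × E3} (hp : p ∈ cylinder Ω τ) {k : ℝ} (hk : 1 ≤ k) :
    dilPair (cylinder Ω τ) p (fun _ => 1) η k = 1 := by
  have ht := hη.isTestFun
  simp only [dilPair, mul_one]
  rw [setIntegral_eq_integral_of_forall_compl_eq_zero fun z hz =>
    (ht.comp_dilate hc hp hk).eq_zero hz,
    integral_comp_dilate ht.continuous ht.hasCompactSupport p (by linarith), hη.integral_eq_one]

/-- The factor counts the pairings: `17 = 2 + 3 (2 + 3)`. -/
theorem enorm_taylorRem_le (hη : IsKernel (cylinder Ω τ) R M η) {p : ℝ × E3}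
    (hp : p ∈ cylinder Ω τ) {l : ℝ} (hl : 0 < l)
    (hTt : ∀ᵐ z ∂(volume.restrict (cylinder Ω τ)), ‖Tt z‖ₑ ≤ h z)
    (hTdd : ∀ i j, ∀ᵐ z ∂(volume.restrict (cylinder Ω τ)), ‖Tdd i j z‖ₑ ≤ h z) :
    ‖taylorRem Ω τ p η Tt Tdd l⁻¹‖ₑ
      ≤ 17 * ENNReal.ofReal M * boxAvg (volume.restrict (cylinder Ω τ)) R h l p := by
  have ht := hη.isTestFun
  set B := ENNReal.ofReal M * boxAvg (volume.restrict (cylinder Ω τ)) R h l p with hB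
  have h1 := enorm_dilPair_le hη.dist_le (ht.time_mul p) (hη.time_le p hp) hp hl hTt
  have h2 := fun j => enorm_dilPair_le hη.dist_le
    (((ht.space_mul p j).time_mul p).fderiv_apply (dirX j))
    (fun q hq => hη.fderiv_le p hp q hq j) hp hl hTt
  have h3 := fun i j => enorm_dilPair_le hη.dist_le ((ht.space_mul p j).space_mul p i)
    (fun q hq => hη.space_space_le p hp q hq i j) hp hl (hTdd j i)
  have two : ‖(2 : ℝ)‖ₑ = 2 := by simp [enorm_eq_nnnorm]
  have h4 : ∀ j, ‖2 * dilPair (cylinder Ω τ) p Tt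
        (fun q => fderiv ℝ (fun q => (q.1 - p.1) * ((q.2 j - p.2 j) * η q)) q (dirX j)) l⁻¹
      - ∑ i, dilPair (cylinder Ω τ) p (Tdd j i)
          (fun q => (q.2 i - p.2 i) * ((q.2 j - p.2 j) * η q)) l⁻¹‖ₑ ≤ 2 * B + 3 * B := fun j => by
    refine enorm_sub_le.trans (add_le_add ?_ ?_)
    · rw [enorm_mul, two]
      gcongr
      exact h2 j
    · refine (enorm_sum_le _ _).trans ((Finset.sum_le_sum fun i _ => h3 i j).trans_eq ?_)
      simp [hB]
  calc _ ≤ 2 * B + ∑ _j : Fin 3, (2 * B + 3 * B) := by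
        refine (enorm_add_le _ _).trans (add_le_add ?_ ?_)
        · rw [enorm_mul, two]
          gcongr
        · exact (enorm_sum_le _ _).trans (Finset.sum_le_sum fun j _ => h4 j)
    _ = 17 * B := by
        simp only [Finset.sum_const, Finset.card_univ, Fintype.card_fin, nsmul_eq_mul]
        push_cast
        ring
    _ = _ := (mul_assoc _ _ _).symm

theorem enorm_taylorMean_corr_le (hη : IsKernel (cylinder Ω τ) R M η) {p : ℝ × E3}
    (hp : p ∈ cylinder Ω τ) {l : ℝ} (hl : 0 < l)
    (hTd : ∀ i, ∀ᵐ z ∂(volume.restrict (cylinder Ω τ)), ‖Td i z‖ₑ ≤ h z) :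
    ‖∑ j, dilPair (cylinder Ω τ) p (Td j) (fun q => (q.2 j - p.2 j) * η q) l⁻¹‖ₑ
      ≤ 3 * (ENNReal.ofReal M * boxAvg (volume.restrict (cylinder Ω τ)) R h l p) := by
  refine (enorm_sum_le _ _).trans ((Finset.sum_le_sum fun j _ => enorm_dilPair_le hη.dist_le
    (hη.isTestFun.space_mul p j) (fun q hq => hη.space_le p hp q hq j) hp hl (hTd j)).trans_eq ?_)
  simp

theorem enorm_taylorMean_one_le (hη : IsKernel (cylinder Ω τ) R M η) {p : ℝ × E3}
    (hp : p ∈ cylinder Ω τ)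
    (hT : ∀ᵐ z ∂(volume.restrict (cylinder Ω τ)), ‖T z‖ₑ ≤ h z)
    (hTd : ∀ i, ∀ᵐ z ∂(volume.restrict (cylinder Ω τ)), ‖Td i z‖ₑ ≤ h z) :
    ‖taylorMean Ω τ p η T Td 1‖ₑ
      ≤ 4 * ENNReal.ofReal M * ∫⁻ z in cylinder Ω τ, h z := by
  have h1 := enorm_dilPair_le hη.dist_le hη.isTestFun (fun q _ => hη.le q) hp one_pos hT
  have h2 := enorm_taylorMean_corr_le (Td := Td) hη hp one_pos hTd
  have h3 := boxAvg_le (μ := volume.restrict (cylinder Ω τ)) R h 1 p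
  simp only [inv_one, ENNReal.ofReal_one, one_pow, one_mul] at h1 h2 h3
  rw [taylorMean, inv_one, one_mul]
  calc _ ≤ _ := enorm_sub_le
    _ ≤ _ := add_le_add h1 h2
    _ = 4 * ENNReal.ofReal M * boxAvg (volume.restrict (cylinder Ω τ)) R h 1 p := by ring
    _ ≤ _ := by gcongr

/-- The fundamental theorem of calculus between the scales `r⁸` and `1`. With `k = s⁻⁸` the weight
`k⁻³ dk` becomes `8 s¹⁵ ds`, the weight of the potential, and `136 = 8 · 17`. -/
theorem ParabolicJet.enorm_taylorMean_le (hc : Convex ℝ Ω) (hb : Bornology.IsBounded Ω)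
    (hT : ParabolicJet Ω τ T Tt Td Tdd) (hη : IsKernel (cylinder Ω τ) R M η) {p : ℝ × E3}
    (hp : p ∈ cylinder Ω τ)
    (hTt : ∀ᵐ z ∂(volume.restrict (cylinder Ω τ)), ‖Tt z‖ₑ ≤ h z)
    (hTdd : ∀ i j, ∀ᵐ z ∂(volume.restrict (cylinder Ω τ)), ‖Tdd i j z‖ₑ ≤ h z)
    {r : ℝ} (hr : 0 < r) (hr1 : r < 1) :
    ‖taylorMean Ω τ p η T Td (r ^ 8)⁻¹‖ₑ ≤ ‖taylorMean Ω τ p η T Td 1‖ₑ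
      + 136 * ENNReal.ofReal M * boxPotential (volume.restrict (cylinder Ω τ)) R h p := by
  have hpos : ∀ s ∈ Icc r 1, 0 < s := fun s hs => hr.trans_le hs.1
  have hd : ∀ s ∈ uIcc r 1, HasDerivAt (fun s => taylorMean Ω τ p η T Td (s ^ 8)⁻¹)
      (8 * s ^ 15 * taylorRem Ω τ p η Tt Tdd (s ^ 8)⁻¹) s := fun s hs => by
    rw [uIcc_of_le hr1.le] at hs
    have hs0 := hpos s hs
    have h8 : (1 : ℝ) ≤ (s ^ 8)⁻¹ := one_le_inv₀ (by positivity) |>.2 (pow_le_one₀ hs0.le hs.2)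
    have h1 := (hT.hasDerivAt_taylorMean hc hb hη.isTestFun hp h8).comp s
      ((hasDerivAt_pow 8 s).fun_inv (by positivity))
    refine h1.congr_deriv ?_
    push_cast
    field_simp
  have hcont : ContinuousOn (fun s => 8 * s ^ 15 * taylorRem Ω τ p η Tt Tdd (s ^ 8)⁻¹)
      (uIcc r 1) := by
    rw [uIcc_of_le hr1.le]
    refine ContinuousOn.mul (by fun_prop) ?_
    refine (hT.continuousOn_taylorRem hb hη.isTestFun p).comp
      (ContinuousOn.inv₀ (by fun_prop) fun s hs => (pow_pos (hpos s hs) 8).ne') fun s hs => ?_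
    exact inv_pos.2 (pow_pos (hpos s hs) 8)
  have hftc := intervalIntegral.integral_eq_sub_of_hasDerivAt hd hcont.intervalIntegrable
  simp only [one_pow, inv_one] at hftc
  have h2 : taylorMean Ω τ p η T Td (r ^ 8)⁻¹ = taylorMean Ω τ p η T Td 1
      - ∫ s in r..1, 8 * s ^ 15 * taylorRem Ω τ p η Tt Tdd (s ^ 8)⁻¹ := by
    rw [hftc]; ring
  rw [h2]
  refine enorm_sub_le.trans (add_le_add le_rfl ?_)
  rw [intervalIntegral.integral_of_le hr1.le, boxPotential,
    ← lintegral_const_mul' _ _ (by finiteness)]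
  calc _ ≤ ∫⁻ s in Ioc r 1, ‖8 * s ^ 15 * taylorRem Ω τ p η Tt Tdd (s ^ 8)⁻¹‖ₑ :=
        enorm_integral_le_lintegral_enorm _
    _ = ∫⁻ s in Ioo r 1, ‖8 * s ^ 15 * taylorRem Ω τ p η Tt Tdd (s ^ 8)⁻¹‖ₑ :=
        setLIntegral_congr Ioo_ae_eq_Ioc.symm
    _ ≤ ∫⁻ s in Ioo r 1, 136 * ENNReal.ofReal M * (ENNReal.ofReal s ^ 15
          * boxAvg (volume.restrict (cylinder Ω τ)) R h (s ^ 8) p) := by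
        refine setLIntegral_mono' measurableSet_Ioo fun s hs => ?_
        have hs0 : 0 < s := hr.trans hs.1
        have h3 := enorm_taylorRem_le hη hp (pow_pos hs0 8) hTt hTdd
        have h4 : ‖(8 : ℝ)‖ₑ = 8 := by simp [enorm_eq_nnnorm]
        rw [enorm_mul, enorm_mul, enorm_pow, h4, Real.enorm_of_nonneg hs0.le]
        calc _ ≤ 8 * ENNReal.ofReal s ^ 15 * (17 * ENNReal.ofReal M
              * boxAvg (volume.restrict (cylinder Ω τ)) R h (s ^ 8) p) := by gcongr
          _ = _ := by ring
    _ ≤ _ := lintegral_mono_set (Ioo_subset_Ioo_left hr.le)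

end Estimates

/-! ### Passage from the Taylor means to the function -/

section Convergence

variable {Ω : Set E3} {τ R M : ℝ} {T Tt η : ℝ × E3 → ℝ} {Td : Fin 3 → ℝ × E3 → ℝ}
  {Tdd : Fin 3 → Fin 3 → ℝ × E3 → ℝ} {h : ℝ × E3 → ℝ≥0∞}

theorem dist_le_of_mem_parabolicBox {l : ℝ} (hR : 0 ≤ R) (hl : 0 < l) (hl1 : l ≤ 1)
    {p z : ℝ × E3} (hz : z ∈ parabolicBox R l p) : dist z p ≤ l * R := by
  obtain ⟨h1, h2⟩ := mem_parabolicBox.1 hz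
  rw [Prod.dist_eq]
  refine max_le (h1.trans ?_) h2
  gcongr
  nlinarith

theorem boxAvg_const_le {μ : Measure (ℝ × E3)} (hμ : μ ≤ volume) {l : ℝ} (hl : 0 < l)
    (p : ℝ × E3) (c : ℝ≥0∞) : boxAvg μ R (fun _ => c) l p ≤ c * boxVolume R := by
  have hl0 : ENNReal.ofReal l ^ 5 ≠ 0 := by positivity
  have hl1 : ENNReal.ofReal l ^ 5 ≠ ⊤ := by finiteness
  rw [boxAvg, setLIntegral_const]
  calc _ ≤ (ENNReal.ofReal l ^ 5)⁻¹ * (c * (ENNReal.ofReal l ^ 5 * boxVolume R)) := by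
        rw [← volume_parabolicBox hl p]
        gcongr
    _ = ((ENNReal.ofReal l ^ 5)⁻¹ * ENNReal.ofReal l ^ 5) * (c * boxVolume R) := by ring
    _ = _ := by rw [ENNReal.inv_mul_cancel hl0 hl1, one_mul]

/-- Pointwise control of the distance from `T` to its Taylor means by means of an approximation `c`
of `T`, with error `g`. -/
theorem enorm_sub_taylorMean_le (hc : Convex ℝ Ω) (hb : Bornology.IsBounded Ω)
    (hη : IsKernel (cylinder Ω τ) R M η) (hT : IntegrableOn T (cylinder Ω τ))
    (hTd : ∀ i, ∀ᵐ z ∂(volume.restrict (cylinder Ω τ)), ‖Td i z‖ₑ ≤ h z)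
    {c : ℝ × E3 → ℝ} {g : ℝ × E3 → ℝ≥0∞}
    (hg : ∀ᵐ z ∂(volume.restrict (cylinder Ω τ)), ‖T z - c z‖ₑ ≤ g z)
    {p : ℝ × E3} (hp : p ∈ cylinder Ω τ) {l : ℝ} (hl : 0 < l) (hl1 : l ≤ 1) {δ : ℝ≥0∞}
    (hδ : ∀ z ∈ parabolicBox R l p, ‖c z - c p‖ₑ ≤ δ) :
    ‖T p - taylorMean Ω τ p η T Td l⁻¹‖ₑ ≤ ENNReal.ofReal M *
      (boxAvg (volume.restrict (cylinder Ω τ)) R g l p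
        + (δ + ‖T p - c p‖ₑ) * boxVolume R
        + 3 * ENNReal.ofReal l * boxAvg (volume.restrict (cylinder Ω τ)) R h l p) := by
  set μ := volume.restrict (cylinder Ω τ) with hμdef
  have hμ : μ ≤ volume := Measure.restrict_le_self
  have hk : 1 ≤ l⁻¹ := (one_le_inv₀ hl).2 hl1
  have hfin : IsFiniteMeasure μ :=
    ⟨by rw [hμdef, Measure.restrict_apply_univ]; exact volume_cylinder_lt_top hb τ⟩
  have h1 : dilPair (cylinder Ω τ) p T η l⁻¹ - T p
      = dilPair (cylinder Ω τ) p (fun z => T z - T p) η l⁻¹ := by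
    have hone := hη.dilPair_one hc hp hk
    simp only [dilPair, mul_one] at hone
    have e : ∀ z, l⁻¹ ^ 5 * η (dilate p l⁻¹ z) * (T z - T p)
        = l⁻¹ ^ 5 * η (dilate p l⁻¹ z) * T z - l⁻¹ ^ 5 * η (dilate p l⁻¹ z) * T p :=
      fun z => mul_sub _ _ _
    have i2 : IntegrableOn (fun _ => T p) (cylinder Ω τ) := integrable_const (μ := μ) (T p)
    rw [dilPair, dilPair]
    simp only [e]
    rw [integral_sub (integrableOn_dilPair hT hη.isTestFun p _)
      (integrableOn_dilPair i2 hη.isTestFun p _), integral_mul_const, hone, one_mul]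
  have h2 : ‖dilPair (cylinder Ω τ) p (fun z => T z - T p) η l⁻¹‖ₑ
      ≤ ENNReal.ofReal M * boxAvg μ R (fun z => g z + (‖c z - c p‖ₑ + ‖T p - c p‖ₑ)) l p := by
    refine enorm_dilPair_le hη.dist_le hη.isTestFun (fun q _ => hη.le q) hp hl ?_
    filter_upwards [hg] with z hz
    have e : T z - T p = (T z - c z) + ((c z - c p) - (T p - c p)) := by ring
    rw [e]
    exact (enorm_add_le _ _).trans (add_le_add hz enorm_sub_le)
  have h3 : boxAvg μ R (fun z => g z + (‖c z - c p‖ₑ + ‖T p - c p‖ₑ)) l p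
      ≤ boxAvg μ R g l p + (δ + ‖T p - c p‖ₑ) * boxVolume R := by
    refine le_trans ?_ (add_le_add le_rfl (boxAvg_const_le hμ hl p _))
    rw [boxAvg, boxAvg, boxAvg, ← mul_add, ← lintegral_add_right _ measurable_const]
    refine mul_le_mul_right (setLIntegral_mono' (measurableSet_parabolicBox R l p) fun z hz => ?_) _
    gcongr
    exact hδ z hz
  have h4 := enorm_taylorMean_corr_le (Td := Td) hη hp hl hTd
  have h5 : T p - taylorMean Ω τ p η T Td l⁻¹
      = l * ∑ j, dilPair (cylinder Ω τ) p (Td j) (fun q => (q.2 j - p.2 j) * η q) l⁻¹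
        - (dilPair (cylinder Ω τ) p T η l⁻¹ - T p) := by
    rw [taylorMean, inv_inv]; ring
  rw [h5, h1]
  calc _ ≤ _ := enorm_sub_le
    _ ≤ ENNReal.ofReal l * (3 * (ENNReal.ofReal M * boxAvg μ R h l p))
        + ENNReal.ofReal M * (boxAvg μ R g l p + (δ + ‖T p - c p‖ₑ) * boxVolume R) := by
        rw [enorm_mul, Real.enorm_of_nonneg hl.le]
        gcongr
        exact h2.trans (by gcongr)
    _ = _ := by ring

/-- If the Taylor means of `T` are bounded by `G`, then so is `T`. -/
theorem ae_enorm_le_of_enorm_taylorMean_le (hΩ : IsC2ConvexDomain Ω)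
    (hη : IsKernel (cylinder Ω τ) R M η) (hT : IntegrableOn T (cylinder Ω τ))
    (hh : Measurable h) (hh1 : ∫⁻ z in cylinder Ω τ, h z ≠ ⊤)
    (hTd : ∀ i, ∀ᵐ z ∂(volume.restrict (cylinder Ω τ)), ‖Td i z‖ₑ ≤ h z)
    {G : ℝ × E3 → ℝ≥0∞} (hG : Measurable G)
    (hTG : ∀ p ∈ cylinder Ω τ, ∀ r : ℝ, 0 < r → r < 1 →
      ‖taylorMean Ω τ p η T Td (r ^ 8)⁻¹‖ₑ ≤ G p) :
    ∀ᵐ p ∂(volume.restrict (cylinder Ω τ)), ‖T p‖ₑ ≤ G p := by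
  set μ := volume.restrict (cylinder Ω τ) with hμdef
  have hμ : μ ≤ volume := Measure.restrict_le_self
  have hfin : IsFiniteMeasure μ :=
    ⟨by rw [hμdef, Measure.restrict_apply_univ]; exact volume_cylinder_lt_top hΩ.isBounded τ⟩
  have hmeas : MeasurableSet (cylinder Ω τ) := measurableSet_Ioo.prod hΩ.isOpen.measurableSet
  set V := boxVolume R with hV
  have hVt : V ≠ ⊤ := boxVolume_ne_top R
  set K : ℝ≥0∞ := ENNReal.ofReal M * (V * 1 + (μ univ + 1) * V + 3 * (V * ∫⁻ z, h z ∂μ)) with hK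
  have hKt : K ≠ ⊤ := by
    have := measure_ne_top μ univ
    finiteness
  -- This replaces Lebesgue differentiation along the boxes. The subtraction is truncated, so the
  -- integral is that of the positive part of `|T| - G`; `T` is approximated in `L¹` by a continuous
  -- function with compact support, and the averaged errors are controlled in `L¹`.
  have key : ∀ ε : ℝ, 0 < ε → ∫⁻ p, (‖T p‖ₑ - G p) ∂μ ≤ ENNReal.ofReal ε * K := by
    intro ε hε
    have hε0 : ENNReal.ofReal ε ≠ 0 := by positivity
    obtain ⟨c, hcs, hcT, hcc, -⟩ := hT.exists_hasCompactSupport_lintegral_sub_le hε0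
    have hTm : AEStronglyMeasurable (fun z => T z - c z) μ := hT.1.sub hcc.aestronglyMeasurable
    set g : ℝ × E3 → ℝ≥0∞ := fun z => ‖hTm.mk _ z‖ₑ with hgdef
    have hgm : Measurable g := hTm.stronglyMeasurable_mk.measurable.enorm
    have hgT : ∀ᵐ z ∂μ, ‖T z - c z‖ₑ = g z := by
      filter_upwards [hTm.ae_eq_mk] with z hz
      rw [hgdef]
      exact congrArg _ hz
    have hgε : ∫⁻ z, g z ∂μ ≤ ENNReal.ofReal ε := by
      rw [← lintegral_congr_ae hgT]
      exact hcT
    obtain ⟨d, hd, hcd⟩ := Metric.uniformContinuous_iff.1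
      (hcs.uniformContinuous_of_continuous hcc) ε hε
    -- The scale `r⁸` puts the box within the modulus of continuity of the approximation, and makes
    -- the first order correction at most a multiple of `ε`.
    obtain ⟨r, hr, hr1, hrR, hrε⟩ : ∃ r : ℝ, 0 < r ∧ r < 1 ∧ r ^ 8 * (|R| + 1) < d ∧
        r ^ 8 ≤ ε := by
      refine ⟨min (1 / 2) (min (d / (2 * (|R| + 1))) ε), by positivity,
        (min_le_left _ _).trans_lt (by norm_num), ?_, ?_⟩ <;>
      set r := min (1 / 2) (min (d / (2 * (|R| + 1))) ε) with hr
      · have h0 : 0 < r := by positivity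
        have h1 : r ≤ 1 := (min_le_left _ _).trans (by norm_num)
        have h2 : r ^ 8 ≤ r := pow_le_of_le_one h0.le h1 (by norm_num)
        have h3 : r ≤ d / (2 * (|R| + 1)) := (min_le_right _ _).trans (min_le_left _ _)
        calc r ^ 8 * (|R| + 1) ≤ d / (2 * (|R| + 1)) * (|R| + 1) := by gcongr; exact h2.trans h3
          _ = d / 2 := by field_simp
          _ < d := by linarith
      · have h0 : 0 < r := by positivity
        have h1 : r ≤ 1 := (min_le_left _ _).trans (by norm_num)
        exact (pow_le_of_le_one h0.le h1 (by norm_num)).trans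
          ((min_le_right _ _).trans (min_le_right _ _))
    have hl : 0 < r ^ 8 := pow_pos hr 8
    have hl1 : r ^ 8 ≤ 1 := pow_le_one₀ hr.le hr1.le
    have hpt : ∀ᵐ p ∂μ, ‖T p‖ₑ - G p ≤ ENNReal.ofReal M *
        (boxAvg μ R g (r ^ 8) p + (ENNReal.ofReal ε + g p) * V
          + 3 * ENNReal.ofReal ε * boxAvg μ R h (r ^ 8) p) := by
      filter_upwards [ae_restrict_mem hmeas, hgT] with p hp hgp
      have hR0 : 0 ≤ R := by simpa using hη.dist_le p hp p hp
      have hδ : ∀ z ∈ parabolicBox R (r ^ 8) p, ‖c z - c p‖ₑ ≤ ENNReal.ofReal ε := fun z hz => by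
        have h1 := dist_le_of_mem_parabolicBox hR0 hl hl1 hz
        have h2 : dist z p < d := by
          refine h1.trans_lt (lt_of_le_of_lt ?_ hrR)
          gcongr
          linarith [le_abs_self R]
        rw [← ofReal_norm, ← dist_eq_norm]
        exact ENNReal.ofReal_le_ofReal (hcd h2).le
      have h3 := enorm_sub_taylorMean_le hΩ.convex hΩ.isBounded hη hT hTd
        (hgT.mono fun z hz => hz.le) hp hl hl1 hδ
      have h4 : ‖T p‖ₑ ≤ ‖T p - taylorMean Ω τ p η T Td (r ^ 8)⁻¹‖ₑ + G p := by
        calc ‖T p‖ₑ = ‖(T p - taylorMean Ω τ p η T Td (r ^ 8)⁻¹)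
              + taylorMean Ω τ p η T Td (r ^ 8)⁻¹‖ₑ := by rw [sub_add_cancel]
          _ ≤ _ := (enorm_add_le _ _).trans (add_le_add le_rfl (hTG p hp r hr hr1))
      rw [hgp] at h3
      refine (tsub_le_iff_right.2 h4).trans (h3.trans ?_)
      gcongr
    have hm1 : Measurable (boxAvg μ R g (r ^ 8)) := measurable_boxAvg_right R hgm _
    have hm2 : Measurable (boxAvg μ R h (r ^ 8)) := measurable_boxAvg_right R hh _
    calc _ ≤ _ := lintegral_mono_ae hpt
      _ = ENNReal.ofReal M * (∫⁻ p, boxAvg μ R g (r ^ 8) p ∂μ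
          + (ENNReal.ofReal ε * μ univ + ∫⁻ p, g p ∂μ) * V
          + 3 * ENNReal.ofReal ε * ∫⁻ p, boxAvg μ R h (r ^ 8) p ∂μ) := by
          rw [lintegral_const_mul' _ _ (by finiteness), lintegral_add_right _ (hm2.const_mul _),
            lintegral_add_left hm1, lintegral_mul_const' _ _ hVt,
            lintegral_add_left measurable_const, lintegral_const,
            lintegral_const_mul' _ _ (by finiteness)]
      _ ≤ ENNReal.ofReal M * (V * ENNReal.ofReal ε
          + (ENNReal.ofReal ε * μ univ + ENNReal.ofReal ε) * V
          + 3 * ENNReal.ofReal ε * (V * ∫⁻ z, h z ∂μ)) := by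
          gcongr
          · exact (lintegral_boxAvg hμ R hgm hl).trans (by gcongr)
          · exact lintegral_boxAvg hμ R hh hl
      _ = _ := by rw [hK]; ring
  have hzero : ∫⁻ p, (‖T p‖ₑ - G p) ∂μ = 0 := by
    refine le_antisymm ?_ zero_le
    have hlim : Tendsto (fun ε : ℝ => ENNReal.ofReal ε * K) (𝓝[>] 0) (𝓝 0) := by
      have h1 : Tendsto (fun ε : ℝ => ENNReal.ofReal ε) (𝓝[>] 0) (𝓝 0) := by
        have := (ENNReal.continuous_ofReal.tendsto 0).mono_left
          (nhdsWithin_le_nhds (s := Ioi 0))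
        rwa [ENNReal.ofReal_zero] at this
      simpa using ENNReal.Tendsto.mul_const h1 (Or.inr hKt)
    refine ge_of_tendsto hlim ?_
    filter_upwards [self_mem_nhdsWithin] with ε hε using key ε hε
  have hm : AEMeasurable (fun p => ‖T p‖ₑ - G p) μ := hT.1.enorm.sub hG.aemeasurable
  filter_upwards [(lintegral_eq_zero_iff' hm).1 hzero] with p hp
  exact tsub_eq_zero_iff_le.1 hp

end Convergence

/-! ### The parabolic embedding into `L⁸` -/

theorem add_pow_eight_le (a b : ℝ≥0∞) : (a + b) ^ 8 ≤ 2 ^ 8 * (a ^ 8 + b ^ 8) := by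
  wlog h : a ≤ b generalizing a b
  · rw [add_comm a, add_comm (a ^ 8)]
    exact this b a (le_of_not_ge h)
  calc (a + b) ^ 8 ≤ (b + b) ^ 8 := by gcongr
    _ = 2 ^ 8 * b ^ 8 := by rw [← two_mul, mul_pow]
    _ ≤ _ := by gcongr; exact le_add_self

/-- The sum of `T` and its weak derivatives, in absolute value. -/
def jetSum (T Tt : ℝ × E3 → ℝ) (Td : Fin 3 → ℝ × E3 → ℝ) (Tdd : Fin 3 → Fin 3 → ℝ × E3 → ℝ)
    (z : ℝ × E3) : ℝ :=
  ‖T z‖ + ‖Tt z‖ + ∑ i, ‖Td i z‖ + ∑ i, ∑ j, ‖Tdd i j z‖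

section Jet

variable {Ω : Set E3} {τ : ℝ} {T Tt : ℝ × E3 → ℝ} {Td : Fin 3 → ℝ × E3 → ℝ}
  {Tdd : Fin 3 → Fin 3 → ℝ × E3 → ℝ}

theorem le_jetSum (z : ℝ × E3) : ‖T z‖ ≤ jetSum T Tt Td Tdd z ∧ ‖Tt z‖ ≤ jetSum T Tt Td Tdd z ∧
    (∀ i, ‖Td i z‖ ≤ jetSum T Tt Td Tdd z) ∧ ∀ i j, ‖Tdd i j z‖ ≤ jetSum T Tt Td Tdd z := by
  have h1 := norm_nonneg (T z)
  have h2 := norm_nonneg (Tt z)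
  have h3 : 0 ≤ ∑ i, ‖Td i z‖ := by positivity
  have h4 : 0 ≤ ∑ i, ∑ j, ‖Tdd i j z‖ := by positivity
  have h5 : ∀ i, ‖Td i z‖ ≤ ∑ i, ‖Td i z‖ := fun i =>
    Finset.single_le_sum (f := fun i => ‖Td i z‖) (fun _ _ => norm_nonneg _) (Finset.mem_univ i)
  have h6 : ∀ i j, ‖Tdd i j z‖ ≤ ∑ i, ∑ j, ‖Tdd i j z‖ := fun i j =>
    (Finset.single_le_sum (f := fun j => ‖Tdd i j z‖) (fun _ _ => norm_nonneg _)
      (Finset.mem_univ j)).trans (Finset.single_le_sum (f := fun i => ∑ j, ‖Tdd i j z‖)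
        (fun _ _ => Finset.sum_nonneg fun _ _ => norm_nonneg _) (Finset.mem_univ i))
  unfold jetSum
  exact ⟨by linarith, by linarith, fun i => by linarith [h5 i], fun i j => by linarith [h6 i j]⟩

/-- `f` is square integrable, with norm at most `a`. -/
def HasL2Bound {α : Type*} [MeasurableSpace α] (μ : Measure α) (f : α → ℝ) (a : ℝ) : Prop :=
  AEStronglyMeasurable f μ ∧ eLpNorm f 2 μ ≤ ENNReal.ofReal a ∧ 0 ≤ a

theorem HasL2Bound.add {α : Type*} [MeasurableSpace α] {μ : Measure α} {f g : α → ℝ} {a b : ℝ}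
    (hf : HasL2Bound μ f a) (hg : HasL2Bound μ g b) : HasL2Bound μ (fun z => f z + g z) (a + b) := by
  obtain ⟨h1, h2, h3⟩ := hf
  obtain ⟨h4, h5, h6⟩ := hg
  refine ⟨h1.add h4, ?_, add_nonneg h3 h6⟩
  rw [ENNReal.ofReal_add h3 h6]
  exact (eLpNorm_add_le h1 h4 one_le_two).trans (add_le_add h2 h5)

theorem HasL2Bound.sum {α ι : Type*} [MeasurableSpace α] {μ : Measure α} (s : Finset ι)
    {f : ι → α → ℝ} {a : ι → ℝ} (hf : ∀ i, HasL2Bound μ (f i) (a i)) :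
    HasL2Bound μ (fun z => ∑ i ∈ s, f i z) (∑ i ∈ s, a i) := by
  classical
  induction s using Finset.induction_on with
  | empty =>
    simp only [Finset.sum_empty]
    exact ⟨aestronglyMeasurable_const, by simp, le_rfl⟩
  | insert i s hi ih =>
    simp only [Finset.sum_insert hi]
    exact (hf i).add ih

theorem hasL2Bound_norm {α : Type*} [MeasurableSpace α] {μ : Measure α} {f : α → ℝ}
    (hf : MemLp f 2 μ) : HasL2Bound μ (fun z => ‖f z‖) (eLpNorm f 2 μ).toReal :=
  ⟨hf.1.norm, by rw [eLpNorm_norm, ENNReal.ofReal_toReal hf.2.ne], ENNReal.toReal_nonneg⟩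

theorem ParabolicJet.hasL2Bound_jetSum (hT : ParabolicJet Ω τ T Tt Td Tdd) :
    HasL2Bound (volume.restrict (cylinder Ω τ)) (jetSum T Tt Td Tdd)
      (normL2Q Ω τ T + normL2Q Ω τ Tt + ∑ i, normL2Q Ω τ (Td i)
        + ∑ i, ∑ j, normL2Q Ω τ (Tdd i j)) :=
  (((hasL2Bound_norm hT.memLp).add (hasL2Bound_norm hT.time.1)).add
    (.sum _ fun i => hasL2Bound_norm (hT.space i).1)).add
    (.sum _ fun i => .sum _ fun j => hasL2Bound_norm (hT.space_space i j).1)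

theorem MemW21.parabolicJet (hT : MemW21 Ω τ T) :
    ParabolicJet Ω τ T (weakDeriv (cylinder Ω τ) dirT T)
      (fun i => weakDeriv (cylinder Ω τ) (dirX i) T)
      (fun i j => weakDeriv (cylinder Ω τ) (dirX j) (weakDeriv (cylinder Ω τ) (dirX i) T)) := by
  have h : ∀ {e : ℝ × E3} {u : ℝ × E3 → ℝ}, HasL2WeakDeriv (cylinder Ω τ) e u →
      IsL2WeakDeriv (cylinder Ω τ) e u (weakDeriv (cylinder Ω τ) e u) := fun {e u} h => by
    rw [weakDeriv, dif_pos h]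
    exact h.choose_spec
  exact ⟨hT.memLp, h hT.time, fun i => h (hT.space i), fun i j => h (hT.space_space i j)⟩

end Jet

/-- The embedding of `W^{2,1}_2(Q_τ)` into `L⁸(Q_τ)`. -/
theorem parabolic_sobolev {Ω : Set E3} (hΩ : IsC2ConvexDomain Ω) {τ : ℝ} (hτ : 0 < τ) :
    ∃ C : ℝ, 0 < C ∧ ∀ T, MemW21 Ω τ T → ∫⁻ p in cylinder Ω τ, ‖T p‖ₑ ^ 8
      ≤ ENNReal.ofReal (C * normW21 Ω τ T) ^ 8 := by
  obtain ⟨R, M, η, hη⟩ := exists_isKernel (U := cylinder Ω τ) (isOpen_Ioo.prod hΩ.isOpen)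
    ((nonempty_Ioo.2 hτ).prod hΩ.nonempty) ((Metric.isBounded_Ioo 0 τ).prod hΩ.isBounded)
  have hmeas : MeasurableSet (cylinder Ω τ) := measurableSet_Ioo.prod hΩ.isOpen.measurableSet
  set μ := volume.restrict (cylinder Ω τ) with hμdef
  have hμ : μ ≤ volume := Measure.restrict_le_self
  have hfin : IsFiniteMeasure μ :=
    ⟨by rw [hμdef, Measure.restrict_apply_univ]; exact volume_cylinder_lt_top hΩ.isBounded τ⟩
  set A := ENNReal.ofReal M with hA
  set K : ℝ≥0∞ := 2 ^ 8 * ((4 * A) ^ 8 * μ univ ^ 5 + (136 * A) ^ 8 * boxVolume R ^ 5) with hK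
  have hKt : K ≠ ⊤ := by
    have := measure_ne_top μ univ
    have := boxVolume_ne_top R
    finiteness
  -- Adding `1` gives a base at least `1`, so its eighth power dominates `K` and no eighth root is
  -- needed.
  refine ⟨K.toReal + 1, by positivity, fun T hT => ?_⟩
  have hJ := hT.parabolicJet
  set Tt := weakDeriv (cylinder Ω τ) dirT T with hTt
  set Td := fun i => weakDeriv (cylinder Ω τ) (dirX i) T with hTd
  set Tdd := fun i j => weakDeriv (cylinder Ω τ) (dirX j) (weakDeriv (cylinder Ω τ) (dirX i) T)
    with hTdd
  obtain ⟨hjm, hjn, -⟩ := hJ.hasL2Bound_jetSum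
  have hnorm : normL2Q Ω τ T + normL2Q Ω τ Tt + ∑ i, normL2Q Ω τ (Td i)
        + ∑ i, ∑ j, normL2Q Ω τ (Tdd i j) = normW21 Ω τ T := rfl
  rw [hnorm] at hjn
  set N := ENNReal.ofReal (normW21 Ω τ T) with hN
  set h : ℝ × E3 → ℝ≥0∞ := fun z => ‖hjm.mk _ z‖ₑ with hh
  have hhm : Measurable h := hjm.stronglyMeasurable_mk.measurable.enorm
  have hae : ∀ᵐ z ∂μ, ‖jetSum T Tt Td Tdd z‖ₑ = h z := by
    filter_upwards [hjm.ae_eq_mk] with z hz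
    rw [hh]
    exact congrArg _ hz
  have hle : ∀ {v : ℝ × E3 → ℝ}, (∀ z, ‖v z‖ ≤ jetSum T Tt Td Tdd z) → ∀ᵐ z ∂μ, ‖v z‖ₑ ≤ h z :=
    fun {v} hv => by
      filter_upwards [hae] with z hz
      rw [← hz]
      exact enorm_le_iff_norm_le.2 ((hv z).trans (Real.le_norm_self _))
  have l1 := hle fun z => (le_jetSum (T := T) (Tt := Tt) (Td := Td) (Tdd := Tdd) z).1
  have l2 := hle fun z => (le_jetSum (T := T) (Tt := Tt) (Td := Td) (Tdd := Tdd) z).2.1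
  have l3 := fun i => hle fun z => (le_jetSum (T := T) (Tt := Tt) (Td := Td) (Tdd := Tdd) z).2.2.1 i
  have l4 := fun i j => hle fun z =>
    (le_jetSum (T := T) (Tt := Tt) (Td := Td) (Tdd := Tdd) z).2.2.2 i j
  have hH : ∫⁻ z, h z ^ 2 ∂μ ≤ N ^ 2 := by
    calc ∫⁻ z, h z ^ 2 ∂μ = ∫⁻ z, ‖jetSum T Tt Td Tdd z‖ₑ ^ 2 ∂μ :=
          lintegral_congr_ae (hae.mono fun z hz => congrArg (· ^ 2) hz.symm)
      _ = eLpNorm (jetSum T Tt Td Tdd) 2 μ ^ 2 := (eLpNorm_two_sq _).symm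
      _ ≤ N ^ 2 := by gcongr
  set D := ∫⁻ z, h z ∂μ with hD
  have hD8 : D ^ 8 ≤ μ univ ^ 4 * N ^ 8 := by
    calc D ^ 8 = (D ^ 2) ^ 4 := by rw [← pow_mul]
      _ ≤ (μ univ * N ^ 2) ^ 4 := by
        gcongr
        exact (sq_lintegral_le μ hhm.aemeasurable).trans (by gcongr)
      _ = _ := by rw [mul_pow, ← pow_mul]
  have hDt : D ≠ ⊤ := by
    intro hD'
    rw [hD', ENNReal.top_pow (by norm_num)] at hD8
    have := measure_ne_top μ univ
    exact absurd hD8 (not_le.2 (by finiteness))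
  -- The first term bounds the Taylor mean at unit scale, the second the variation over all smaller
  -- scales; the bound is uniform in the scale.
  set G : ℝ × E3 → ℝ≥0∞ := fun p => 4 * A * D + 136 * A * boxPotential μ R h p with hG
  have hbm : Measurable (boxPotential μ R h) := measurable_boxPotential R hhm
  have hGm : Measurable G := (hbm.const_mul _).const_add _
  have hTG : ∀ᵐ p ∂μ, ‖T p‖ₑ ≤ G p :=
    ae_enorm_le_of_enorm_taylorMean_le hΩ hη (integrableOn_cylinder hΩ.isBounded hJ.memLp) hhm hDt
      l3 hGm fun p hp r hr hr1 =>
        (hJ.enorm_taylorMean_le hΩ.convex hΩ.isBounded hη hp l2 l4 hr hr1).trans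
          (add_le_add (enorm_taylorMean_one_le hη hp l1 l3) le_rfl)
  have hfinal : ∫⁻ p, ‖T p‖ₑ ^ 8 ∂μ ≤ K * N ^ 8 := by
    calc ∫⁻ p, ‖T p‖ₑ ^ 8 ∂μ
        ≤ ∫⁻ p, 2 ^ 8 * ((4 * A * D) ^ 8 + (136 * A * boxPotential μ R h p) ^ 8) ∂μ := by
          refine lintegral_mono_ae (hTG.mono fun p hp => ?_)
          exact (pow_le_pow_left' hp 8).trans (add_pow_eight_le _ _)
      _ = 2 ^ 8 * ((4 * A) ^ 8 * D ^ 8 * μ univ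
            + (136 * A) ^ 8 * ∫⁻ p, boxPotential μ R h p ^ 8 ∂μ) := by
          simp only [mul_pow _ _ 8]
          rw [lintegral_const_mul' _ _ (by finiteness), lintegral_add_left measurable_const,
            lintegral_const, lintegral_const_mul' _ _ (by finiteness)]
      _ ≤ 2 ^ 8 * ((4 * A) ^ 8 * (μ univ ^ 4 * N ^ 8) * μ univ
            + (136 * A) ^ 8 * (boxVolume R ^ 5 * (N ^ 2) ^ 4)) := by
          gcongr
          exact (lintegral_boxPotential_pow_eight hμ hμ R hhm).trans (by gcongr)
      _ = K * N ^ 8 := by rw [hK]; ring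
  refine hfinal.trans ?_
  have hK8 : K ≤ ENNReal.ofReal (K.toReal + 1) ^ 8 := by
    rw [← ENNReal.ofReal_pow (by positivity)]
    refine (ENNReal.ofReal_toReal hKt).symm.le.trans (ENNReal.ofReal_le_ofReal ?_)
    have h0 : 0 ≤ K.toReal := ENNReal.toReal_nonneg
    exact (le_add_of_nonneg_right zero_le_one).trans (le_self_pow₀ (by linarith) (by norm_num))
  rw [ENNReal.ofReal_mul (by positivity), mul_pow]
  gcongr

/-! ### The source term and the time-dependent problem -/

theorem restrict_cylinder (Ω : Set E3) (τ : ℝ) :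
    volume.restrict (cylinder Ω τ) = (timeMeasure τ).prod (volume.restrict Ω) := by
  rw [timeMeasure, Measure.prod_restrict, cylinder, Measure.volume_eq_prod]

/-- The square of `T⁴` is the eighth power of `T`, and the source does not depend on the direction,
so integrating over the sphere contributes only its finite area `m`. The bound `m ≤ (m + 1)²` avoids
a square root. -/
theorem memLp_source {Ω : Set E3} {τ : ℝ} {T : ℝ × E3 → ℝ}
    (hT : AEStronglyMeasurable T (volume.restrict (cylinder Ω τ))) {B : ℝ≥0∞} (hB : B ≠ ⊤)
    (h8 : ∫⁻ p in cylinder Ω τ, ‖T p‖ₑ ^ 8 ≤ B ^ 8) :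
    MemLp (fun q : ℝ × (E3 × Dir) => T (q.1, q.2.1) ^ 4) 2
        ((timeMeasure τ).prod (phaseMeasure Ω)) ∧
      eLpNorm (fun q : ℝ × (E3 × Dir) => T (q.1, q.2.1) ^ 4) 2
        ((timeMeasure τ).prod (phaseMeasure Ω)) ≤ (dirMeasure univ + 1) * B ^ 4 := by
  rw [restrict_cylinder] at hT h8
  have hmp := measurePreserving_prodAssoc (timeMeasure τ) (volume.restrict Ω) dirMeasure
  have hmp' : MeasurePreserving MeasurableEquiv.prodAssoc.symm
      ((timeMeasure τ).prod (phaseMeasure Ω))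
      (((timeMeasure τ).prod (volume.restrict Ω)).prod dirMeasure) := hmp.symm
  have hm1 : AEStronglyMeasurable (fun p => T p ^ 4) ((timeMeasure τ).prod (volume.restrict Ω)) :=
    hT.pow 4
  have hm2 : AEStronglyMeasurable (fun q : (ℝ × E3) × Dir => T q.1 ^ 4)
      (((timeMeasure τ).prod (volume.restrict Ω)).prod dirMeasure) := hm1.comp_fst
  have hm3 : AEStronglyMeasurable (fun q : ℝ × (E3 × Dir) => T (q.1, q.2.1) ^ 4)
      ((timeMeasure τ).prod (phaseMeasure Ω)) :=
    hm2.comp_measurePreserving hmp'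
  have hsq : eLpNorm (fun q : ℝ × (E3 × Dir) => T (q.1, q.2.1) ^ 4) 2
      ((timeMeasure τ).prod (phaseMeasure Ω)) ^ 2 ≤ ((dirMeasure univ + 1) * B ^ 4) ^ 2 := by
    rw [eLpNorm_two_sq]
    have h1 : ∫⁻ q : ℝ × (E3 × Dir), ‖T (q.1, q.2.1) ^ 4‖ₑ ^ 2
          ∂((timeMeasure τ).prod (phaseMeasure Ω))
        = ∫⁻ q : (ℝ × E3) × Dir, ‖T q.1 ^ 4‖ₑ ^ 2
          ∂(((timeMeasure τ).prod (volume.restrict Ω)).prod dirMeasure) :=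
      (hmp'.lintegral_comp_emb MeasurableEquiv.prodAssoc.symm.measurableEmbedding
        (fun q : (ℝ × E3) × Dir => ‖T q.1 ^ 4‖ₑ ^ 2))
    rw [h1, lintegral_prod _ (hm2.enorm.pow_const 2)]
    simp only [lintegral_const]
    rw [lintegral_mul_const' _ _ (measure_ne_top _ _)]
    have h2 : ∀ p, ‖T p ^ 4‖ₑ ^ 2 = ‖T p‖ₑ ^ 8 := fun p => by rw [enorm_pow, ← pow_mul]
    simp only [h2]
    calc _ ≤ B ^ 8 * dirMeasure univ := by gcongr
      _ ≤ B ^ 8 * (dirMeasure univ + 1) ^ 2 := by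
        gcongr
        calc dirMeasure univ ≤ (dirMeasure univ + 1) * 1 := by rw [mul_one]; exact le_self_add
          _ ≤ (dirMeasure univ + 1) * (dirMeasure univ + 1) := by gcongr; exact le_add_self
          _ = _ := (sq _).symm
      _ = _ := by ring
  have hle := (ENNReal.pow_right_strictMono two_ne_zero).le_iff_le.1 hsq
  exact ⟨⟨hm3, hle.trans_lt (by finiteness)⟩, hle⟩

/-- A bounded operator `X × Y → Z` acts on pairs of square integrable functions. -/
theorem exists_compLp_prod {α X Y Z : Type*} [MeasurableSpace α] {μ : Measure α}
    [NormedAddCommGroup X] [NormedSpace ℝ X] [NormedAddCommGroup Y] [NormedSpace ℝ Y]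
    [NormedAddCommGroup Z] [NormedSpace ℝ Z] (S : X × Y →L[ℝ] Z) :
    ∃ C : ℝ, 0 ≤ C ∧ ∀ (f : Lp X 2 μ) (g : Lp Y 2 μ),
      ∃ I : Lp Z 2 μ, (∀ᵐ t ∂μ, I t = S (f t, g t)) ∧ ‖I‖ ≤ C * (‖f‖ + ‖g‖) := by
  refine ⟨‖S‖, norm_nonneg S, fun f g => ⟨(S.comp (ContinuousLinearMap.inl ℝ X Y)).compLp f
    + (S.comp (ContinuousLinearMap.inr ℝ X Y)).compLp g, ?_, ?_⟩⟩
  · filter_upwards [Lp.coeFn_add ((S.comp (ContinuousLinearMap.inl ℝ X Y)).compLp f)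
      ((S.comp (ContinuousLinearMap.inr ℝ X Y)).compLp g),
      (S.comp (ContinuousLinearMap.inl ℝ X Y)).coeFn_compLp f,
      (S.comp (ContinuousLinearMap.inr ℝ X Y)).coeFn_compLp g] with t h1 h2 h3
    rw [h1, Pi.add_apply, h2, h3]
    simp [← map_add]
  · have h1 : ‖S.comp (ContinuousLinearMap.inl ℝ X Y)‖ ≤ ‖S‖ :=
      (S.opNorm_comp_le _).trans
        (mul_le_of_le_one_right (norm_nonneg _) (ContinuousLinearMap.norm_inl_le_one ℝ X Y))
    have h2 : ‖S.comp (ContinuousLinearMap.inr ℝ X Y)‖ ≤ ‖S‖ :=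
      (S.opNorm_comp_le _).trans
        (mul_le_of_le_one_right (norm_nonneg _) (ContinuousLinearMap.norm_inr_le_one ℝ X Y))
    calc _ ≤ _ := norm_add_le _ _
      _ ≤ ‖S.comp (ContinuousLinearMap.inl ℝ X Y)‖ * ‖f‖
          + ‖S.comp (ContinuousLinearMap.inr ℝ X Y)‖ * ‖g‖ :=
        add_le_add (ContinuousLinearMap.norm_compLp_le _ f) (ContinuousLinearMap.norm_compLp_le _ g)
      _ ≤ ‖S‖ * ‖f‖ + ‖S‖ * ‖g‖ := by gcongr
      _ = _ := (mul_add _ _ _).symm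

/-- The source `T⁴` as a square integrable function of time with values in `L²(𝒳)`. -/
theorem exists_source {Ω : Set E3} (hΩ : IsC2ConvexDomain Ω) {τ : ℝ} (hτ : 0 < τ) :
    ∃ C : ℝ, 0 < C ∧ ∀ T : ℝ × E3 → ℝ, MemW21 Ω τ T →
      ∃ f : Lp (L2Phase Ω) 2 (timeMeasure τ),
        (∀ᵐ t ∂(timeMeasure τ), ∀ᵐ z ∂(phaseMeasure Ω), f t z = T (t, z.1) ^ 4) ∧
        ‖f‖ ≤ C * normW21 Ω τ T ^ 4 := by
  obtain ⟨K, hK, hsob⟩ := parabolic_sobolev hΩ hτ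
  have := isFiniteMeasure_phaseMeasure hΩ
  have : SFinite (timeMeasure τ) := by unfold timeMeasure; infer_instance
  refine ⟨((dirMeasure univ).toReal + 1) * K ^ 4, by positivity, fun T hT => ?_⟩
  have hW : 0 ≤ normW21 Ω τ T := by
    unfold normW21 normL2Q
    positivity
  obtain ⟨hF, hFn⟩ := memLp_source hT.memLp.1 ENNReal.ofReal_ne_top (hsob T hT)
  obtain ⟨f, hf, hfn⟩ := exists_curry_Lp hF
  refine ⟨f, hf, ?_⟩
  rw [← hfn] at hFn
  have h1 := ENNReal.toReal_mono (by finiteness) hFn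
  rw [toReal_enorm, ENNReal.toReal_mul, ENNReal.toReal_pow, ENNReal.toReal_ofReal (by positivity),
    ENNReal.toReal_add (by finiteness) (by finiteness), ENNReal.toReal_one, mul_pow,
    ← mul_assoc] at h1
  exact h1

theorem mul_add_le_mul_add {s K w b x : ℝ} (hs : 0 ≤ s) (hK : 0 ≤ K) (hw : 0 ≤ w) (hb : 0 ≤ b)
    (hx : x ≤ K * w) : s * (x + b) ≤ (s * (K + 1) + 1) * (w + b) := by
  calc s * (x + b) ≤ s * (K * w + b) := by gcongr
    _ ≤ s * (K * w + b) + (s * w + s * K * b + (w + b)) := le_add_of_nonneg_right (by positivity)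
    _ = _ := by ring

set_option maxHeartbeats 1000000 in
-- Time is only a parameter: the stationary solution operator is applied at almost every `t`, and
-- its boundedness and linearity give measurability and the norm estimate.
theorem exists_unique_solution {Ω : Set E3} (hΩ : IsC2ConvexDomain Ω) {τ : ℝ} (hτ : 0 < τ) :
    ∃ C : ℝ, 0 < C ∧ ∀ T : ℝ × E3 → ℝ, MemW21 Ω τ T →
      ∀ Ib : Lp (L2Minus Ω) 2 (timeMeasure τ),
        (∀ᵐ t ∂(timeMeasure τ), ∀ᵐ z ∂(boundaryMeasure Ω (-1)), 0 ≤ Ib t z) →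
        ∃ I : Lp (transportSpace Ω) 2 (timeMeasure τ), IsSolution Ω τ T Ib I ∧
          (∀ J : Lp (transportSpace Ω) 2 (timeMeasure τ), IsSolution Ω τ T Ib J → J = I) ∧
          (∀ᵐ t ∂(timeMeasure τ), ∀ᵐ z ∂(phaseMeasure Ω), 0 ≤ fn (I t) z) ∧
          ‖I‖ ≤ C * (normW21 Ω τ T ^ 4 + ‖Ib‖) := by
  obtain ⟨S, hS⟩ := exists_solution_operator hΩ
  obtain ⟨K, hK, hsrc⟩ := exists_source hΩ hτ
  obtain ⟨s, hs, hop⟩ := exists_compLp_prod (μ := timeMeasure τ) S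
  refine ⟨s * (K + 1) + 1, by positivity, fun T hT Ib hIb => ?_⟩
  obtain ⟨f, hf, hfn⟩ := hsrc T hT
  obtain ⟨I, hIt, hIn⟩ := hop f Ib
  refine ⟨I, ?_, fun J hJ => ?_, ?_, ?_⟩
  · filter_upwards [hIt, hf] with t h1 h2
    obtain ⟨⟨h3, h4⟩, -⟩ := hS (f t) (Ib t)
    rw [h1]
    generalize S (f t, Ib t) = w at h3 h4
    generalize f t = F at h2 h3
    refine ⟨?_, h4⟩
    filter_upwards [h2, Lp.coeFn_add (fn w) (dirD w)] with z h5 h6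
    rw [← Pi.add_apply, ← h6, h3, h5]
  · refine Lp.ext ?_
    filter_upwards [hIt, hf, hJ] with t h1 h2 h3
    rw [h1]
    -- At almost every time both functions solve the stationary problem with the same data.
    refine Solves.unique hΩ (F := f t) (g := Ib t) ⟨?_, h3.2⟩ (hS (f t) (Ib t)).1
    refine Lp.ext ?_
    filter_upwards [h2, h3.1, Lp.coeFn_add (fn (J t)) (dirD (J t))] with z h4 h5 h6
    rw [h4, h6, Pi.add_apply, h5]
  · filter_upwards [hIt, hf, hIb] with t h1 h2 h3
    rw [h1]
    refine (hS (f t) (Ib t)).2 ?_ h3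
    filter_upwards [h2] with z hz
    rw [hz]
    positivity
  · exact hIn.trans (mul_add_le_mul_add hs hK.le (by positivity) (norm_nonneg _) hfn)

end

end RadTransfer

theorem mainTheorem2 (Ω : Set RadTransfer.E3) (hΩ : RadTransfer.IsC2ConvexDomain Ω)
    (τ : ℝ) (hτ : 0 < τ) :
    ∃ C : ℝ, 0 < C ∧
      ∀ T : ℝ × RadTransfer.E3 → ℝ, RadTransfer.MemW21 Ω τ T →
      ∀ Ib : Lp (RadTransfer.L2Minus Ω) 2 (RadTransfer.timeMeasure τ),
        (∀ᵐ t ∂(RadTransfer.timeMeasure τ),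
          ∀ᵐ z ∂(RadTransfer.boundaryMeasure Ω (-1)), 0 ≤ Ib t z) →
        ∃ I : Lp (RadTransfer.transportSpace Ω) 2 (RadTransfer.timeMeasure τ),
          RadTransfer.IsSolution Ω τ T Ib I ∧
          (∀ J : Lp (RadTransfer.transportSpace Ω) 2 (RadTransfer.timeMeasure τ),
            RadTransfer.IsSolution Ω τ T Ib J → J = I) ∧
          (∀ᵐ t ∂(RadTransfer.timeMeasure τ),
            ∀ᵐ z ∂(RadTransfer.phaseMeasure Ω), 0 ≤ RadTransfer.fn (I t) z) ∧
          ‖I‖ ≤ C * (RadTransfer.normW21 Ω τ T ^ 4 + ‖Ib‖) :=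
  RadTransfer.exists_unique_solution hΩ hτ
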